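/- Let $k$ be a finite field with $q_k$ elements and let $\mathcal T$ be a skeletally small, idempotent complete triangulated $k$-category with shift $T$. Let $\mathcal G$ be its Grothendieck group: the quotient of the free abelian group on the isomorphism classes of objects by the relations $[X]+[Y]-[L]$, one for each exact triangle $Y\to L\to X\to TY$; write $h_X$ for the image of $[X]$ in $\mathcal G$. Assume that $\mathcal T$ is * finitary: all Hom sets are finite and, for each $h\in\mathcal G$, there are up to isomorphism and shift only finitely many indecomposable objects $X$ with $h_X=h$; * 2-periodic: $T^2\cong 1$ as functors; * with proper Grothendieck group: $h_X\neq0$ in $\mathcal G$ for every indecomposable $X$. For indecomposable $X$ put $d(X)=\dim_k(\operatorname{End}X/\operatorname{rad}\operatorname{End}X)$ and $\tilde h_X=h_X/d(X)\in\mathbb Q\otimes_{\mathbb Z}\mathcal G$. Let $\mathfrak h\subset\mathbb Q\otimes_{\mathbb Z}\mathcal G$ be the subgroup generated by all $\tilde h_X$ with $X$ indecomposable, let $\mathfrak n$ be the free abelian group with basis elements $u_X$ indexed by the isomorphism classes of indecomposable objects, and set $\mathfrak g=\mathfrak h\oplus\mathfrak n$. For objects $X,Y,L$ let $F_{XY}^L$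 be the number of orbits of $\operatorname{Aut}X\times\operatorname{Aut}Y$ on the set of exact triangles $Y\to L\to X\to TY$, where $(\xi,\eta)$ maps a triangle $(f,g,h)$ to $(f\eta^{-1},\xi g,(T\eta)h\xi^{-1})$. Then: 1. There is a bilinear form $(\cdot\,|\,\cdot)$ on $\mathbb Q\otimes_{\mathbb Z}\mathcal G$ with $$(h_X\,|\,h_Y)=\dim_k\operatorname{Hom}(X,Y)-\dim_k\operatorname{Hom}(X,TY)+\dim_k\operatorname{Hom}(Y,X)-\dim_k\operatorname{Hom}(Y,TX)$$ for all objects $X,Y$, and $(\tilde h_X\,|\,h_Y)\in\mathbb Z$ for all indecomposable $X,Y$. 2. There is a biadditive product $[\cdot,\cdot]$ on $\mathfrak g$ with $[x,x]=0$ for all $x\in\mathfrak g$ and, for all indecomposable $X,Y$, $$[u_X,u_Y]=\begin{cases}\sum_{L\text{ indecomposable}}(F_{XY}^L-F_{YX}^L)\,u_L&\text{if }X\not\cong TY,\\ \tilde h_X&\text{if }X\cong TY,\end{cases}$$ $$[\tilde h_X,u_Y]=-(\tilde h_X\,|\,h_Y)\,u_Y,\qquad [u_Y,\tilde h_X]=(\tilde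 h_X\,|\,h_Y)\,u_Y,\qquad [\tilde h_X,\tilde h_Y]=0,$$ where the sum runs over isomorphism classes and has only finitely many non-zero terms. 3. With the induced bracket, $\mathfrak g/(q_k-1)\mathfrak g$ is a Lie algebra over the ring $\mathbb Z/(q_k-1)\mathbb Z$; in particular the Jacobi identity holds modulo $q_k-1$. -/

import Mathlib

open CategoryTheory CategoryTheory.Limits CategoryTheory.Pretriangulated
open scoped TensorProduct

universe w v u

noncomputable section

namespace PengXiao

section Additive

variable (C : Type u) [Category.{v} C]

/-- The set of isomorphism classes of objects of `C`. -/
abbrev IsoClass : Type u := Quotient (isIsomorphicSetoid C)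

variable {C} in
/-- The isomorphism class `[X]`. -/
abbrev isoClass (X : C) : IsoClass C := Quotient.mk (isIsomorphicSetoid C) X

variable [Preadditive C] [HasBinaryBiproducts C]

/-- The set of isomorphism classes of indecomposable objects of `C`. -/
abbrev IndClass : Type u :=
  Quotient ((isIsomorphicSetoid C).comap (Subtype.val : {X : C // Indecomposable X} → C))

variable {C} in
/-- The isomorphism class of an indecomposable object. -/
abbrev indClass (X : C) (hX : Indecomposable X) : IndClass C :=
  Quotient.mk ((isIsomorphicSetoid C).comap (Subtype.val : {X : C // Indecomposable X} → C))
    ⟨X, hX⟩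

end Additive

section Triangulated

variable (C : Type u) [Category.{v} C] [Preadditive C] [HasZeroObject C] [HasShift C ℤ]
  [∀ n : ℤ, (shiftFunctor C n).Additive] [Pretriangulated C]

/-- The subgroup of the free abelian group on isomorphism classes generated by the elements
`[X] + [Y] - [L]`, one for each exact triangle `Y ⟶ L ⟶ X ⟶ Y⟦1⟧`. -/
def triangleRelations : AddSubgroup (FreeAbelianGroup (IsoClass C)) :=
  AddSubgroup.closure {r | ∃ t ∈ distTriang C,
    r = FreeAbelianGroup.of (isoClass t.obj₃) + FreeAbelianGroup.of (isoClass t.obj₁)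
      - FreeAbelianGroup.of (isoClass t.obj₂)}

/-- The Grothendieck group of the triangulated category `C`. -/
abbrev GrothendieckGroup : Type u := FreeAbelianGroup (IsoClass C) ⧸ triangleRelations C

variable {C}

/-- The class `h_X` of an object in the Grothendieck group. -/
def cls (X : C) : GrothendieckGroup C :=
  QuotientAddGroup.mk (FreeAbelianGroup.of (isoClass X))

/-- The image of `h_X` in `ℚ ⊗ G`, where `G` is the Grothendieck group. -/
def ratCls (X : C) : ℚ ⊗[ℤ] GrothendieckGroup C := (1 : ℚ) ⊗ₜ[ℤ] cls X

variable (C)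

/-- The Grothendieck group is proper: `h_X ≠ 0` for all indecomposable `X`. -/
def ProperGrothendieckGroup : Prop := ∀ X : C, Indecomposable X → cls X ≠ 0

/-- All Hom sets are finite and, up to isomorphism and shift, only finitely many indecomposable
objects have a given class in the Grothendieck group. -/
def Finitary : Prop :=
  (∀ X Y : C, Finite (X ⟶ Y)) ∧
    ∀ h : GrothendieckGroup C, ∃ S : Set C, S.Finite ∧
      ∀ X : C, Indecomposable X → cls X = h → ∃ Y ∈ S, ∃ n : ℤ, Nonempty (X ≅ Y⟦n⟧)

/-- `C` is 2-periodic: the square of the shift functor is isomorphic to the identity functor. -/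
def TwoPeriodic : Prop :=
  Nonempty (shiftFunctor C (1 : ℤ) ⋙ shiftFunctor C (1 : ℤ) ≅ 𝟭 C)

variable {C}

/-- The set `W_{XY}^L` of exact triangles `Y ⟶ L ⟶ X ⟶ Y⟦1⟧`. -/
structure TriangleSet (X Y L : C) : Type v where
  f : Y ⟶ L
  g : L ⟶ X
  h : X ⟶ Y⟦(1 : ℤ)⟧
  dist : Triangle.mk f g h ∈ distTriang C

/-- Two triangles in `W_{XY}^L` are equivalent if they lie in the same orbit of
`Aut X × Aut Y`, that is, if there is an isomorphism of triangles between them of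
the form `(η, 𝟙 L, ξ)`. -/
def triangleSetoid (X Y L : C) : Setoid (TriangleSet X Y L) where
  r s t := ∃ (η : Y ≅ Y) (ξ : X ≅ X),
    η.hom ≫ t.f = s.f ∧ s.g ≫ ξ.hom = t.g ∧ s.h ≫ η.hom⟦(1 : ℤ)⟧' = ξ.hom ≫ t.h
  iseqv :=
    { refl := fun s => ⟨Iso.refl _, Iso.refl _, by simp, by simp, by simp⟩
      symm := by
        rintro s t ⟨η, ξ, h₁, h₂, h₃⟩
        refine ⟨η.symm, ξ.symm, by simp [← h₁], by simp [← h₂], ?_⟩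
        rw [Iso.symm_hom, Iso.symm_hom, Iso.eq_inv_comp, ← Category.assoc, ← h₃,
          Category.assoc, ← Functor.map_comp, Iso.hom_inv_id, CategoryTheory.Functor.map_id,
          Category.comp_id]
      trans := by
        rintro s t r ⟨η, ξ, h₁, h₂, h₃⟩ ⟨η', ξ', h₁', h₂', h₃'⟩
        refine ⟨η ≪≫ η', ξ ≪≫ ξ', by simp [h₁, h₁'], ?_, ?_⟩
        · rw [Iso.trans_hom, ← Category.assoc, h₂, h₂']
        · rw [Iso.trans_hom, Iso.trans_hom, Functor.map_comp, ← Category.assoc, h₃,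
            Category.assoc, h₃', Category.assoc] }

/-- The triangle-counting number `F_{XY}^L`, the number of orbits of `Aut X × Aut Y` on
`W_{XY}^L`. -/
def hallNumber (X Y L : C) : ℕ := Nat.card (Quotient (triangleSetoid X Y L))

end Triangulated

section Linear

variable (k : Type w) [Field k]

/-- `d(X) = dim_k (End X / rad End X)`. -/
def endDim {C : Type u} [Category.{v} C] [Preadditive C] [Linear k C] (X : C) : ℕ :=
  Module.finrank k (End X ⧸ Ring.jacobson (End X))

variable {C : Type u} [Category.{v} C] [Preadditive C] [Linear k C]
  [HasZeroObject C] [HasShift C ℤ] [∀ n : ℤ, (shiftFunctor C n).Additive] [Pretriangulated C]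

/-- The alternating sum
`dim Hom(X,Y) - dim Hom(X,TY) + dim Hom(Y,X) - dim Hom(Y,TX)`. -/
def eulerSum (X Y : C) : ℤ :=
  (Module.finrank k (X ⟶ Y) : ℤ) - Module.finrank k (X ⟶ Y⟦(1 : ℤ)⟧)
    + Module.finrank k (Y ⟶ X) - Module.finrank k (Y ⟶ X⟦(1 : ℤ)⟧)

/-- The element `h_X / d(X)` of `ℚ ⊗ G`. -/
def coroot (X : C) : ℚ ⊗[ℤ] GrothendieckGroup C := (endDim k X : ℚ)⁻¹ • ratCls X

variable (C)

/-- The lattice `𝔥` in `ℚ ⊗ G` generated by the `h_X / d(X)` with `X` indecomposable. -/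
def cartan : Submodule ℤ (ℚ ⊗[ℤ] GrothendieckGroup C) :=
  Submodule.span ℤ {x | ∃ X : C, Indecomposable X ∧ x = coroot k X}

/-- `𝔤 = 𝔥 ⊕ 𝔫`, where `𝔫` is the free abelian group on the isomorphism classes of
indecomposable objects. -/
abbrev HallLie : Type u := cartan k C × (IndClass C →₀ ℤ)

variable {C}

/-- The element `h_X / d(X)` of `𝔤`, for `X` indecomposable. -/
def hGen (X : C) (hX : Indecomposable X) : HallLie k C :=
  (⟨coroot k X, Submodule.subset_span ⟨X, hX, rfl⟩⟩, 0)

/-- The basis element `u_X` of `𝔫`, as an element of `𝔤`. -/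
def uGen (X : C) (hX : Indecomposable X) : HallLie k C :=
  (0, Finsupp.single (indClass X hX) 1)

/-- `form` is the bilinear form on `ℚ ⊗ G` with `(h_X | h_Y)` given by the alternating sum. -/
def IsEulerForm
    (form : (ℚ ⊗[ℤ] GrothendieckGroup C) →ₗ[ℚ] (ℚ ⊗[ℤ] GrothendieckGroup C) →ₗ[ℚ] ℚ) : Prop :=
  ∀ X Y : C, form (ratCls X) (ratCls Y) = (eulerSum k X Y : ℚ)

/-- The biadditive product `B` on `𝔤` takes the prescribed values on the generators
`h_X / d(X)` and `u_X`. -/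
structure IsHallBracket
    (form : (ℚ ⊗[ℤ] GrothendieckGroup C) →ₗ[ℚ] (ℚ ⊗[ℤ] GrothendieckGroup C) →ₗ[ℚ] ℚ)
    (B : HallLie k C →ₗ[ℤ] HallLie k C →ₗ[ℤ] HallLie k C) : Prop where
  /-- If `X` is not isomorphic to `TY`, then `[u_X, u_Y]` is the sum over the classes of
  indecomposable objects `L` of `(F_{XY}^L - F_{YX}^L) u_L`. -/
  u_u : ∀ (X Y : C) (hX : Indecomposable X) (hY : Indecomposable Y),
    ¬ Nonempty (X ≅ Y⟦(1 : ℤ)⟧) →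
      (B (uGen k X hX) (uGen k Y hY)).1 = 0 ∧
      ∀ (L : C) (hL : Indecomposable L),
        (B (uGen k X hX) (uGen k Y hY)).2 (indClass L hL) =
          (hallNumber X Y L : ℤ) - hallNumber Y X L
  /-- If `X` is isomorphic to `TY`, then `[u_X, u_Y] = h_X / d(X)`. -/
  u_u_shift : ∀ (X Y : C) (hX : Indecomposable X) (hY : Indecomposable Y),
    Nonempty (X ≅ Y⟦(1 : ℤ)⟧) → B (uGen k X hX) (uGen k Y hY) = hGen k X hX
  /-- The number `(h_X / d(X) | h_Y)` is an integer `n`, with `[h_X / d(X), u_Y] = -n u_Y` and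
  `[u_Y, h_X / d(X)] = n u_Y`. -/
  h_u : ∀ (X Y : C) (hX : Indecomposable X) (hY : Indecomposable Y), ∃ n : ℤ,
    (n : ℚ) = form (coroot k X) (ratCls Y) ∧
      B (hGen k X hX) (uGen k Y hY) = -(n • uGen k Y hY) ∧
      B (uGen k Y hY) (hGen k X hX) = n • uGen k Y hY
  /-- `[h_X / d(X), h_Y / d(Y)] = 0`. -/
  h_h : ∀ (X Y : C) (hX : Indecomposable X) (hY : Indecomposable Y),
    B (hGen k X hX) (hGen k Y hY) = 0

end Linear

end PengXiao

end

/-!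
# The Lie algebra of a 2-periodic triangulated category over a finite field

Let `q = |k|`. All counting takes place in `ZMod (q - 1)`, where `q = 1`: finite vector spaces and
their cosets have cardinality one, and the group of units of `End X`, for `X` indecomposable, has
cardinality `q ^ d(X) - 1` up to a power of `q`. The weighted orbit count `sum_eq_mul_classSum`
therefore turns a weighted count of morphisms into `q ^ d(X) - 1` times a number that is congruent
to the corresponding count of `Aut X`-orbits. The Hall number `F_{XY}^L` is a count of orbits of
morphisms `L ⟶ X` with fibre `Y`, or of morphisms `Y ⟶ L` with cone `X`.

The main point is the associator of `u_X`, `u_Y`, `u_Z` at `u_M` (`hall_associator`).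
Here `∑ F_{XY}^L F_{LZ}^M` is a sum over orbits of morphisms `i : Z ⟶ M`, with `L` the cone of
`i`, and `F_{XY}^L` a sum over morphisms `b : L ⟶ X`. Sort these by the composite `c : M ⟶ X`. For
fixed nonzero `i` and `c` the octahedral axiom matches extensions `b` of `c` to the cone of `i` with
lifts `j` of `i` to the fibre of `c` (`natCast_card_extensions_eq_card_lifts`), and the latter occur
in `∑ F_{XL}^M F_{YZ}^L`. Two kinds of terms remain.

* The intermediate object may be decomposable. This contributes only if it is isomorphic to the
  biproduct of the two outer objects (`natCast_hallNumber_of_not_indecomposable`). Such terms are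
  symmetric in two of the three objects, so they cancel in an alternating sum.
* The composite `c`, or `j` followed by the map to `M`, may vanish. Then `b` comes from a morphism
  `Z ⟶ T X`, and the octahedral axiom leads to triangles `Z ⟶ M ⊞ T X ⟶ Y`
  (`sum_post_vanishing`, `sum_pre_vanishing`). Those without invertible components can be counted
  from either end (`sum_lift_eq_sum_desc`), and again they cancel in the alternating sum. The others
  involve dimensions of Hom spaces, and add up to `(h_X / d(X) | h_Z)` if `X ≅ T Y` and `M ≅ Z`
  (`sum_assocCoeff`). This is what the terms `[[u_X, u_Y], u_Z]` with `[u_X, u_Y] ∈ 𝔥` compensate.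

The `𝔥`-component of the Jacobi identity for `u_X`, `u_Y`, `u_Z` is settled by rotating triangles
`Y ⟶ T Z ⟶ X ⟶ T Y` (`exists_sum_cartanElt_eq`). If an element of `𝔥` is involved, the identity
holds exactly, because the bracket is graded by the Grothendieck group
(`jacobiator_cartan_nil_nil`).

The Euler form exists because the long exact sequences of Hom spaces are periodic of period six
(`Tri.euler_post`, `Tri.euler_pre`). It is integral on `h_X / d(X)` because `d(X)` divides the
dimension of every Hom space from or to `X`, as `q ^ d(X) - 1` divides the number of nonzero
morphisms (`exists_eulerSum_eq`).
-/

noncomputable section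

namespace PengXiao

set_option linter.unusedSectionVars false

attribute [local instance] Fintype.ofFinite

/-! ### Counting classes modulo `q - 1` -/

section Counting

open scoped Classical

lemma natCast_eq_one_zmod_sub_one {q : ℕ} (hq : 1 ≤ q) : (q : ZMod (q - 1)) = 1 := by
  have h : ((q - 1 + 1 : ℕ) : ZMod (q - 1)) = 1 := by simp
  rwa [Nat.sub_add_cancel hq] at h

/-- If the classes of an equivalence relation on which an invariant weight does not vanish all
have `D * q ^ e` elements for varying `e`, then the total weight is `D` times an integer that is
congruent modulo `q - 1` to the sum of the weights of the classes. -/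
theorem sum_eq_mul_classSum {S : Type*} [Finite S] (r : Setoid S) {q D : ℕ} (hq : 1 ≤ q)
    (w : S → ℕ) (hw : ∀ s t, r s t → w s = w t)
    (hr : ∀ s, w s ≠ 0 → ∃ e, Nat.card {t // r s t} = D * q ^ e) :
    ∃ n : ℕ, ∑ s, w s = D * n ∧
      (n : ZMod (q - 1)) = ∑ o : Quotient r, (w o.out : ZMod (q - 1)) := by
  have h (o : Quotient r) : ∃ e : ℕ, w o.out ≠ 0 → Nat.card {t // r o.out t} = D * q ^ e := by
    by_cases ho : w o.out = 0
    · exact ⟨0, fun h => absurd ho h⟩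
    · exact (hr _ ho).imp fun e he _ => he
  choose e he using h
  refine ⟨∑ o, q ^ e o * w o.out, ?_, ?_⟩
  · rw [← Finset.sum_fiberwise Finset.univ (fun s => (Quotient.mk r s)) w, Finset.mul_sum]
    refine Finset.sum_congr rfl fun o _ => ?_
    have h1 : ∀ s ∈ Finset.univ.filter (fun s => Quotient.mk r s = o), w s = w o.out := by
      intro s hs
      refine hw _ _ (Quotient.exact ?_)
      rw [(Finset.mem_filter.1 hs).2, Quotient.out_eq]
    rw [Finset.sum_congr rfl h1, Finset.sum_const, smul_eq_mul]
    by_cases ho : w o.out = 0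
    · simp [ho]
    rw [← mul_assoc, ← he o ho, Nat.card_eq_fintype_card, Fintype.card_subtype]
    congr 2
    ext s
    simp only [Finset.mem_filter, Finset.mem_univ, true_and]
    constructor
    · intro hs
      refine Quotient.exact ?_
      rw [hs, Quotient.out_eq]
    · intro hs
      rw [← Quotient.out_eq o]
      exact Quotient.sound (Setoid.symm hs)
  · push_cast
    simp [natCast_eq_one_zmod_sub_one hq]

/-- The classes of the restriction of `r` to an invariant subset are the classes of `r` contained
in it. -/
theorem card_quotient_subtype {S : Type*} [Finite S] (r : Setoid S) (P : S → Prop)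
    (hP : ∀ s t, r s t → P s → P t) :
    Nat.card (Quotient (r.comap (Subtype.val : {s // P s} → S))) =
      ∑ o : Quotient r, if P o.out then 1 else 0 := by
  simp only [Finset.sum_boole, Nat.cast_id]
  rw [← Fintype.card_subtype, ← Nat.card_eq_fintype_card]
  refine Nat.card_congr
    { toFun := fun x => ⟨Quotient.map' (s₂ := r) Subtype.val (fun _ _ h => h) x, ?_⟩
      invFun := fun o => Quotient.mk _ ⟨o.1.out, o.2⟩
      left_inv := ?_
      right_inv := ?_ }
  · induction x using Quotient.inductionOn with
    | h a => exact hP _ _ (Setoid.symm (Quotient.mk_out (s := r) a.1)) a.2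
  · intro x
    induction x using Quotient.inductionOn with
    | h a => exact Quotient.sound (Quotient.mk_out (s := r) a.1)
  · rintro ⟨o, ho⟩
    exact Subtype.ext (Quotient.out_eq o)

/-- A finite vector space has cardinality `1` modulo `q - 1`. -/
lemma natCast_card_eq_one (k : Type*) [Field k] [Finite k] {V : Type*} [AddCommGroup V]
    [Module k V] [Finite V] : (Nat.card V : ZMod (Nat.card k - 1)) = 1 := by
  have : Module.Finite k V := Module.Finite.of_finite
  rw [Module.natCard_eq_pow_finrank (K := k) (V := V)]
  rw [Nat.cast_pow, natCast_eq_one_zmod_sub_one Nat.card_pos, one_pow]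

/-- In a finite monoid some power of every element is idempotent. -/
lemma exists_pow_idempotent {G : Type*} [Monoid G] [Finite G] (x : G) :
    ∃ n, 0 < n ∧ x ^ n * x ^ n = x ^ n := by
  obtain ⟨a, b, hab, h⟩ := Finite.exists_ne_map_eq_of_infinite (fun n : ℕ => x ^ (n + 1))
  wlog hlt : a < b generalizing a b
  · exact this b a hab.symm h.symm (lt_of_le_of_ne (not_lt.1 hlt) hab.symm)
  obtain ⟨p, rfl⟩ := Nat.exists_eq_add_of_lt hlt
  have h1 : ∀ j t, x ^ (a + 1 + t + j * (p + 1)) = x ^ (a + 1 + t) := by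
    intro j t
    induction j with
    | zero => simp
    | succ j ih =>
      have : a + 1 + t + (j + 1) * (p + 1) = (a + p + 1 + 1) + (t + j * (p + 1)) := by ring
      rw [this, pow_add, ← h, ← pow_add, ← add_assoc, ih]
  refine ⟨(a + 1) * (p + 1), by positivity, ?_⟩
  rw [← pow_add]
  have := h1 (a + 1) ((a + 1) * p)
  rw [show (a + 1) * (p + 1) = a + 1 + (a + 1) * p by ring]
  rw [show a + 1 + (a + 1) * p + (a + 1 + (a + 1) * p) = a + 1 + (a + 1) * p + (a + 1) * (p + 1) by
    ring]
  exact this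

end Counting

/-! ### Endomorphisms of indecomposable objects -/

section Local

variable {C : Type u} [Category.{v} C] [Preadditive C] [HasBinaryBiproducts C]
  [IsIdempotentComplete C]

/-- An idempotent of an indecomposable object is trivial. -/
lemma _root_.CategoryTheory.Indecomposable.eq_zero_or_one {X : C} (hX : Indecomposable X)
    (p : X ⟶ X) (hp : p ≫ p = p) :
    p = 0 ∨ p = 𝟙 X := by
  obtain ⟨Y, i, e, hi, he⟩ := IsIdempotentComplete.idempotents_split X p hp
  obtain ⟨Y', i', e', hi', he'⟩ := IsIdempotentComplete.idempotents_split X (𝟙 X - p)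
    (by simp [hp])
  have h1 : i ≫ e' = 0 := by
    have : i ≫ (e' ≫ i') = 0 := by
      rw [he', Preadditive.comp_sub, ← he, reassoc_of% hi]; simp
    calc i ≫ e' = (i ≫ e' ≫ i') ≫ e' := by simp [hi']
      _ = 0 := by rw [this]; simp
  have h2 : i' ≫ e = 0 := by
    have : i' ≫ (e ≫ i) = 0 := by
      have h3 : i' ≫ (𝟙 X - p) = i' := by rw [← he', reassoc_of% hi']
      rw [he]
      simpa using h3
    calc i' ≫ e = (i' ≫ e ≫ i) ≫ e := by simp [hi]
      _ = 0 := by rw [this]; simp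
  let φ : X ≅ Y ⊞ Y' :=
    { hom := biprod.lift e e'
      inv := biprod.desc i i'
      hom_inv_id := by simp [biprod.lift_desc, he, he']
      inv_hom_id := by
        apply biprod.hom_ext' <;> apply biprod.hom_ext <;> simp [hi, hi', h1, h2] }
  rcases hX.2 Y Y' φ with h | h
  · left
    rw [← he, h.eq_of_tgt e 0, zero_comp]
  · right
    have : 𝟙 X - p = 0 := by rw [← he', h.eq_of_tgt e' 0, zero_comp]
    exact (sub_eq_zero.1 this).symm

/-- Fitting's lemma for an indecomposable object with finite endomorphism ring. -/
lemma _root_.CategoryTheory.Indecomposable.isIso_or_isNilpotent {X : C} [Finite (X ⟶ X)]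
    (hX : Indecomposable X)
    (f : End X) : IsIso f ∨ IsNilpotent f := by
  have : Finite (End X) := ‹Finite (X ⟶ X)›
  obtain ⟨n, hn, h⟩ := exists_pow_idempotent f
  rcases hX.eq_zero_or_one (f ^ n) h with h' | h'
  · exact Or.inr ⟨n, h'⟩
  · left
    have hu : IsUnit f := IsUnit.of_pow_eq_one (a := f) (n := n) h' hn.ne'
    exact (isUnit_iff_isIso f).1 hu

lemma isNilpotent_not_isIso {X : C} (hX : ¬ IsZero X) {f : End X} (hf : IsNilpotent f) :
    ¬ IsIso f := by
  intro h
  have : IsUnit f := (isUnit_iff_isIso f).2 h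
  have h0 : ¬ Nontrivial (End X) := fun _ => hf.not_isUnit this
  rw [not_nontrivial_iff_subsingleton] at h0
  exact hX ((IsZero.iff_id_eq_zero X).2 (Subsingleton.elim (α := End X) _ _))

lemma _root_.CategoryTheory.Indecomposable.isIso_iff {X : C} [Finite (X ⟶ X)]
    (hX : Indecomposable X) (f : End X) :
    ¬ IsIso f ↔ IsNilpotent f :=
  ⟨fun h => (hX.isIso_or_isNilpotent f).resolve_left h, isNilpotent_not_isIso hX.1⟩

/-- If a composite `X ⟶ Y ⟶ X` is an isomorphism, with `Y` indecomposable and `X` nonzero, then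
both morphisms are isomorphisms. -/
lemma _root_.CategoryTheory.Indecomposable.isIso_of_isIso_comp {X Y : C} [Finite (Y ⟶ Y)]
    (hX : ¬ IsZero X) (hY : Indecomposable Y) (f : X ⟶ Y) (g : Y ⟶ X) [IsIso (f ≫ g)] :
    IsIso f ∧ IsIso g := by
  let p : Y ⟶ Y := g ≫ inv (f ≫ g) ≫ f
  have hp : p ≫ p = p := by simp [p, ← Category.assoc f g]
  have hfp : f ≫ p = f := by simp [p, ← Category.assoc f g]
  rcases hY.eq_zero_or_one p hp with h | h
  · exfalso
    apply hX
    rw [IsZero.iff_id_eq_zero]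
    have hf : f = 0 := by rw [← hfp, h, comp_zero]
    rw [← IsIso.hom_inv_id (f ≫ g), Category.assoc]
    nth_rewrite 1 [hf]
    exact zero_comp
  · have hf : IsIso f :=
      ⟨⟨g ≫ inv (f ≫ g), by rw [← Category.assoc]; simp, by simpa [p] using h⟩⟩
    exact ⟨hf, IsIso.of_isIso_comp_left f g⟩

lemma _root_.CategoryTheory.Indecomposable.not_isIso_comp_left {X Y : C} [Finite (X ⟶ X)]
    [Finite (Y ⟶ Y)] (hX : Indecomposable X) (hY : Indecomposable Y) (f : X ⟶ Y) (g : Y ⟶ X)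
    (hf : ¬ IsIso f) : ¬ IsIso (f ≫ g) := fun _ => hf (hY.isIso_of_isIso_comp hX.1 f g).1

/-- The nonisomorphisms of an indecomposable object are closed under addition. -/
lemma _root_.CategoryTheory.Indecomposable.not_isIso_add {X : C} [Finite (X ⟶ X)]
    (hX : Indecomposable X) {f g : X ⟶ X} (hf : ¬ IsIso f) (hg : ¬ IsIso g) : ¬ IsIso (f + g) := by
  intro h
  have h1 : ¬ IsIso (f ≫ inv (f + g)) := hX.not_isIso_comp_left hX _ _ hf
  have h2 : ¬ IsIso (g ≫ inv (f + g)) := hX.not_isIso_comp_left hX _ _ hg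
  have h3 : g ≫ inv (f + g) = 𝟙 X - f ≫ inv (f + g) := by
    rw [eq_sub_iff_add_eq, add_comm, ← Preadditive.add_comp, IsIso.hom_inv_id]
  apply h2
  rw [h3]
  have := ((hX.isIso_iff (f ≫ inv (f + g))).1 h1).isUnit_one_sub
  exact (isUnit_iff_isIso _).1 this

variable (k : Type w) [Field k] [Linear k C]

/-- The radical of the endomorphism ring of an indecomposable object: the subspace of
nonisomorphisms. -/
def radEnd {X : C} [Finite (X ⟶ X)] (hX : Indecomposable X) : Submodule k (X ⟶ X) where
  carrier := {f | ¬ IsIso f}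
  zero_mem' := fun h => hX.1 ((IsZero.iff_id_eq_zero X).2 (by
    rw [← IsIso.hom_inv_id (0 : X ⟶ X), zero_comp]))
  add_mem' := hX.not_isIso_add
  smul_mem' := by
    intro c f hf h
    have : IsIso (f ≫ (c • 𝟙 X)) := by simpa using h
    exact hX.not_isIso_comp_left hX f _ hf this

/-- The endomorphism ring of an indecomposable object is local: its Jacobson radical consists of
the nonisomorphisms. -/
lemma mem_jacobson_iff_not_isIso {X : C} [Finite (X ⟶ X)] (hX : Indecomposable X) (f : End X) :
    f ∈ Ring.jacobson (End X) ↔ ¬ IsIso f := by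
  rw [← Ideal.jacobson_bot, Ideal.mem_jacobson_iff]
  constructor
  · intro h hf
    let f' : End X := inv f
    obtain ⟨z, hz⟩ := h (-f')
    rw [Ideal.mem_bot] at hz
    have h1 : -f' * f = -1 := by
      change f ≫ (-inv f) = -𝟙 X
      simp
    have h2 : z * -f' * f + z - 1 = -1 := by
      rw [mul_assoc, h1]; simp
    have h3 : (1 : End X) = 0 := by
      rw [← neg_eq_zero, ← h2]; exact hz
    exact hX.1 ((IsZero.iff_id_eq_zero X).2 h3)
  · intro h y
    have h1 : ¬ IsIso (f ≫ (y : X ⟶ X)) := hX.not_isIso_comp_left hX _ _ h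
    have h2 : IsUnit (1 - -(y * f)) := by
      refine IsNilpotent.isUnit_one_sub (IsNilpotent.neg ?_)
      exact (hX.isIso_iff (f ≫ (y : X ⟶ X))).1 h1
    obtain ⟨u, hu⟩ := h2
    refine ⟨(↑u⁻¹ : End X), ?_⟩
    rw [Ideal.mem_bot]
    have : (↑u⁻¹ : End X) * u = 1 := u.inv_mul
    rw [hu] at this
    change (↑u⁻¹ : End X) * y * f + ↑u⁻¹ - 1 = 0
    rw [← this]
    noncomm_ring

lemma finrank_radEnd_add_endDim {X : C} [Finite (X ⟶ X)] (hX : Indecomposable X) :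
    Module.finrank k (radEnd k hX) + endDim k X = Module.finrank k (X ⟶ X) := by
  have : Module.Finite k (X ⟶ X) := Module.Finite.of_finite
  have : Module.Finite k (End X) := this
  let J : Submodule k (End X) := (Ring.jacobson (End X)).restrictScalars k
  have e : endDim k X = Module.finrank k (End X ⧸ J) := rfl
  have hJ : J = radEnd k hX := by
    ext f
    exact mem_jacobson_iff_not_isIso hX f
  have h := Submodule.finrank_quotient_add_finrank J
  rw [e, add_comm]
  have h2 : Module.finrank k (radEnd k hX) = Module.finrank k J := by
    rw [← hJ]; rfl
  rw [h2]
  exact h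

lemma endDim_pos {X : C} [Finite (X ⟶ X)] (hX : Indecomposable X) : 0 < endDim k X := by
  have : Module.Finite k (X ⟶ X) := Module.Finite.of_finite
  have h := finrank_radEnd_add_endDim k hX
  have h1 : radEnd k hX < ⊤ := by
    rw [lt_top_iff_ne_top]
    intro h
    have : 𝟙 X ∈ radEnd k hX := by rw [h]; trivial
    exact this inferInstance
  have := Submodule.finrank_lt h1.ne
  omega

end Local

/-! ### Orbits of automorphism groups on Hom spaces -/

section Orbits

open scoped Classical

lemma finrank_range_eq_finrank_map_add {k V W : Type*} [Field k] [AddCommGroup V] [Module k V]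
    [AddCommGroup W] [Module k W] [Module.Finite k V] (ρ : V →ₗ[k] W) (U : Submodule k V)
    (hU : LinearMap.ker ρ ≤ U) {d : ℕ} (hd : Module.finrank k U + d = Module.finrank k V) :
    Module.finrank k (LinearMap.range ρ) = Module.finrank k (U.map ρ) + d := by
  have h1 := LinearMap.finrank_range_add_finrank_ker ρ
  have h2 := LinearMap.finrank_range_add_finrank_ker (ρ.domRestrict U)
  have h3 : LinearMap.range (ρ.domRestrict U) = U.map ρ := by
    rw [LinearMap.range_domRestrict]
  have h4 : Module.finrank k (LinearMap.ker (ρ.domRestrict U)) =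
      Module.finrank k (LinearMap.ker ρ) := by
    rw [LinearMap.ker_domRestrict]
    exact (Submodule.comapSubtypeEquivOfLe hU).finrank_eq
  rw [h3, h4] at h2
  omega

lemma card_range_diff_map {k V W : Type*} [Field k] [Finite k] [AddCommGroup V] [Module k V]
    [AddCommGroup W] [Module k W] [Finite V] (ρ : V →ₗ[k] W) (U : Submodule k V)
    (hU : LinearMap.ker ρ ≤ U) {d : ℕ} (hd : Module.finrank k U + d = Module.finrank k V)
    (P : W → Prop) (hP : ∀ x, P x ↔ x ∈ LinearMap.range ρ ∧ x ∉ U.map ρ) :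
    ∃ e, Nat.card {x // P x} = (Nat.card k ^ d - 1) * Nat.card k ^ e := by
  have : Module.Finite k V := Module.Finite.of_finite
  refine ⟨Module.finrank k (U.map ρ), ?_⟩
  have h1 : {x | P x} = (LinearMap.range ρ : Set W) \ (U.map ρ : Set W) := by
    ext x; exact hP x
  have h2 : (U.map ρ : Set W) ⊆ (LinearMap.range ρ : Set W) := LinearMap.map_le_range
  have hfin : (LinearMap.range ρ : Set W).Finite := Set.finite_range ρ
  change Nat.card ({x | P x} : Set W) = _
  rw [h1, Nat.card_coe_set_eq, Set.ncard_sdiff h2 (hfin.subset h2)]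
  have h3 : (LinearMap.range ρ : Set W).ncard = Nat.card k ^ Module.finrank k (LinearMap.range ρ) :=
    Module.natCard_eq_pow_finrank (K := k) (V := LinearMap.range ρ)
  have h4 : (U.map ρ : Set W).ncard = Nat.card k ^ Module.finrank k (U.map ρ) :=
    Module.natCard_eq_pow_finrank (K := k) (V := U.map ρ)
  rw [h3, h4, finrank_range_eq_finrank_map_add ρ U hU hd, pow_add, Nat.sub_mul, one_mul, mul_comm]

variable {C : Type u} [Category.{v} C]

/-- Two morphisms `L ⟶ X` are equivalent if they differ by an automorphism of `X`. -/
def postSetoid (L X : C) : Setoid (L ⟶ X) where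
  r b b' := ∃ ξ : X ≅ X, b ≫ ξ.hom = b'
  iseqv :=
    { refl := fun b => ⟨Iso.refl _, by simp⟩
      symm := by
        rintro b _ ⟨ξ, rfl⟩
        exact ⟨ξ.symm, by simp⟩
      trans := by
        rintro b _ _ ⟨ξ, rfl⟩ ⟨ξ', rfl⟩
        exact ⟨ξ ≪≫ ξ', by simp⟩ }

/-- Two morphisms `Z ⟶ M` are equivalent if they differ by an automorphism of `Z`. -/
def preSetoid (Z M : C) : Setoid (Z ⟶ M) where
  r i i' := ∃ η : Z ≅ Z, η.hom ≫ i = i'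
  iseqv :=
    { refl := fun b => ⟨Iso.refl _, by simp⟩
      symm := by
        rintro b _ ⟨ξ, rfl⟩
        exact ⟨ξ.symm, by simp⟩
      trans := by
        rintro b _ _ ⟨ξ, rfl⟩ ⟨ξ', rfl⟩
        exact ⟨ξ' ≪≫ ξ, by simp⟩ }

/-- The orbits of `Aut X` on `Hom(L, X)`. -/
abbrev PostOrbit (L X : C) := Quotient (postSetoid L X)

/-- The orbits of `Aut Z` on `Hom(Z, M)`. -/
abbrev PreOrbit (Z M : C) := Quotient (preSetoid Z M)

variable [Preadditive C] [HasBinaryBiproducts C] [IsIdempotentComplete C]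
variable (k : Type w) [Field k] [Linear k C]

/-- `q ^ d(X) - 1`, the number of units of the residue field of `End X`. -/
def unitCard (X : C) : ℕ := Nat.card k ^ endDim k X - 1

variable [∀ X Y : C, Finite (X ⟶ Y)] [Finite k]

lemma unitCard_pos {X : C} (hX : Indecomposable X) : 0 < unitCard k X := by
  have h : 1 < Nat.card k := Finite.one_lt_card
  have := Nat.one_lt_pow (endDim_pos k hX).ne' h
  unfold unitCard
  omega

/-- The orbit of a nonzero morphism `b : L ⟶ X` is the difference of the images of `End X` and of
its radical under `ξ ↦ b ≫ ξ`. -/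
lemma card_postOrbit {L X : C} (hX : Indecomposable X) (b : L ⟶ X) (hb : b ≠ 0) :
    ∃ e, Nat.card {b' // postSetoid L X b b'} = unitCard k X * Nat.card k ^ e := by
  have key : ∀ ξ : X ⟶ X, b ≫ ξ = 0 → ¬ IsIso ξ := fun ξ h _ => by
    apply hb
    rw [← cancel_mono ξ, h, zero_comp]
  refine card_range_diff_map (Linear.leftComp k X b) (radEnd k hX) (fun ξ hξ => key ξ hξ)
    (finrank_radEnd_add_endDim k hX) _ fun x => ?_
  constructor
  · rintro ⟨ξ, rfl⟩
    refine ⟨⟨ξ.hom, rfl⟩, ?_⟩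
    rintro ⟨η, hη, h⟩
    have h' : b ≫ (ξ.hom - η) = 0 := by
      rw [Preadditive.comp_sub, sub_eq_zero]; exact h.symm
    have := (radEnd k hX).add_mem (key _ h') hη
    rw [sub_add_cancel] at this
    exact this inferInstance
  · rintro ⟨⟨ξ, rfl⟩, h⟩
    have : IsIso ξ := by
      by_contra hξ
      exact h ⟨ξ, hξ, rfl⟩
    exact ⟨asIso ξ, rfl⟩

/-- The orbit of a nonzero morphism `i : Z ⟶ M` is the difference of the images of `End Z` and of
its radical under `η ↦ η ≫ i`. -/
lemma card_preOrbit {Z M : C} (hZ : Indecomposable Z) (i : Z ⟶ M) (hi : i ≠ 0) :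
    ∃ e, Nat.card {i' // preSetoid Z M i i'} = unitCard k Z * Nat.card k ^ e := by
  have key : ∀ ξ : Z ⟶ Z, ξ ≫ i = 0 → ¬ IsIso ξ := fun ξ h _ => by
    apply hi
    rw [← cancel_epi ξ, h, comp_zero]
  refine card_range_diff_map (Linear.rightComp k Z i) (radEnd k hZ) (fun ξ hξ => key ξ hξ)
    (finrank_radEnd_add_endDim k hZ) _ fun x => ?_
  constructor
  · rintro ⟨ξ, rfl⟩
    refine ⟨⟨ξ.hom, rfl⟩, ?_⟩
    rintro ⟨η, hη, h⟩
    have h' : (ξ.hom - η) ≫ i = 0 := by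
      rw [Preadditive.sub_comp, sub_eq_zero]; exact h.symm
    have := (radEnd k hZ).add_mem (key _ h') hη
    rw [sub_add_cancel] at this
    exact this inferInstance
  · rintro ⟨⟨ξ, rfl⟩, h⟩
    have : IsIso ξ := by
      by_contra hξ
      exact h ⟨ξ, hξ, rfl⟩
    exact ⟨asIso ξ, rfl⟩

/-- The sum over `Hom(L, X)` of a weight that is invariant under `Aut X` and vanishes at `0` is
divisible by `q ^ d(X) - 1`, and modulo `q - 1` the quotient is the sum over the orbits. -/
theorem sum_post {L X : C} (hX : Indecomposable X) (w : (L ⟶ X) → ℕ)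
    (hw : ∀ (b : L ⟶ X) (ξ : X ≅ X), w (b ≫ ξ.hom) = w b) (h0 : w 0 = 0) :
    ∃ n : ℕ, ∑ b, w b = unitCard k X * n ∧
      (n : ZMod (Nat.card k - 1)) = ∑ o : PostOrbit L X, (w o.out : ZMod (Nat.card k - 1)) := by
  refine sum_eq_mul_classSum _ Nat.card_pos w ?_ ?_
  · rintro b _ ⟨ξ, rfl⟩
    exact (hw b ξ).symm
  · intro b hb
    refine card_postOrbit k hX b ?_
    rintro rfl
    exact hb h0

/-- The sum over `Hom(Z, M)` of a weight that is invariant under `Aut Z` and vanishes at `0` is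
divisible by `q ^ d(Z) - 1`, and modulo `q - 1` the quotient is the sum over the orbits. -/
theorem sum_pre {Z M : C} (hZ : Indecomposable Z) (w : (Z ⟶ M) → ℕ)
    (hw : ∀ (i : Z ⟶ M) (η : Z ≅ Z), w (η.hom ≫ i) = w i) (h0 : w 0 = 0) :
    ∃ n : ℕ, ∑ i, w i = unitCard k Z * n ∧
      (n : ZMod (Nat.card k - 1)) = ∑ o : PreOrbit Z M, (w o.out : ZMod (Nat.card k - 1)) := by
  refine sum_eq_mul_classSum _ Nat.card_pos w ?_ ?_
  · rintro b _ ⟨ξ, rfl⟩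
    exact (hw b ξ).symm
  · intro b hb
    refine card_preOrbit k hZ b ?_
    rintro rfl
    exact hb h0

/-- The quotient `(q ^ (d * n) - 1) / (q ^ d - 1)` is congruent to `n` modulo `q - 1`. -/
lemma exists_pow_mul_sub_one {q : ℕ} (hq : 1 ≤ q) (d n : ℕ) :
    ∃ t : ℕ, q ^ (d * n) - 1 = (q ^ d - 1) * t ∧ (t : ZMod (q - 1)) = n := by
  refine ⟨∑ i ∈ Finset.range n, (q ^ d) ^ i, ?_, ?_⟩
  · have h1 : 1 ≤ q ^ d := Nat.one_le_pow _ _ hq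
    have h2 : 1 ≤ q ^ (d * n) := Nat.one_le_pow _ _ hq
    zify [h1, h2]
    rw [pow_mul, mul_comm, geom_sum_mul]
  · push_cast
    simp [natCast_eq_one_zmod_sub_one hq]

lemma dvd_of_pow_sub_one_dvd {q a b : ℕ} (hq : 1 < q) (h : q ^ a - 1 ∣ q ^ b - 1) : a ∣ b := by
  have h1 := Nat.pow_sub_one_gcd_pow_sub_one q a b
  rw [Nat.gcd_eq_left h] at h1
  have h2 : 1 ≤ q ^ a := Nat.one_le_pow _ _ hq.le
  have h3 : 1 ≤ q ^ a.gcd b := Nat.one_le_pow _ _ hq.le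
  have h4 : q ^ a = q ^ a.gcd b := by omega
  rw [Nat.pow_right_injective hq h4]
  exact Nat.gcd_dvd_right a b

/-- The number of nonzero vectors of a finite vector space. -/
lemma sum_ne_zero_eq {V : Type*} [AddCommGroup V] [Module k V] [Finite V] :
    ∑ x : V, (if x ≠ 0 then 1 else 0) = Nat.card k ^ Module.finrank k V - 1 := by
  have : Module.Finite k V := Module.Finite.of_finite
  rw [← Module.natCard_eq_pow_finrank (K := k) (V := V), Finset.sum_boole, Nat.card_eq_fintype_card]
  rw [Finset.filter_ne', Finset.card_erase_of_mem (Finset.mem_univ _), Finset.card_univ]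
  rfl

lemma unitCard_mul_cancel {X : C} (hX : Indecomposable X) {a b : ℕ}
    (h : unitCard k X * a = unitCard k X * b) : a = b :=
  Nat.eq_of_mul_eq_mul_left (unitCard_pos k hX) h

/-- `d(X)` divides `dim Hom(L, X)`, and the quotient counts the orbits of nonzero morphisms. -/
lemma exists_finrank_eq_post (L : C) {X : C} (hX : Indecomposable X) :
    ∃ n : ℕ, Module.finrank k (L ⟶ X) = endDim k X * n ∧ (n : ZMod (Nat.card k - 1)) =
      ∑ o : PostOrbit L X, if o.out ≠ 0 then 1 else 0 := by
  obtain ⟨n, h1, h2⟩ := sum_post k hX (L := L) (fun b => if b ≠ 0 then 1 else 0)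
    (fun b ξ => by simp) (by simp)
  rw [sum_ne_zero_eq k] at h1
  have hq : 1 < Nat.card k := Finite.one_lt_card
  obtain ⟨t, ht⟩ := dvd_of_pow_sub_one_dvd hq ⟨n, h1⟩
  refine ⟨t, ht, ?_⟩
  obtain ⟨s, hs, hs'⟩ := exists_pow_mul_sub_one hq.le (endDim k X) t
  rw [ht, hs] at h1
  rw [← hs', unitCard_mul_cancel k hX h1, h2]
  simp

/-- `d(Z)` divides `dim Hom(Z, M)`, and the quotient counts the orbits of nonzero morphisms. -/
lemma exists_finrank_eq_pre {Z : C} (hZ : Indecomposable Z) (M : C) :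
    ∃ n : ℕ, Module.finrank k (Z ⟶ M) = endDim k Z * n ∧ (n : ZMod (Nat.card k - 1)) =
      ∑ o : PreOrbit Z M, if o.out ≠ 0 then 1 else 0 := by
  obtain ⟨n, h1, h2⟩ := sum_pre k hZ (M := M) (fun b => if b ≠ 0 then 1 else 0)
    (fun b ξ => by simp) (by simp)
  rw [sum_ne_zero_eq k] at h1
  have hq : 1 < Nat.card k := Finite.one_lt_card
  obtain ⟨t, ht⟩ := dvd_of_pow_sub_one_dvd hq ⟨n, h1⟩
  refine ⟨t, ht, ?_⟩
  obtain ⟨s, hs, hs'⟩ := exists_pow_mul_sub_one hq.le (endDim k Z) t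
  rw [ht, hs] at h1
  rw [← hs', unitCard_mul_cancel k hZ h1, h2]
  simp

/-- Refining the orbits of `Aut X` on a set of morphisms `b : L ⟶ X` along the restriction
`b ↦ a ≫ b`: modulo `q - 1` a nonzero restriction may be counted with its whole fibre. -/
theorem sum_post_fiber {M L X : C} (hX : Indecomposable X) (a : M ⟶ L) (P : (L ⟶ X) → Prop)
    (hP : ∀ (b : L ⟶ X) (ξ : X ≅ X), P (b ≫ ξ.hom) ↔ P b) :
    ∑ o : PostOrbit L X, (if P o.out then 1 else 0 : ZMod (Nat.card k - 1)) =
      ∑ o : PostOrbit M X, (if o.out ≠ 0 then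
        (Nat.card {b : L ⟶ X // a ≫ b = o.out ∧ P b} : ZMod (Nat.card k - 1)) else 0) +
      ∑ o : PostOrbit L X, if P o.out ∧ a ≫ o.out = 0 then 1 else 0 := by
  obtain ⟨n, h1, h2⟩ := sum_post k hX (L := L) (fun b => if P b ∧ a ≫ b ≠ 0 then 1 else 0)
    (fun b ξ => by simp [hP, ← Category.assoc]) (by simp)
  obtain ⟨n', h1', h2'⟩ := sum_post k hX (L := M)
    (fun c => if c ≠ 0 then Nat.card {b : L ⟶ X // a ≫ b = c ∧ P b} else 0)
    (fun c ξ => by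
      have : Nat.card {b : L ⟶ X // a ≫ b = c ≫ ξ.hom ∧ P b} =
          Nat.card {b : L ⟶ X // a ≫ b = c ∧ P b} := by
        refine Nat.card_congr ((ξ.symm.homToEquiv (Z := L)).subtypeEquiv fun b => ?_)
        change _ ↔ a ≫ b ≫ ξ.inv = c ∧ P (b ≫ ξ.symm.hom)
        rw [hP, ← Category.assoc, Iso.comp_inv_eq]
      simp only [this, Preadditive.IsIso.comp_right_eq_zero, ne_eq]) (by simp)
  have h3 : n = n' := by
    refine unitCard_mul_cancel k hX ?_
    rw [← h1, ← h1', ← Finset.sum_fiberwise Finset.univ (fun b => a ≫ b)]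
    refine Finset.sum_congr rfl fun c _ => ?_
    rw [Nat.card_eq_fintype_card, Fintype.card_subtype]
    rw [← Finset.sum_filter, Finset.filter_filter, ← Finset.card_eq_sum_ones]
    split_ifs with hc
    · congr 1
      ext b
      simp only [Finset.mem_filter, Finset.mem_univ, true_and]
      constructor
      · rintro ⟨h, h', -⟩; exact ⟨h, h'⟩
      · rintro ⟨h, h'⟩; exact ⟨h, h', by rwa [h]⟩
    · rw [Finset.card_eq_zero, Finset.filter_eq_empty_iff]
      rintro b - ⟨h, h', h''⟩
      exact h'' (by rw [h]; simpa using hc)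
  have h4 : ∑ o : PostOrbit M X, (if o.out ≠ 0 then
        (Nat.card {b : L ⟶ X // a ≫ b = o.out ∧ P b} : ZMod (Nat.card k - 1)) else 0) = n := by
    rw [h3, h2']
    exact Finset.sum_congr rfl fun o _ => by split_ifs <;> simp
  rw [h4, h2, ← Finset.sum_add_distrib]
  refine Finset.sum_congr rfl fun o _ => ?_
  by_cases hp : P o.out <;> by_cases h0 : a ≫ o.out = 0 <;> simp [hp, h0]

/-- Refining the orbits of `Aut Z` on a set of morphisms `j : Z ⟶ L` along `j ↦ j ≫ l`. -/
theorem sum_pre_fiber {Z L M : C} (hZ : Indecomposable Z) (l : L ⟶ M) (P : (Z ⟶ L) → Prop)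
    (hP : ∀ (b : Z ⟶ L) (ξ : Z ≅ Z), P (ξ.hom ≫ b) ↔ P b) :
    ∑ o : PreOrbit Z L, (if P o.out then 1 else 0 : ZMod (Nat.card k - 1)) =
      ∑ o : PreOrbit Z M, (if o.out ≠ 0 then
        (Nat.card {b : Z ⟶ L // b ≫ l = o.out ∧ P b} : ZMod (Nat.card k - 1)) else 0) +
      ∑ o : PreOrbit Z L, if P o.out ∧ o.out ≫ l = 0 then 1 else 0 := by
  obtain ⟨n, h1, h2⟩ := sum_pre k hZ (M := L) (fun b => if P b ∧ b ≫ l ≠ 0 then 1 else 0)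
    (fun b ξ => by simp [hP]) (by simp)
  obtain ⟨n', h1', h2'⟩ := sum_pre k hZ (M := M)
    (fun c => if c ≠ 0 then Nat.card {b : Z ⟶ L // b ≫ l = c ∧ P b} else 0)
    (fun c ξ => by
      have : Nat.card {b : Z ⟶ L // b ≫ l = ξ.hom ≫ c ∧ P b} =
          Nat.card {b : Z ⟶ L // b ≫ l = c ∧ P b} := by
        refine Nat.card_congr ((ξ.homFromEquiv (Z := L)).subtypeEquiv fun b => ?_)
        change _ ↔ (ξ.symm.hom ≫ b) ≫ l = c ∧ P (ξ.symm.hom ≫ b)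
        rw [hP, Category.assoc, Iso.symm_hom, Iso.inv_comp_eq]
      simp only [this, Preadditive.IsIso.comp_left_eq_zero, ne_eq]) (by simp)
  have h3 : n = n' := by
    refine unitCard_mul_cancel k hZ ?_
    rw [← h1, ← h1', ← Finset.sum_fiberwise Finset.univ (fun b => b ≫ l)]
    refine Finset.sum_congr rfl fun c _ => ?_
    rw [Nat.card_eq_fintype_card, Fintype.card_subtype]
    rw [← Finset.sum_filter, Finset.filter_filter, ← Finset.card_eq_sum_ones]
    split_ifs with hc
    · congr 1
      ext b
      simp only [Finset.mem_filter, Finset.mem_univ, true_and]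
      constructor
      · rintro ⟨h, h', -⟩; exact ⟨h, h'⟩
      · rintro ⟨h, h'⟩; exact ⟨h, h', by rwa [h]⟩
    · rw [Finset.card_eq_zero, Finset.filter_eq_empty_iff]
      rintro b - ⟨h, h', h''⟩
      exact h'' (by rw [h]; simpa using hc)
  have h4 : ∑ o : PreOrbit Z M, (if o.out ≠ 0 then
        (Nat.card {b : Z ⟶ L // b ≫ l = o.out ∧ P b} : ZMod (Nat.card k - 1)) else 0) = n := by
    rw [h3, h2']
    exact Finset.sum_congr rfl fun o _ => by split_ifs <;> simp
  rw [h4, h2, ← Finset.sum_add_distrib]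
  refine Finset.sum_congr rfl fun o _ => ?_
  by_cases hp : P o.out <;> by_cases h0 : o.out ≫ l = 0 <;> simp [hp, h0]

/-- A set of nonzero vectors that is stable under scaling has cardinality divisible by `q - 1`. -/
lemma natCast_card_eq_zero_of_smul {V : Type*} [AddCommGroup V] [Module k V] [Finite V]
    (P : V → Prop) (hP : ∀ (c : kˣ) x, P x → P (c • x)) (h0 : ¬ P 0) :
    (Nat.card {x // P x} : ZMod (Nat.card k - 1)) = 0 := by
  obtain ⟨n, h1, -⟩ := sum_eq_mul_classSum (MulAction.orbitRel kˣ V) (q := Nat.card k)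
    (D := Nat.card k - 1) Nat.card_pos (fun x => if P x then 1 else 0)
    (by
      rintro _ x ⟨c, rfl⟩
      have : P (c • x) ↔ P x := ⟨fun h => by simpa using hP c⁻¹ _ h, hP c x⟩
      simp [this])
    (by
      intro x hx
      refine ⟨0, ?_⟩
      have hx0 : x ≠ 0 := by
        rintro rfl
        simp [h0] at hx
      rw [pow_zero, mul_one, ← Nat.card_units]
      refine (Nat.card_congr
        (Equiv.ofBijective (fun c : kˣ => ⟨c⁻¹ • x, c, by simp⟩) ⟨?_, ?_⟩)).symm
      · intro c c' h
        have h' : ((c⁻¹ : kˣ) : k) • x = ((c'⁻¹ : kˣ) : k) • x := congrArg Subtype.val h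
        have := smul_left_injective k hx0 h'
        simpa [Units.ext_iff] using this
      · rintro ⟨y, c, hc⟩
        refine ⟨c, Subtype.ext ?_⟩
        simp [← hc])
  rw [Finset.sum_boole, ← Fintype.card_subtype, ← Nat.card_eq_fintype_card] at h1
  simp only [Nat.cast_id] at h1
  rw [h1, Nat.cast_mul, ZMod.natCast_self, zero_mul]

end Orbits

/-! ### Cones and fibres -/

section Triangles

variable {C : Type u} [Category.{v} C] [Preadditive C] [HasZeroObject C] [HasShift C ℤ]
  [∀ n : ℤ, (shiftFunctor C n).Additive] [Pretriangulated C]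

/-- The sequence `Y ⟶ L ⟶ X ⟶ Y⟦1⟧` is an exact triangle. -/
abbrev Tri {Y L X : C} (f : Y ⟶ L) (g : L ⟶ X) (h : X ⟶ Y⟦(1 : ℤ)⟧) : Prop :=
  Triangle.mk f g h ∈ distTriang C

/-- The morphisms `f` and `g` are the first two morphisms of an exact triangle. -/
def IsPair {Y L X : C} (f : Y ⟶ L) (g : L ⟶ X) : Prop := ∃ h, Tri f g h

/-- `X` is a cone of `f`. -/
def IsCone {Y L : C} (f : Y ⟶ L) (X : C) : Prop := ∃ g : L ⟶ X, IsPair f g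

/-- `Y` is a fibre (a shifted cone) of `g`. -/
def IsFib {L X : C} (g : L ⟶ X) (Y : C) : Prop := ∃ f : Y ⟶ L, IsPair f g

lemma Tri.rotate {Y L X : C} {f : Y ⟶ L} {g : L ⟶ X} {h : X ⟶ Y⟦(1 : ℤ)⟧} (H : Tri f g h) :
    Tri g h (-f⟦(1 : ℤ)⟧') := rot_of_distTriang _ H

lemma Tri.of_rotate {Y L X : C} {f : Y ⟶ L} {g : L ⟶ X} {h : X ⟶ Y⟦(1 : ℤ)⟧}
    (H : Tri g h (-f⟦(1 : ℤ)⟧')) : Tri f g h :=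
  (rotate_distinguished_triangle (Triangle.mk f g h)).2 H

lemma Tri.of_iso {Y L X Y' L' X' : C} {f : Y ⟶ L} {g : L ⟶ X} {h : X ⟶ Y⟦(1 : ℤ)⟧}
    (H : Tri f g h) {f' : Y' ⟶ L'} {g' : L' ⟶ X'} {h' : X' ⟶ Y'⟦(1 : ℤ)⟧}
    (a : Y ≅ Y') (b : L ≅ L') (c : X ≅ X') (h1 : f ≫ b.hom = a.hom ≫ f')
    (h2 : g ≫ c.hom = b.hom ≫ g') (h3 : h ≫ a.hom⟦(1 : ℤ)⟧' = c.hom ≫ h') : Tri f' g' h' :=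
  isomorphic_distinguished _ H _ (Triangle.isoMk _ _ a b c h1 h2 h3).symm

lemma Tri.neg₂₃ {Y L X : C} {f : Y ⟶ L} {g : L ⟶ X} {h : X ⟶ Y⟦(1 : ℤ)⟧} (H : Tri f g h) :
    Tri f (-g) (-h) :=
  H.of_iso (Iso.refl _) (Iso.refl _) (-(Iso.refl _)) (by simp) (by simp) (by simp)

lemma Tri.zero₁₂ {Y L X : C} {f : Y ⟶ L} {g : L ⟶ X} {h : X ⟶ Y⟦(1 : ℤ)⟧} (H : Tri f g h) :
    f ≫ g = 0 := comp_distTriang_mor_zero₁₂ _ H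

lemma Tri.zero₂₃ {Y L X : C} {f : Y ⟶ L} {g : L ⟶ X} {h : X ⟶ Y⟦(1 : ℤ)⟧} (H : Tri f g h) :
    g ≫ h = 0 := comp_distTriang_mor_zero₂₃ _ H

lemma Tri.zero₃₁ {Y L X : C} {f : Y ⟶ L} {g : L ⟶ X} {h : X ⟶ Y⟦(1 : ℤ)⟧} (H : Tri f g h) :
    h ≫ f⟦(1 : ℤ)⟧' = 0 := comp_distTriang_mor_zero₃₁ _ H

lemma Tri.yoneda₃ {Y L X W : C} {f : Y ⟶ L} {g : L ⟶ X} {h : X ⟶ Y⟦(1 : ℤ)⟧} (H : Tri f g h)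
    (b : X ⟶ W) (hb : g ≫ b = 0) : ∃ t : Y⟦(1 : ℤ)⟧ ⟶ W, b = h ≫ t :=
  Triangle.yoneda_exact₃ _ H b hb

lemma Tri.coyoneda₁ {Y L X W : C} {f : Y ⟶ L} {g : L ⟶ X} {h : X ⟶ Y⟦(1 : ℤ)⟧} (H : Tri f g h)
    (b : W ⟶ Y⟦(1 : ℤ)⟧) (hb : b ≫ f⟦(1 : ℤ)⟧' = 0) : ∃ t : W ⟶ X, b = t ≫ h :=
  Triangle.coyoneda_exact₁ _ H b hb

lemma Tri.yoneda₁ {Y L X W : C} {f : Y ⟶ L} {g : L ⟶ X} {h : X ⟶ Y⟦(1 : ℤ)⟧} (H : Tri f g h)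
    (b : Y ⟶ W) (hb : h ≫ b⟦(1 : ℤ)⟧' = 0) : ∃ t : L ⟶ W, b = f ≫ t := by
  obtain ⟨t, ht⟩ := H.rotate.yoneda₃ (b⟦(1 : ℤ)⟧') hb
  obtain ⟨t, rfl⟩ := (shiftFunctor C (1 : ℤ)).map_surjective t
  refine ⟨-t, (shiftFunctor C (1 : ℤ)).map_injective ?_⟩
  rw [ht]
  simp

lemma exists_tri_cone {Y L : C} (f : Y ⟶ L) :
    ∃ (X : C) (g : L ⟶ X) (h : X ⟶ Y⟦(1 : ℤ)⟧), Tri f g h := distinguished_cocone_triangle f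

lemma exists_tri_fib {L X : C} (g : L ⟶ X) :
    ∃ (Y : C) (f : Y ⟶ L) (h : X ⟶ Y⟦(1 : ℤ)⟧), Tri f g h := distinguished_cocone_triangle₁ g

/-- Two triangles with the same first morphism are isomorphic. -/
lemma Tri.exists_iso₃ {Y L X X' : C} {f : Y ⟶ L} {g : L ⟶ X} {h : X ⟶ Y⟦(1 : ℤ)⟧}
    {g' : L ⟶ X'} {h' : X' ⟶ Y⟦(1 : ℤ)⟧} (H : Tri f g h) (H' : Tri f g' h') :
    ∃ e : X ≅ X', g ≫ e.hom = g' ∧ h = e.hom ≫ h' := by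
  let e := isoTriangleOfIso₁₂ _ _ H H' (Iso.refl Y) (Iso.refl L)
    (by change f ≫ 𝟙 L = 𝟙 Y ≫ f; simp)
  refine ⟨Triangle.π₃.mapIso e, ?_, ?_⟩
  · exact e.hom.comm₂.trans (Category.id_comp g')
  · have h1 : h ≫ (𝟙 Y)⟦(1 : ℤ)⟧' = e.hom.hom₃ ≫ h' := e.hom.comm₃
    rwa [CategoryTheory.Functor.map_id, Category.comp_id] at h1

/-- Two triangles with the same second morphism are isomorphic. -/
lemma Tri.exists_iso₁ {Y Y' L X : C} {f : Y ⟶ L} {g : L ⟶ X} {h : X ⟶ Y⟦(1 : ℤ)⟧}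
    {f' : Y' ⟶ L} {h' : X ⟶ Y'⟦(1 : ℤ)⟧} (H : Tri f g h) (H' : Tri f' g h') :
    ∃ e : Y ≅ Y', f = e.hom ≫ f' ∧ h ≫ e.hom⟦(1 : ℤ)⟧' = h' := by
  obtain ⟨e, h1, h2⟩ := H.rotate.exists_iso₃ H'.rotate
  refine ⟨(shiftFunctor C (1 : ℤ)).preimageIso e, ?_, by simpa using h1⟩
  apply (shiftFunctor C (1 : ℤ)).map_injective
  rw [Preadditive.comp_neg, neg_inj] at h2
  simpa using h2

lemma Tri.isCone_iff {Y L X : C} {f : Y ⟶ L} {g : L ⟶ X} {h : X ⟶ Y⟦(1 : ℤ)⟧} (H : Tri f g h)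
    (X' : C) : IsCone f X' ↔ Nonempty (X ≅ X') := by
  constructor
  · rintro ⟨g', h', H'⟩
    obtain ⟨e, -⟩ := H.exists_iso₃ H'
    exact ⟨e⟩
  · rintro ⟨e⟩
    exact ⟨g ≫ e.hom, e.inv ≫ h, H.of_iso (Iso.refl _) (Iso.refl _) e (by simp) (by simp)
      (by simp)⟩

lemma Tri.isFib_iff {Y L X : C} {f : Y ⟶ L} {g : L ⟶ X} {h : X ⟶ Y⟦(1 : ℤ)⟧} (H : Tri f g h)
    (Y' : C) : IsFib g Y' ↔ Nonempty (Y ≅ Y') := by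
  constructor
  · rintro ⟨f', h', H'⟩
    obtain ⟨e, -⟩ := H.exists_iso₁ H'
    exact ⟨e⟩
  · rintro ⟨e⟩
    exact ⟨e.inv ≫ f, h ≫ e.hom⟦(1 : ℤ)⟧', H.of_iso e (Iso.refl _) (Iso.refl _) (by simp) (by simp)
      (by simp)⟩

lemma isPair_iff_exists_post {Y L X : C} {f : Y ⟶ L} {g : L ⟶ X} (H : IsPair f g) (g' : L ⟶ X) :
    IsPair f g' ↔ postSetoid L X g g' := by
  obtain ⟨h, H⟩ := H
  constructor
  · rintro ⟨h', H'⟩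
    obtain ⟨e, he, -⟩ := H.exists_iso₃ H'
    exact ⟨e, he⟩
  · rintro ⟨e, rfl⟩
    exact ⟨e.inv ≫ h, H.of_iso (Iso.refl _) (Iso.refl _) e (by simp) (by simp) (by simp)⟩

lemma isPair_iff_exists_pre {Y L X : C} {f : Y ⟶ L} {g : L ⟶ X} (H : IsPair f g) (f' : Y ⟶ L) :
    IsPair f' g ↔ preSetoid Y L f f' := by
  obtain ⟨h, H⟩ := H
  constructor
  · rintro ⟨h', H'⟩
    obtain ⟨e, he, -⟩ := H.exists_iso₁ H'
    exact ⟨e.symm, by simp [he]⟩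
  · rintro ⟨e, rfl⟩
    exact ⟨h ≫ e.inv⟦(1 : ℤ)⟧', H.of_iso e.symm (Iso.refl _) (Iso.refl _) (by simp) (by simp)
      (by simp)⟩

lemma isPair_congr {Y L X Y' L' X' : C} {f : Y ⟶ L} {g : L ⟶ X} {f' : Y' ⟶ L'} {g' : L' ⟶ X'}
    (H : IsPair f g) (a : Y ≅ Y') (b : L ≅ L') (c : X ≅ X') (h1 : f ≫ b.hom = a.hom ≫ f')
    (h2 : g ≫ c.hom = b.hom ≫ g') : IsPair f' g' := by
  obtain ⟨h, H⟩ := H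
  exact ⟨c.inv ≫ h ≫ a.hom⟦(1 : ℤ)⟧', H.of_iso a b c h1 h2 (by simp)⟩

lemma isCone_congr {Y L X Y' L' X' : C} {f : Y ⟶ L} {f' : Y' ⟶ L'} (a : Y ≅ Y') (b : L ≅ L')
    (c : X ≅ X') (h1 : f ≫ b.hom = a.hom ≫ f') : IsCone f X ↔ IsCone f' X' := by
  constructor
  · rintro ⟨g, H⟩
    exact ⟨b.inv ≫ g ≫ c.hom, isPair_congr H a b c h1 (by simp)⟩
  · rintro ⟨g, H⟩
    refine ⟨b.hom ≫ g ≫ c.inv, isPair_congr H a.symm b.symm c.symm ?_ (by simp)⟩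
    rw [Iso.symm_hom, Iso.symm_hom, Iso.comp_inv_eq, Category.assoc, h1, Iso.inv_hom_id_assoc]

lemma isFib_congr {L X Y L' X' Y' : C} {g : L ⟶ X} {g' : L' ⟶ X'} (b : L ≅ L') (c : X ≅ X')
    (a : Y ≅ Y') (h2 : g ≫ c.hom = b.hom ≫ g') : IsFib g Y ↔ IsFib g' Y' := by
  constructor
  · rintro ⟨f, H⟩
    exact ⟨a.inv ≫ f ≫ b.hom, isPair_congr H a b c (by simp) h2⟩
  · rintro ⟨f, H⟩
    refine ⟨a.hom ≫ f ≫ b.inv, isPair_congr H a.symm b.symm c.symm (by simp) ?_⟩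
    rw [Iso.symm_hom, Iso.symm_hom, Iso.comp_inv_eq, Category.assoc, h2, Iso.inv_hom_id_assoc]

lemma isFib_comp_iso {L X Y : C} (g : L ⟶ X) (ξ : X ≅ X) : IsFib (g ≫ ξ.hom) Y ↔ IsFib g Y :=
  (isFib_congr (Iso.refl _) ξ (Iso.refl _) (by simp)).symm

lemma isCone_iso_comp {Y L X : C} (f : Y ⟶ L) (η : Y ≅ Y) : IsCone (η.hom ≫ f) X ↔ IsCone f X :=
  isCone_congr η (Iso.refl _) (Iso.refl _) (by simp)

lemma isCone_comp_iso {Y L L' X : C} (f : Y ⟶ L) (ξ : L ≅ L') :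
    IsCone (f ≫ ξ.hom) X ↔ IsCone f X :=
  (isCone_congr (Iso.refl _) ξ (Iso.refl _) (by simp)).symm

lemma isFib_iso_comp {L L' X Y : C} (g : L' ⟶ X) (ξ : L ≅ L') :
    IsFib (ξ.hom ≫ g) Y ↔ IsFib g Y :=
  (isFib_congr ξ (Iso.refl _) (Iso.refl _) (by simp))

lemma nonempty_iso_of_shift {X Y : C} (h : Nonempty (X⟦(1 : ℤ)⟧ ≅ Y⟦(1 : ℤ)⟧)) : Nonempty (X ≅ Y) :=
  h.map fun e => (shiftFunctor C (1 : ℤ)).preimageIso e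

lemma Tri.shift {Y L X : C} {f : Y ⟶ L} {g : L ⟶ X} {h : X ⟶ Y⟦(1 : ℤ)⟧} (H : Tri f g h) :
    Tri (f⟦(1 : ℤ)⟧') (g⟦(1 : ℤ)⟧') (-h⟦(1 : ℤ)⟧') := by
  have h1 := H.rotate.rotate.rotate
  refine h1.of_iso (Iso.refl _) (-(Iso.refl _)) (Iso.refl _) ?_ ?_ ?_ <;> simp

lemma isCone_shift_iff {Y L : C} (f : Y ⟶ L) (X : C) :
    IsCone (f⟦(1 : ℤ)⟧') (X⟦(1 : ℤ)⟧) ↔ IsCone f X := by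
  obtain ⟨X', g', h', H'⟩ := exists_tri_cone f
  rw [H'.isCone_iff, H'.shift.isCone_iff]
  exact ⟨nonempty_iso_of_shift, fun h => h.map fun e => (shiftFunctor C (1 : ℤ)).mapIso e⟩

/-- A fibre of the zero morphism splits as a biproduct. -/
lemma isFib_zero {L X Y : C} (h : IsFib (0 : L ⟶ X) Y) :
    Nonempty (Y ≅ X⟦(-1 : ℤ)⟧ ⊞ L) := by
  obtain ⟨f, h, H⟩ := h
  obtain ⟨e, -⟩ := exists_iso_binaryBiproduct_of_distTriang _ (inv_rot_of_distTriang _ H)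
    zero_comp
  exact ⟨e⟩

/-- A cone of the zero morphism splits as a biproduct. -/
lemma isCone_zero {L X Y : C} (h : IsCone (0 : L ⟶ X) Y) :
    Nonempty (Y ≅ X ⊞ L⟦(1 : ℤ)⟧) := by
  obtain ⟨f, h, H⟩ := h
  obtain ⟨e, -⟩ := exists_iso_binaryBiproduct_of_distTriang _ H.rotate
    (by change -((0 : L ⟶ X)⟦(1 : ℤ)⟧') = 0; simp)
  exact ⟨e⟩

lemma not_isZero_shift {X : C} (h : ¬ IsZero X) (n : ℤ) : ¬ IsZero (X⟦n⟧) := by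
  rw [IsZero.iff_id_eq_zero] at h ⊢
  intro h'
  apply h
  apply (shiftFunctor C n).map_injective
  simpa using h'

lemma not_isFib_zero {L X Y : C} (hY : Indecomposable Y) (hL : ¬ IsZero L) (hX : ¬ IsZero X) :
    ¬ IsFib (0 : L ⟶ X) Y := by
  intro h
  obtain ⟨e⟩ := isFib_zero h
  rcases hY.2 _ _ e with h | h
  · exact not_isZero_shift hX _ h
  · exact hL h

lemma not_isCone_zero {L X Y : C} (hY : Indecomposable Y) (hL : ¬ IsZero L) (hX : ¬ IsZero X) :
    ¬ IsCone (0 : L ⟶ X) Y := by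
  intro h
  obtain ⟨e⟩ := isCone_zero h
  rcases hY.2 _ _ e with h | h
  · exact hX h
  · exact not_isZero_shift hL _ h

lemma _root_.CategoryTheory.Indecomposable.of_iso {X Y : C} (hX : Indecomposable X)
    (e : X ≅ Y) : Indecomposable Y :=
  ⟨fun h => hX.1 (h.of_iso e), fun A B e' => hX.2 A B (e ≪≫ e')⟩

lemma Tri.isZero₃_iff {Y L X : C} {f : Y ⟶ L} {g : L ⟶ X} {h : X ⟶ Y⟦(1 : ℤ)⟧} (H : Tri f g h) :
    IsZero X ↔ IsIso f := Triangle.isZero₃_iff_isIso₁ _ H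

lemma Tri.isZero₁_iff {Y L X : C} {f : Y ⟶ L} {g : L ⟶ X} {h : X ⟶ Y⟦(1 : ℤ)⟧} (H : Tri f g h) :
    IsZero Y ↔ IsIso g := Triangle.isZero₁_iff_isIso₂ _ H

lemma tri_inl_snd (M N : C) : Tri (biprod.inl : M ⟶ M ⊞ N) biprod.snd 0 :=
  binaryBiproductTriangle_distinguished M N

lemma tri_inr_fst (M N : C) : Tri (biprod.inr : N ⟶ M ⊞ N) biprod.fst 0 :=
  (tri_inl_snd N M).of_iso (Iso.refl _) (biprod.braiding N M) (Iso.refl _)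
    (by apply biprod.hom_ext <;> simp) (by simp) (by simp)

variable [IsTriangulated C]

/-- Homotopy pushout: for a triangle `Z ⟶ E ⟶ P` where `E` is a biproduct with components `M` and
`N` (`ι`, `π`, `r` being the inclusion of `N` and the two projections), a cone `L` of the component
`Z ⟶ M` fits into a triangle `N ⟶ P ⟶ L ⟶ N⟦1⟧`, whose last morphism is determined by the other
component. -/
lemma Tri.pushout {Z E P M N L : C} {f : Z ⟶ E} {g : E ⟶ P} {h : P ⟶ Z⟦(1 : ℤ)⟧} (H : Tri f g h)
    {ι : N ⟶ E} {π : E ⟶ M} (hE : Tri ι π 0) (r : E ⟶ N) (hr : ι ≫ r = 𝟙 N)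
    {a : M ⟶ L} {p : L ⟶ Z⟦(1 : ℤ)⟧} (HL : Tri (f ≫ π) a p) :
    ∃ b : P ⟶ L, Tri (ι ≫ g) b (p ≫ (f ≫ r)⟦(1 : ℤ)⟧') := by
  let o := Triangulated.someOctahedron rfl H hE.rotate HL
  have h1 : o.m₃ = -(p ≫ (f ≫ r)⟦(1 : ℤ)⟧') := by
    have := congrArg (fun x => x ≫ r⟦(1 : ℤ)⟧') o.comm₄
    simp only [Category.assoc, Preadditive.neg_comp, Preadditive.comp_neg,
      ← Functor.map_comp, hr] at this
    rw [this]
    simp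
  have h2 : Tri o.m₁ o.m₃ (-(ι ≫ g)⟦(1 : ℤ)⟧') := by
    have := o.mem
    simpa using this
  rw [h1] at h2
  refine ⟨-o.m₁, ?_⟩
  simpa using h2.of_rotate.neg₂₃

/-- Homotopy pullback, dual to `Tri.pushout`. -/
lemma Tri.pullback {Z E Y M N L : C} {f : Z ⟶ E} {g : E ⟶ Y} {h : Y ⟶ Z⟦(1 : ℤ)⟧} (H : Tri f g h)
    {ι : M ⟶ E} {π : E ⟶ N} (hE : Tri ι π 0) (r : N ⟶ E) (hr : r ≫ π = 𝟙 N)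
    {l : L ⟶ M} {s : Y ⟶ L⟦(1 : ℤ)⟧} (HL : Tri l (ι ≫ g) s) :
    ∃ b : L⟦(1 : ℤ)⟧ ⟶ Z⟦(1 : ℤ)⟧, Tri (f ≫ π) ((r ≫ g) ≫ s) b := by
  let o := Triangulated.someOctahedron rfl hE H.rotate HL.rotate
  have h1 : o.m₁ = (r ≫ g) ≫ s := by
    have := congrArg (fun x => r ≫ x) o.comm₁
    simpa [reassoc_of% hr] using this
  refine ⟨o.m₃, Tri.of_rotate ?_⟩
  rw [← h1]
  have := o.mem
  simpa using this

end Triangles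

/-! ### Hall numbers as numbers of orbits -/

section HallNumbers

open scoped Classical

variable {C : Type u} [Category.{v} C] [Preadditive C] [HasZeroObject C] [HasShift C ℤ]
  [∀ n : ℤ, (shiftFunctor C n).Additive] [Pretriangulated C]

lemma card_quotient_eq_of_surjective {A B : Type*} (r : Setoid A) (s : Setoid B) (φ : A → B)
    (hφ : Function.Surjective φ) (h : ∀ a a', r a a' ↔ s (φ a) (φ a')) :
    Nat.card (Quotient r) = Nat.card (Quotient s) := by
  refine Nat.card_congr (Equiv.ofBijective
    (Quotient.map' (s₁ := r) (s₂ := s) φ fun a a' => (h a a').1) ⟨?_, ?_⟩)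
  · intro x y
    induction x using Quotient.inductionOn
    induction y using Quotient.inductionOn
    intro hxy
    exact Quotient.sound ((h _ _).2 (Quotient.exact hxy))
  · intro y
    induction y using Quotient.inductionOn with
    | h b =>
      obtain ⟨a, rfl⟩ := hφ b
      exact ⟨Quotient.mk _ a, rfl⟩

lemma hallNumber_eq_card_post (X Y L : C) : hallNumber X Y L =
    Nat.card (Quotient ((postSetoid L X).comap (Subtype.val : {g : L ⟶ X // IsFib g Y} → _))) := by
  refine card_quotient_eq_of_surjective _ _
    (fun t : TriangleSet X Y L => ⟨t.g, t.f, t.h, t.dist⟩) ?_ ?_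
  · rintro ⟨g, f, h, H⟩
    exact ⟨⟨f, g, h, H⟩, rfl⟩
  · rintro ⟨f, g, h, H⟩ ⟨f', g', h', H'⟩
    constructor
    · rintro ⟨η, ξ, -, h2, -⟩
      exact ⟨ξ, h2⟩
    · rintro ⟨ξ, rfl : g ≫ ξ.hom = g'⟩
      have H1 : Tri f (g ≫ ξ.hom) (ξ.inv ≫ h) :=
        Tri.of_iso H (Iso.refl _) (Iso.refl _) ξ (by simp) (by simp) (by simp)
      obtain ⟨e, he, he'⟩ := H1.exists_iso₁ H'
      refine ⟨e, ξ, he.symm, rfl, ?_⟩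
      change h ≫ e.hom⟦(1 : ℤ)⟧' = ξ.hom ≫ h'
      rw [← he']
      simp

lemma hallNumber_eq_card_pre (X Y L : C) : hallNumber X Y L =
    Nat.card (Quotient ((preSetoid Y L).comap (Subtype.val : {f : Y ⟶ L // IsCone f X} → _))) := by
  refine card_quotient_eq_of_surjective _ _
    (fun t : TriangleSet X Y L => ⟨t.f, t.g, t.h, t.dist⟩) ?_ ?_
  · rintro ⟨f, g, h, H⟩
    exact ⟨⟨f, g, h, H⟩, rfl⟩
  · rintro ⟨f, g, h, H⟩ ⟨f', g', h', H'⟩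
    constructor
    · rintro ⟨η, ξ, h2, -, -⟩
      refine ⟨η.symm, ?_⟩
      change η.inv ≫ f = f'
      rw [Iso.inv_comp_eq]
      exact h2.symm
    · rintro ⟨η, rfl : η.hom ≫ f = f'⟩
      have H1 : Tri (η.hom ≫ f) g (h ≫ η.inv⟦(1 : ℤ)⟧') :=
        Tri.of_iso H η.symm (Iso.refl _) (Iso.refl _) (by simp) (by simp) (by simp)
      obtain ⟨e, he, he'⟩ := H1.exists_iso₃ H'
      refine ⟨η.symm, e, by simp, he, ?_⟩
      simpa using he'

lemma hallNumber_congr {X X' Y Y' L L' : C} (a : X ≅ X') (b : Y ≅ Y') (c : L ≅ L') :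
    hallNumber X Y L = hallNumber X' Y' L' := by
  rw [hallNumber_eq_card_post, hallNumber_eq_card_post]
  refine card_quotient_eq_of_surjective _ _
    (fun g => ⟨c.inv ≫ g.1 ≫ a.hom, (isFib_congr c a b (by simp)).1 g.2⟩) ?_ ?_
  · rintro ⟨g, hg⟩
    exact ⟨⟨c.hom ≫ g ≫ a.inv, (isFib_congr c a b (by simp)).2 hg⟩, by simp⟩
  · rintro ⟨g, hg⟩ ⟨g', hg'⟩
    constructor
    · rintro ⟨ξ, rfl : g ≫ ξ.hom = g'⟩
      exact ⟨a.symm ≪≫ ξ ≪≫ a, by simp⟩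
    · rintro ⟨ξ, h : (c.inv ≫ g ≫ a.hom) ≫ ξ.hom = c.inv ≫ g' ≫ a.hom⟩
      refine ⟨a ≪≫ ξ ≪≫ a.symm, ?_⟩
      change g ≫ a.hom ≫ ξ.hom ≫ a.inv = g'
      simp only [Category.assoc, Iso.cancel_iso_inv_left] at h
      rw [reassoc_of% h]
      simp

variable [∀ X Y : C, Finite (X ⟶ Y)]

lemma hallNumber_eq_post (X Y L : C) :
    hallNumber X Y L = ∑ o : PostOrbit L X, if IsFib o.out Y then 1 else 0 := by
  rw [hallNumber_eq_card_post]
  refine card_quotient_subtype _ _ ?_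
  rintro g _ ⟨ξ, rfl⟩ h
  exact (isFib_comp_iso g ξ).2 h

lemma hallNumber_eq_pre (X Y L : C) :
    hallNumber X Y L = ∑ o : PreOrbit Y L, if IsCone o.out X then 1 else 0 := by
  rw [hallNumber_eq_card_pre]
  refine card_quotient_subtype _ _ ?_
  rintro g _ ⟨ξ, rfl⟩ h
  exact (isCone_iso_comp g ξ).2 h

lemma exists_tri_of_hallNumber_ne_zero {X Y L : C} (h : hallNumber X Y L ≠ 0) :
    ∃ (f : Y ⟶ L) (g : L ⟶ X) (h : X ⟶ Y⟦(1 : ℤ)⟧), Tri f g h := by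
  have : Nonempty (Quotient (triangleSetoid X Y L)) := by
    by_contra hn
    rw [not_nonempty_iff] at hn
    exact h Nat.card_of_isEmpty
  obtain ⟨x⟩ := this
  exact ⟨x.out.f, x.out.g, x.out.h, x.out.dist⟩

/-- The isomorphisms `L ⟶ X` form a single orbit. -/
lemma sum_post_isIso {R : Type*} [AddCommMonoid R] (r : R) (L X : C) :
    ∑ o : PostOrbit L X, (if IsIso o.out then r else 0) = if Nonempty (L ≅ X) then r else 0 := by
  split_ifs with h
  · obtain ⟨e⟩ := h
    rw [Fintype.sum_eq_single (Quotient.mk _ e.hom)]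
    · obtain ⟨ξ, hξ⟩ := Quotient.mk_out (s := postSetoid L X) e.hom
      rw [if_pos]
      have : (Quotient.mk (postSetoid L X) e.hom).out = e.hom ≫ ξ.inv := by
        rw [Iso.eq_comp_inv]; exact hξ
      rw [this]
      infer_instance
    · intro o ho
      rw [if_neg]
      intro hi
      apply ho
      rw [← Quotient.out_eq o]
      exact Quotient.sound ⟨(asIso o.out).symm ≪≫ e, by simp⟩
  · refine Finset.sum_eq_zero fun o _ => ?_
    rw [if_neg]
    intro hi
    exact h ⟨asIso o.out⟩

/-- The isomorphisms `Z ⟶ M` form a single orbit. -/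
lemma sum_pre_isIso {R : Type*} [AddCommMonoid R] (r : R) (Z M : C) :
    ∑ o : PreOrbit Z M, (if IsIso o.out then r else 0) = if Nonempty (Z ≅ M) then r else 0 := by
  split_ifs with h
  · obtain ⟨e⟩ := h
    rw [Fintype.sum_eq_single (Quotient.mk _ e.hom)]
    · obtain ⟨ξ, hξ⟩ := Quotient.mk_out (s := preSetoid Z M) e.hom
      rw [if_pos]
      have : (Quotient.mk (preSetoid Z M) e.hom).out = ξ.inv ≫ e.hom := by
        rw [Iso.eq_inv_comp]; exact hξ
      rw [this]
      infer_instance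
    · intro o ho
      rw [if_neg]
      intro hi
      apply ho
      rw [← Quotient.out_eq o]
      exact Quotient.sound ⟨e ≪≫ (asIso o.out).symm, by simp⟩
  · refine Finset.sum_eq_zero fun o _ => ?_
    rw [if_neg]
    intro hi
    exact h ⟨asIso o.out⟩

end HallNumbers

/-! ### Hall numbers with decomposable middle term -/

section Decomposable

open scoped Classical

variable {C : Type u} [Category.{v} C] [Preadditive C] [HasZeroObject C] [HasShift C ℤ]
  [∀ n : ℤ, (shiftFunctor C n).Additive] [Pretriangulated C] [IsTriangulated C]

/-- The fibre of a morphism that factors through the projection of a biproduct. -/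
lemma nonempty_iso_of_isFib_comp {K E Q X F Y : C} {ι : K ⟶ E} {π : E ⟶ Q} (hE : Tri ι π 0)
    {f : F ⟶ Q} {c : Q ⟶ X} {h : X ⟶ F⟦(1 : ℤ)⟧} (H : Tri f c h) (hY : IsFib (π ≫ c) Y) :
    Nonempty (Y ≅ K ⊞ F) := by
  obtain ⟨y, s, hY⟩ := hY
  let o := Triangulated.someOctahedron' rfl hE H hY
  obtain ⟨e, -⟩ := exists_iso_binaryBiproduct_of_distTriang _ o.mem
    (by change f ≫ (0 : Q ⟶ K⟦(1 : ℤ)⟧) = 0; simp)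
  exact ⟨e⟩

/-- If an indecomposable object `Y` is a fibre of a morphism factoring through the projection of a
biproduct with nonzero kernel `K`, then the morphism induced on the quotient is an isomorphism and
`K ≅ Y`. -/
lemma isIso_of_isFib_comp {K E Q X Y : C} {ι : K ⟶ E} {π : E ⟶ Q} (hE : Tri ι π 0)
    (hY : Indecomposable Y) (hK : ¬ IsZero K) {c : Q ⟶ X} (h : IsFib (π ≫ c) Y) :
    IsIso c ∧ Nonempty (K ≅ Y) := by
  obtain ⟨F, f, s, H⟩ := exists_tri_fib c
  obtain ⟨e⟩ := nonempty_iso_of_isFib_comp hE H h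
  have hF := (hY.2 _ _ e).resolve_left hK
  have hc : IsIso c := H.isZero₁_iff.1 hF
  refine ⟨hc, ?_⟩
  have H2 : Tri ι (π ≫ c) 0 :=
    hE.of_iso (Iso.refl _) (Iso.refl _) (asIso c) (by simp) (by simp) (by simp)
  exact (H2.isFib_iff Y).1 h

lemma isFib_comp_of_isIso {K E Q X : C} {ι : K ⟶ E} {π : E ⟶ Q} (hE : Tri ι π 0)
    {c : Q ⟶ X} [IsIso c] : IsFib (π ≫ c) K :=
  ⟨ι, 0, hE.of_iso (Iso.refl _) (Iso.refl _) (asIso c) (by simp) (by simp) (by simp)⟩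

variable [IsIdempotentComplete C] [∀ X Y : C, Finite (X ⟶ Y)]
variable (k : Type w) [Field k] [Finite k] [Linear k C]

/-- Scaling the second component of `b : L₁ ⊞ L₂ ⟶ X` shows that, modulo `q - 1`, only the
morphisms with vanishing second component contribute to a Hall number. -/
lemma natCast_hallNumber_biprod {X Y L₁ L₂ : C} (hX : Indecomposable X)
    (h : ∀ b : L₁ ⊞ L₂ ⟶ X, IsFib b Y → biprod.inl ≫ b ≠ 0) :
    (hallNumber X Y (L₁ ⊞ L₂) : ZMod (Nat.card k - 1)) =
      ∑ o : PostOrbit L₁ X, if o.out ≠ 0 ∧ IsFib (biprod.fst ≫ o.out : L₁ ⊞ L₂ ⟶ X) Y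
        then 1 else 0 := by
  rw [hallNumber_eq_post]
  push_cast
  rw [sum_post_fiber k hX (biprod.inl : L₁ ⟶ L₁ ⊞ L₂) (fun b => IsFib b Y)
    (fun b ξ => isFib_comp_iso b ξ)]
  have h1 : ∑ o : PostOrbit (L₁ ⊞ L₂) X, (if IsFib o.out Y ∧ biprod.inl ≫ o.out = 0 then 1 else 0 :
      ZMod (Nat.card k - 1)) = 0 :=
    Finset.sum_eq_zero fun o _ => if_neg fun h' => h _ h'.1 h'.2
  rw [h1, add_zero]
  refine Finset.sum_congr rfl fun o _ => ?_
  generalize o.out = c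
  by_cases hc : c = 0
  · simp [hc]
  rw [if_pos hc]
  have h2 : Nat.card {b : L₁ ⊞ L₂ ⟶ X // biprod.inl ≫ b = c ∧ IsFib b Y} =
      Nat.card {b : L₂ ⟶ X // IsFib (biprod.desc c b) Y} :=
    Nat.card_congr
      { toFun := fun b => ⟨biprod.inr ≫ b.1, by
          have : biprod.desc c (biprod.inr ≫ b.1) = b.1 := by
            apply biprod.hom_ext' <;> simp [b.2.1]
          rw [this]
          exact b.2.2⟩
        invFun := fun b => ⟨biprod.desc c b.1, by simp, b.2⟩
        left_inv := fun b => by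
          apply Subtype.ext
          apply biprod.hom_ext' <;> simp [b.2.1]
        right_inv := fun b => by simp }
  have h3 : Nat.card {b : L₂ ⟶ X // IsFib (biprod.desc c b) Y} =
      (if IsFib (biprod.desc c (0 : L₂ ⟶ X)) Y then 1 else 0) +
      Nat.card {b : L₂ ⟶ X // b ≠ 0 ∧ IsFib (biprod.desc c b) Y} := by
    simp only [Nat.card_eq_fintype_card, Fintype.card_subtype]
    rw [← Finset.card_filter_add_card_filter_not (s := Finset.univ.filter _) (fun b => b = 0)]
    congr 1
    · rw [Finset.filter_filter]
      split_ifs with h0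
      · rw [Finset.card_eq_one]
        refine ⟨0, ?_⟩
        ext b
        simp only [Finset.mem_filter, Finset.mem_univ, true_and, Finset.mem_singleton]
        exact ⟨fun h => h.2, fun h => ⟨by rwa [h], h⟩⟩
      · rw [Finset.card_eq_zero, Finset.filter_eq_empty_iff]
        rintro b - ⟨h', rfl⟩
        exact h0 h'
    · rw [Finset.filter_filter]
      congr 1
      ext b
      simp [and_comm]
  -- Scaling `b` is induced by an automorphism of `L₁ ⊞ L₂`, so the number of nonzero `b` is a
  -- multiple of `q - 1`.
  rw [h2, h3, Nat.cast_add, natCast_card_eq_zero_of_smul k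
    (fun b : L₂ ⟶ X => b ≠ 0 ∧ IsFib (biprod.desc c b) Y) _ (by simp), add_zero]
  · have : biprod.desc c (0 : L₂ ⟶ X) = biprod.fst ≫ c := by
      apply biprod.hom_ext' <;> simp
    rw [this]
    simp [hc]
  · rintro u b ⟨hb, hb'⟩
    refine ⟨(smul_ne_zero_iff_ne u).2 hb, ?_⟩
    let e : L₂ ≅ L₂ :=
      { hom := (u : k) • 𝟙 L₂
        inv := ((u⁻¹ : kˣ) : k) • 𝟙 L₂
        hom_inv_id := by simp [smul_smul]
        inv_hom_id := by simp [smul_smul] }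
    have : biprod.desc c (u • b) = (biprod.mapIso (Iso.refl L₁) e).hom ≫ biprod.desc c b := by
      apply biprod.hom_ext' <;> simp [e]
      rfl
    rw [this, isFib_iso_comp]
    exact hb'

/-- Modulo `q - 1` the Hall numbers of nonisomorphic indecomposable objects with nonzero
decomposable middle term vanish, except for the biproduct, where the Hall number is `1`. -/
theorem natCast_hallNumber_of_not_indecomposable {X Y L : C} (hX : Indecomposable X)
    (hY : Indecomposable Y) (hXY : ¬ Nonempty (X ≅ Y)) (hL : ¬ IsZero L)
    (hL' : ¬ Indecomposable L) :
    (hallNumber X Y L : ZMod (Nat.card k - 1)) = if Nonempty (L ≅ X ⊞ Y) then 1 else 0 := by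
  split_ifs with h
  · obtain ⟨e⟩ := h
    rw [hallNumber_congr (Iso.refl X) (Iso.refl Y) e, natCast_hallNumber_biprod k hX]
    · have h1 := sum_post_isIso (1 : ZMod (Nat.card k - 1)) X X
      rw [if_pos ⟨Iso.refl X⟩] at h1
      rw [← h1]
      refine Finset.sum_congr rfl fun o _ => ?_
      generalize o.out = c
      congr 1
      rw [eq_iff_iff]
      constructor
      · rintro ⟨-, h⟩
        exact (isIso_of_isFib_comp (tri_inr_fst X Y) hY hY.1 h).1
      · intro hc
        refine ⟨?_, isFib_comp_of_isIso (tri_inr_fst X Y)⟩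
        rintro rfl
        exact (radEnd k hX).zero_mem hc
    · intro b hb h0
      have : b = biprod.snd ≫ biprod.inr ≫ b := by apply biprod.hom_ext' <;> simp [h0]
      rw [this] at hb
      obtain ⟨h1, -⟩ := isIso_of_isFib_comp (tri_inl_snd X Y) hY hX.1 hb
      exact hXY ⟨(asIso (biprod.inr ≫ b)).symm⟩
  · have h1 : ∃ L₁ L₂ : C, Nonempty (L ≅ L₁ ⊞ L₂) ∧ ¬ IsZero L₁ ∧ ¬ IsZero L₂ := by
      by_contra hn
      push Not at hn
      refine hL' ⟨hL, fun A B e => ?_⟩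
      by_cases hA : IsZero A
      · exact Or.inl hA
      · exact Or.inr (hn A B ⟨e⟩ hA)
    obtain ⟨L₁, L₂, ⟨e⟩, h1, h2⟩ := h1
    rw [hallNumber_congr (Iso.refl X) (Iso.refl Y) e, natCast_hallNumber_biprod k hX]
    · refine Finset.sum_eq_zero fun o _ => if_neg ?_
      rintro ⟨-, ho⟩
      obtain ⟨h3, ⟨e'⟩⟩ := isIso_of_isFib_comp (tri_inr_fst L₁ L₂) hY h2 ho
      exact h ⟨e ≪≫ biprod.mapIso (asIso o.out) e'⟩
    · intro b hb h0
      have : b = biprod.snd ≫ biprod.inr ≫ b := by apply biprod.hom_ext' <;> simp [h0]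
      rw [this] at hb
      obtain ⟨h3, ⟨e'⟩⟩ := isIso_of_isFib_comp (tri_inl_snd L₁ L₂) hY h1 hb
      exact h ⟨e ≪≫ biprod.mapIso e' (asIso (biprod.inr ≫ b)) ≪≫ biprod.braiding _ _⟩

end Decomposable

/-! ### Comparing the two factorisations of a composition -/

section Comparison

open scoped Classical

/-- Double counting: if the fibres of a relation over the elements satisfying `P` and `Q` all have
`1` element in the coefficient ring, then `P` and `Q` have equally many solutions, as elements of
that ring. -/
lemma natCast_card_eq_of_relation {R : Type*} [CommRing R] {A B : Type*} [Finite A] [Finite B]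
    (S : A → B → Prop) (P : A → Prop) (Q : B → Prop)
    (hP : ∀ a, P a → (Nat.card {b // S a b} : R) = 1)
    (hQ : ∀ b, Q b → (Nat.card {a // S a b} : R) = 1) (hS : ∀ a b, S a b → (P a ↔ Q b)) :
    (Nat.card {a // P a} : R) = Nat.card {b // Q b} := by
  have h1 : (Nat.card {a // P a} : R) = ∑ a, ∑ b, if P a ∧ S a b then 1 else 0 := by
    rw [Nat.card_eq_fintype_card, Fintype.card_subtype, Finset.card_eq_sum_ones,
      Finset.sum_filter, Nat.cast_sum]
    refine Finset.sum_congr rfl fun a _ => ?_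
    by_cases ha : P a
    · have := hP a ha
      rw [Nat.card_eq_fintype_card, Fintype.card_subtype] at this
      simp [ha, this]
    · simp [ha]
  have h2 : (Nat.card {b // Q b} : R) = ∑ b, ∑ a, if Q b ∧ S a b then 1 else 0 := by
    rw [Nat.card_eq_fintype_card, Fintype.card_subtype, Finset.card_eq_sum_ones,
      Finset.sum_filter, Nat.cast_sum]
    refine Finset.sum_congr rfl fun a _ => ?_
    by_cases ha : Q a
    · have := hQ a ha
      rw [Nat.card_eq_fintype_card, Fintype.card_subtype] at this
      simp [ha, this]
    · simp [ha]
  rw [h1, h2, Finset.sum_comm]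
  refine Finset.sum_congr rfl fun b _ => Finset.sum_congr rfl fun a _ => ?_
  congr 1
  rw [eq_iff_iff]
  exact ⟨fun h => ⟨(hS a b h.2).1 h.1, h.2⟩, fun h => ⟨(hS a b h.2).2 h.1, h.2⟩⟩

/-- A coset of a subspace has cardinality `1` modulo `q - 1`. -/
lemma natCast_card_coset (k : Type*) [Field k] [Finite k] {V : Type*} [AddCommGroup V]
    [Module k V] [Finite V] (K : Submodule k V) (P : V → Prop) (x₀ : V)
    (h : ∀ x, P x ↔ x - x₀ ∈ K) : (Nat.card {x // P x} : ZMod (Nat.card k - 1)) = 1 := by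
  rw [← natCast_card_eq_one k (V := K)]
  congr 1
  refine Nat.card_congr ((Equiv.subRight x₀).subtypeEquiv fun x => ?_)
  exact h x

/-- Summing a function over the fibres of a linear map. -/
lemma sum_comp_linearMap {k V W : Type*} [Field k] [AddCommGroup V] [Module k V] [Finite V]
    [AddCommGroup W] [Module k W] [Finite W] (φ : V →ₗ[k] W) (f : W → ℕ)
    (hf : ∀ w, f w ≠ 0 → w ∈ LinearMap.range φ) :
    ∑ v, f (φ v) = Nat.card (LinearMap.ker φ) * ∑ w, f w := by
  rw [← Finset.sum_fiberwise Finset.univ φ, Finset.mul_sum]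
  refine Finset.sum_congr rfl fun w _ => ?_
  have h1 : ∑ v ∈ Finset.univ.filter (fun v => φ v = w), f (φ v) =
      (Finset.univ.filter (fun v => φ v = w)).card * f w := by
    rw [Finset.sum_congr rfl (g := fun _ => f w)
      fun v hv => by rw [(Finset.mem_filter.1 hv).2], Finset.sum_const, smul_eq_mul]
  rw [h1]
  by_cases hw : f w = 0
  · simp [hw]
  obtain ⟨v₀, rfl⟩ := hf w hw
  congr 1
  rw [← Fintype.card_subtype, ← Nat.card_eq_fintype_card]
  refine Nat.card_congr ((Equiv.subRight v₀).subtypeEquiv fun x => ?_)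
  simp [sub_eq_zero]

variable {C : Type u} [Category.{v} C] [Preadditive C]

/-- `1 + l ε` is invertible if `1 + ε l` is: its inverse is `1 - l (1 + ε l)⁻¹ ε`. -/
lemma isIso_one_add_comp {A B : C} (l : A ⟶ B) (ε : B ⟶ A) (h : IsIso (𝟙 B + ε ≫ l)) :
    IsIso (𝟙 A + l ≫ ε) := by
  let t := inv (𝟙 B + ε ≫ l)
  have h1 : t + ε ≫ l ≫ t = 𝟙 B := by
    have := IsIso.hom_inv_id (𝟙 B + ε ≫ l)
    rw [Preadditive.add_comp, Category.id_comp, Category.assoc] at this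
    exact this
  have h2 : t + t ≫ ε ≫ l = 𝟙 B := by
    have := IsIso.inv_hom_id (𝟙 B + ε ≫ l)
    rw [Preadditive.comp_add, Category.comp_id] at this
    exact this
  refine ⟨⟨𝟙 A - l ≫ t ≫ ε, ?_, ?_⟩⟩
  · have h3 : (𝟙 A + l ≫ ε) ≫ (𝟙 A - l ≫ t ≫ ε) =
        𝟙 A + l ≫ (𝟙 B - (t + ε ≫ l ≫ t)) ≫ ε := by
      simp only [Preadditive.add_comp, Preadditive.comp_sub, Preadditive.sub_comp,
        Preadditive.comp_add, Category.id_comp, Category.comp_id, Category.assoc]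
      abel
    rw [h3, h1]
    simp
  · have h3 : (𝟙 A - l ≫ t ≫ ε) ≫ (𝟙 A + l ≫ ε) =
        𝟙 A + l ≫ (𝟙 B - (t + t ≫ ε ≫ l)) ≫ ε := by
      simp only [Preadditive.add_comp, Preadditive.comp_sub, Preadditive.sub_comp,
        Preadditive.comp_add, Category.id_comp, Category.comp_id, Category.assoc]
      abel
    rw [h3, h2]
    simp

variable [HasZeroObject C] [HasShift C ℤ]
  [∀ n : ℤ, (shiftFunctor C n).Additive] [Pretriangulated C] [IsTriangulated C]

/-- If `j` and `j₀` are two fillings of the same morphism of triangles that is the identity on an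
indecomposable object `M`, and `i : Z ⟶ M` is nonzero, then `j` and `j₀` differ by an automorphism.
The difference is `i ≫ ε` for some `ε : M ⟶ L'`, and `ε ≫ l` is nilpotent because it is killed
by `i`. -/
lemma exists_iso_of_fillings [IsIdempotentComplete C] {Z M L X L' : C} [Finite (M ⟶ M)]
    (hM : Indecomposable M)
    {i : Z ⟶ M} (hi : i ≠ 0) {a : M ⟶ L} {p : L ⟶ Z⟦(1 : ℤ)⟧} (H : Tri i a p)
    {l : L' ⟶ M} {c : M ⟶ X} {s : X ⟶ L'⟦(1 : ℤ)⟧} (_ : Tri l c s) {j j₀ : Z ⟶ L'}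
    (hj : j ≫ l = i) (hj₀ : j₀ ≫ l = i)
    (h : p ≫ j⟦(1 : ℤ)⟧' = p ≫ j₀⟦(1 : ℤ)⟧') : ∃ e : L' ≅ L', j = j₀ ≫ e.hom := by
  obtain ⟨ε, h1⟩ := H.yoneda₁ (j - j₀)
    (by rw [Functor.map_sub, Preadditive.comp_sub, h, sub_self])
  have h2 : i ≫ ε ≫ l = 0 := by
    rw [← Category.assoc, ← h1, Preadditive.sub_comp, hj, hj₀, sub_self]
  have h3 : ¬ IsIso (ε ≫ l) := by
    intro h
    apply hi
    rw [← cancel_mono (ε ≫ l), h2, zero_comp]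
  have h4 : IsIso (𝟙 M + ε ≫ l) := by
    have := ((hM.isIso_iff (ε ≫ l)).1 h3).isUnit_one_add
    exact (isUnit_iff_isIso _).1 this
  have h5 := isIso_one_add_comp l ε h4
  refine ⟨asIso (𝟙 L' + l ≫ ε), ?_⟩
  rw [asIso_hom, Preadditive.comp_add, Category.comp_id, reassoc_of% hj₀, ← h1]
  abel

variable [IsIdempotentComplete C] [∀ X Y : C, Finite (X ⟶ Y)]
variable (k : Type w) [Field k] [Finite k] [Linear k C] [∀ n : ℤ, (shiftFunctor C n).Linear k]

/-- Given triangles `Z ⟶ M ⟶ L` and `L' ⟶ M ⟶ X`, the extensions `L ⟶ X` of `M ⟶ X` with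
fibre `Y` and the lifts `Z ⟶ L'` of `Z ⟶ M` with cone `Y` are equally many modulo `q - 1`: by the
octahedral axiom they correspond to each other up to torsors under vector spaces. -/
theorem natCast_card_extensions_eq_card_lifts {Z M L X L' : C} (Y : C) (hM : Indecomposable M)
    {i : Z ⟶ M} (hi : i ≠ 0) {a : M ⟶ L} {p : L ⟶ Z⟦(1 : ℤ)⟧} (H : Tri i a p)
    {l : L' ⟶ M} {c : M ⟶ X} {s : X ⟶ L'⟦(1 : ℤ)⟧} (H' : Tri l c s) :
    (Nat.card {b : L ⟶ X // a ≫ b = c ∧ IsFib b Y} : ZMod (Nat.card k - 1)) =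
      Nat.card {j : Z ⟶ L' // j ≫ l = i ∧ IsCone j Y} := by
  -- The octahedron on `a ≫ b = c` turns an extension `b` into a lift `j` such that the cone of `j`
  -- is the fibre of `b`.
  have C1 : ∀ b : L ⟶ X, a ≫ b = c → ∃ j : Z ⟶ L', j ≫ l = i ∧ b ≫ s = p ≫ j⟦(1 : ℤ)⟧' ∧
      (IsFib b Y ↔ IsCone j Y) := by
    intro b hb
    obtain ⟨Y₀, f, h, H₀⟩ := exists_tri_fib b
    let o := Triangulated.someOctahedron' hb H H₀ H'
    refine ⟨o.m₁, o.comm₁, o.comm₂.symm, ?_⟩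
    rw [H₀.isFib_iff]
    exact (Tri.isCone_iff o.mem Y).symm
  -- Conversely a lift `j` is part of a morphism of triangles, which yields `b`.
  have C3 : ∀ j : Z ⟶ L', j ≫ l = i → ∃ b : L ⟶ X, a ≫ b = c ∧ b ≫ s = p ≫ j⟦(1 : ℤ)⟧' := by
    intro j hj
    obtain ⟨b, h1, h2⟩ := complete_distinguished_triangle_morphism₂ _ _ H.rotate H'.rotate (𝟙 M)
      (j⟦(1 : ℤ)⟧') (by
        change (-i⟦(1 : ℤ)⟧') ≫ (𝟙 M)⟦(1 : ℤ)⟧' = j⟦(1 : ℤ)⟧' ≫ (-l⟦(1 : ℤ)⟧')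
        rw [← hj]; simp)
    exact ⟨b, h1.trans (Category.id_comp c), h2.symm⟩
  -- Relate `b` and `j` if `(𝟙 M, b, j⟦1⟧)` is a morphism between the rotated triangles. In both
  -- directions the fibres are cosets of a subspace.
  refine natCast_card_eq_of_relation
    (fun b j => a ≫ b = c ∧ j ≫ l = i ∧ b ≫ s = p ≫ j⟦(1 : ℤ)⟧') _ _ ?_ ?_ ?_
  · rintro b ⟨hb, -⟩
    obtain ⟨j₀, h1, h2, -⟩ := C1 b hb
    let K : Submodule k (Z ⟶ L') :=
      { carrier := {θ | θ ≫ l = 0 ∧ p ≫ θ⟦(1 : ℤ)⟧' = 0}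
        zero_mem' := by simp
        add_mem' := by
          rintro x y ⟨hx, hx'⟩ ⟨hy, hy'⟩
          exact ⟨by rw [Preadditive.add_comp, hx, hy, add_zero],
            by rw [Functor.map_add, Preadditive.comp_add, hx', hy', add_zero]⟩
        smul_mem' := by
          rintro t x ⟨hx, hx'⟩
          exact ⟨by rw [Linear.smul_comp, hx, smul_zero],
            by rw [Functor.map_smul, Linear.comp_smul, hx', smul_zero]⟩ }
    refine natCast_card_coset k K _ j₀ fun j => ?_
    change _ ↔ (j - j₀) ≫ l = 0 ∧ p ≫ (j - j₀)⟦(1 : ℤ)⟧' = 0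
    rw [Preadditive.sub_comp, h1, Functor.map_sub, Preadditive.comp_sub, ← h2, sub_eq_zero,
      sub_eq_zero]
    exact ⟨fun h => ⟨h.2.1, h.2.2.symm⟩, fun h => ⟨hb, h.1, h.2.symm⟩⟩
  · rintro j ⟨hj, -⟩
    obtain ⟨b₀, h1, h2⟩ := C3 j hj
    let K : Submodule k (L ⟶ X) :=
      { carrier := {θ | a ≫ θ = 0 ∧ θ ≫ s = 0}
        zero_mem' := by simp
        add_mem' := by
          rintro x y ⟨hx, hx'⟩ ⟨hy, hy'⟩
          exact ⟨by rw [Preadditive.comp_add, hx, hy, add_zero],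
            by rw [Preadditive.add_comp, hx', hy', add_zero]⟩
        smul_mem' := by
          rintro t x ⟨hx, hx'⟩
          exact ⟨by rw [Linear.comp_smul, hx, smul_zero],
            by rw [Linear.smul_comp, hx', smul_zero]⟩ }
    refine natCast_card_coset k K _ b₀ fun b => ?_
    change _ ↔ a ≫ (b - b₀) = 0 ∧ (b - b₀) ≫ s = 0
    rw [Preadditive.comp_sub, h1, Preadditive.sub_comp, ← h2, sub_eq_zero, sub_eq_zero]
    exact ⟨fun h => ⟨h.1, h.2.2⟩, fun h => ⟨h.1, hj, h.2⟩⟩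
  · rintro b j ⟨hb, hj, h⟩
    -- The lift given by the octahedron differs from `j` by an automorphism of `L'` only.
    obtain ⟨j₀, h1, h2, h3⟩ := C1 b hb
    obtain ⟨e, rfl⟩ := exists_iso_of_fillings hM hi H H' hj h1 (by rw [← h, h2])
    rw [isCone_comp_iso, h3]
    simp [hb, hj]

/-! ### The invariant `d(X)` -/

lemma endDim_congr {X Y : C} (hX : Indecomposable X) (hY : Indecomposable Y)
    (f : (X ⟶ X) ≃ₗ[k] (Y ⟶ Y))
    (hf : ∀ x, IsIso (f x) ↔ IsIso x) : endDim k X = endDim k Y := by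
  have h1 := finrank_radEnd_add_endDim k hX
  have h2 := finrank_radEnd_add_endDim k hY
  have h3 := f.finrank_eq
  have h4 : (radEnd k hX).map (f : (X ⟶ X) →ₗ[k] (Y ⟶ Y)) = radEnd k hY := by
    ext y
    constructor
    · rintro ⟨x, hx, rfl⟩
      exact fun h => hx ((hf x).1 h)
    · intro hy
      refine ⟨f.symm y, fun h => hy ?_, by simp⟩
      have := (hf (f.symm y)).2 h
      simpa using this
  have h5 := LinearEquiv.finrank_map_eq f (radEnd k hX)
  rw [h4] at h5
  omega

lemma endDim_iso {X Y : C} (hX : Indecomposable X) (e : X ≅ Y) : endDim k X = endDim k Y := by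
  refine endDim_congr k hX (hX.of_iso e) (Linear.homCongr k e e) fun x => ?_
  rw [Linear.homCongr_apply]
  constructor
  · intro h
    have : x = e.hom ≫ ((e.inv ≫ x) ≫ e.hom) ≫ e.inv := by simp
    rw [this]
    infer_instance
  · intro h
    infer_instance

lemma _root_.CategoryTheory.Indecomposable.shift {X : C} (hX : Indecomposable X) (n : ℤ) :
    Indecomposable (X⟦n⟧) := by
  refine ⟨not_isZero_shift hX.1 n, fun A B e => ?_⟩
  have := preservesBinaryBiproducts_of_preservesBiproducts (shiftFunctor C (-n))
  have e' : X ≅ A⟦-n⟧ ⊞ B⟦-n⟧ :=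
    (shiftShiftNeg X n).symm ≪≫ (shiftFunctor C (-n)).mapIso e ≪≫
      (shiftFunctor C (-n)).mapBiprod A B
  rcases hX.2 _ _ e' with h | h
  · left
    by_contra hA
    exact not_isZero_shift hA _ h
  · right
    by_contra hA
    exact not_isZero_shift hA _ h

lemma endDim_shift {X : C} (hX : Indecomposable X) : endDim k (X⟦(1 : ℤ)⟧) = endDim k X := by
  refine (endDim_congr k hX (hX.shift 1)
    (LinearEquiv.ofBijective ((shiftFunctor C (1 : ℤ)).mapLinearMap k)
      ⟨fun _ _ h => (shiftFunctor C (1 : ℤ)).map_injective h,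
        fun y => (shiftFunctor C (1 : ℤ)).map_surjective y⟩) fun x => ?_).symm
  change IsIso (x⟦(1 : ℤ)⟧') ↔ IsIso x
  exact ⟨fun h => isIso_of_reflects_iso x (shiftFunctor C (1 : ℤ)), fun h => inferInstance⟩

/-! ### Morphisms that vanish on one side -/

/-- Orbits of morphisms `b : L ⟶ X` with fibre `Y` that vanish on `M`, where `L` is a cone of
`i : Z ⟶ M`: they factor through `L ⟶ Z⟦1⟧`, and correspond to the morphisms `δ : Z ⟶ N`, with
`N⟦1⟧ ≅ X`, such that `Y` is a cone of `(i, δ) : Z ⟶ M ⊞ N`. -/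
theorem sum_post_vanishing {Z M L X Y N : C} {i : Z ⟶ M} {a : M ⟶ L} {p : L ⟶ Z⟦(1 : ℤ)⟧}
    (H : Tri i a p) (hL : ¬ IsZero L) (hX : Indecomposable X) (hN : Indecomposable N)
    (hY : Indecomposable Y) (e : N⟦(1 : ℤ)⟧ ≅ X) :
    ∑ o : PostOrbit L X, (if IsFib o.out Y ∧ a ≫ o.out = 0 then 1 else 0 : ZMod (Nat.card k - 1)) =
      ∑ o : PostOrbit Z N, if IsCone (biprod.lift i o.out) Y then 1 else 0 := by
  let φ : (Z ⟶ N) →ₗ[k] (L ⟶ X) :=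
    (Linear.rightComp k L e.hom) ∘ₗ (Linear.leftComp k (N⟦(1 : ℤ)⟧) p) ∘ₗ
      ((shiftFunctor C (1 : ℤ)).mapLinearMap k)
  have hφ : ∀ δ, φ δ = (p ≫ δ⟦(1 : ℤ)⟧') ≫ e.hom := fun δ => rfl
  -- By homotopy pushout, a cone of `(i, δ)` is a fibre of the composite `L ⟶ Z⟦1⟧ ⟶ N⟦1⟧`.
  have key : ∀ δ : Z ⟶ N, IsCone (biprod.lift i δ) Y ↔ IsFib (φ δ) Y := by
    intro δ
    obtain ⟨P, g, h, HP⟩ := exists_tri_cone (biprod.lift i δ)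
    obtain ⟨b, hb⟩ := HP.pushout (tri_inr_fst M N) biprod.snd (by simp) (a := a) (p := p)
      (by simpa using H)
    rw [HP.isCone_iff, hφ, isFib_congr (Iso.refl L) e.symm (Iso.refl Y)
      (g' := p ≫ δ⟦(1 : ℤ)⟧') (by simp)]
    rw [biprod.lift_snd] at hb
    exact (hb.rotate.isFib_iff Y).symm
  have hf0 : ¬ IsFib (0 : L ⟶ X) Y := not_isFib_zero hY hL hX.1
  obtain ⟨n, h1, h2⟩ := sum_post k hX (L := L) (fun b => if IsFib b Y ∧ a ≫ b = 0 then 1 else 0)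
    (fun b ξ => by
      simp only [isFib_comp_iso, ← Category.assoc, Preadditive.IsIso.comp_right_eq_zero])
    (by simp [hf0])
  obtain ⟨n', h1', h2'⟩ := sum_post k hN (L := Z)
    (fun δ => if IsCone (biprod.lift i δ) Y then 1 else 0)
    (fun b ξ => by
      have : biprod.lift i (b ≫ ξ.hom) = biprod.lift i b ≫ (biprod.mapIso (Iso.refl M) ξ).hom := by
        apply biprod.hom_ext <;> simp
      simp only [this, isCone_comp_iso])
    (by
      have : ¬ IsCone (biprod.lift i (0 : Z ⟶ N)) Y := by
        rw [key, map_zero]; exact hf0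
      simp [this])
  have h3 := sum_comp_linearMap φ (fun b => if IsFib b Y ∧ a ≫ b = 0 then 1 else 0) (by
    intro b hb
    have hb' : a ≫ b = 0 := by
      by_contra h0
      simp [h0] at hb
    obtain ⟨g, hg⟩ := H.yoneda₃ b hb'
    obtain ⟨δ, hδ⟩ := (shiftFunctor C (1 : ℤ)).map_surjective (g ≫ e.inv)
    refine ⟨δ, ?_⟩
    rw [hφ, hδ, hg]
    simp)
  have h4 : ∀ δ, a ≫ φ δ = 0 := fun δ => by
    rw [hφ, Category.assoc, reassoc_of% H.zero₂₃, zero_comp]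
  simp only [h4, and_true, ← key] at h3
  rw [h1, h1'] at h3
  have h5 : unitCard k N = unitCard k X := by
    unfold unitCard
    rw [← endDim_shift k hN, endDim_iso k (hN.shift 1) e]
  have h6 : n' = Nat.card (LinearMap.ker φ) * n := by
    apply unitCard_mul_cancel k hX
    rw [← h5, h3, h5]
    ring
  have h7 : (n' : ZMod (Nat.card k - 1)) = n := by
    rw [h6, Nat.cast_mul, natCast_card_eq_one, one_mul]
  push_cast at h2 h2'
  rw [← h2, ← h2', h7]

/-- Orbits of morphisms `j : X ⟶ L` with cone `Z` that vanish after composition with `L ⟶ M`,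
where `L` is a fibre of `c : M ⟶ Y`: they correspond to the morphisms `δ : N ⟶ Y`, with
`X⟦1⟧ ≅ N`, such that `Z` is a fibre of `(c, δ) : M ⊞ N ⟶ Y`. -/
theorem sum_pre_vanishing {Y M L X Z N : C} {l : L ⟶ M} {c : M ⟶ Y} {s : Y ⟶ L⟦(1 : ℤ)⟧}
    (H : Tri l c s) (hL : ¬ IsZero L) (hX : Indecomposable X) (hN : Indecomposable N)
    (hZ : Indecomposable Z) (e : X⟦(1 : ℤ)⟧ ≅ N) :
    ∑ o : PreOrbit X L, (if IsCone o.out Z ∧ o.out ≫ l = 0 then 1 else 0 : ZMod (Nat.card k - 1)) =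
      ∑ o : PreOrbit N Y, if IsFib (biprod.desc c o.out) Z then 1 else 0 := by
  let T : (X ⟶ L) ≃ₗ[k] (X⟦(1 : ℤ)⟧ ⟶ L⟦(1 : ℤ)⟧) :=
    LinearEquiv.ofBijective ((shiftFunctor C (1 : ℤ)).mapLinearMap k)
      ⟨fun _ _ h => (shiftFunctor C (1 : ℤ)).map_injective h,
        fun y => (shiftFunctor C (1 : ℤ)).map_surjective y⟩
  let φ : (N ⟶ Y) →ₗ[k] (X ⟶ L) :=
    (T.symm : _ →ₗ[k] _) ∘ₗ (Linear.leftComp k (L⟦(1 : ℤ)⟧) e.hom) ∘ₗ (Linear.rightComp k N s)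
  have hφ : ∀ δ, (φ δ)⟦(1 : ℤ)⟧' = e.hom ≫ δ ≫ s := fun δ => T.apply_symm_apply _
  have key : ∀ δ : N ⟶ Y, IsFib (biprod.desc c δ) Z ↔ IsCone (φ δ) Z := by
    intro δ
    obtain ⟨P, f, h, HP⟩ := exists_tri_fib (biprod.desc c δ)
    obtain ⟨b, hb⟩ := HP.pullback (tri_inl_snd M N) biprod.inr (by simp) (l := l) (s := s)
      (by simpa using H)
    rw [HP.isFib_iff, ← isCone_shift_iff, hφ, isCone_congr (f' := δ ≫ s) e (Iso.refl _)
      (Iso.refl _) (by simp)]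
    rw [biprod.inr_desc] at hb
    rw [hb.rotate.isCone_iff]
    exact ⟨fun h => h.map fun e => (shiftFunctor C (1 : ℤ)).mapIso e, nonempty_iso_of_shift⟩
  have hf0 : ¬ IsCone (0 : X ⟶ L) Z := not_isCone_zero hZ hX.1 hL
  obtain ⟨n, h1, h2⟩ := sum_pre k hX (M := L) (fun b => if IsCone b Z ∧ b ≫ l = 0 then 1 else 0)
    (fun b ξ => by
      simp only [isCone_iso_comp, Category.assoc, Preadditive.IsIso.comp_left_eq_zero])
    (by simp [hf0])
  obtain ⟨n', h1', h2'⟩ := sum_pre k hN (M := Y)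
    (fun δ => if IsFib (biprod.desc c δ) Z then 1 else 0)
    (fun b ξ => by
      have : biprod.desc c (ξ.hom ≫ b) = (biprod.mapIso (Iso.refl M) ξ).hom ≫ biprod.desc c b := by
        apply biprod.hom_ext' <;> simp
      simp only [this, isFib_iso_comp])
    (by
      have : ¬ IsFib (biprod.desc c (0 : N ⟶ Y)) Z := by
        rw [key, map_zero]; exact hf0
      simp [this])
  have h3 := sum_comp_linearMap φ (fun b => if IsCone b Z ∧ b ≫ l = 0 then 1 else 0) (by
    intro b hb
    have hb' : b ≫ l = 0 := by
      by_contra h0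
      simp [h0] at hb
    obtain ⟨g, hg⟩ := H.coyoneda₁ (b⟦(1 : ℤ)⟧') (by
      rw [← Functor.map_comp, hb', Functor.map_zero])
    refine ⟨e.inv ≫ g, ?_⟩
    apply (shiftFunctor C (1 : ℤ)).map_injective
    rw [hφ, hg]
    simp)
  have h4 : ∀ δ, φ δ ≫ l = 0 := fun δ => by
    apply (shiftFunctor C (1 : ℤ)).map_injective
    rw [Functor.map_comp, hφ, Category.assoc, Category.assoc, H.zero₃₁]
    simp
  simp only [h4, and_true, ← key] at h3
  rw [h1, h1'] at h3
  have h5 : unitCard k N = unitCard k X := by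
    unfold unitCard
    rw [← endDim_shift k hX, endDim_iso k (hX.shift 1) e]
  have h6 : n' = Nat.card (LinearMap.ker φ) * n := by
    apply unitCard_mul_cancel k hX
    rw [← h5, h3, h5]
    ring
  have h7 : (n' : ZMod (Nat.card k - 1)) = n := by
    rw [h6, Nat.cast_mul, natCast_card_eq_one, one_mul]
  push_cast at h2 h2'
  rw [← h2, ← h2', h7]

end Comparison

/-! ### Triangles `Z ⟶ M ⊞ N ⟶ Y` -/

section Squares

open scoped Classical

variable {C : Type u} [Category.{v} C] [Preadditive C] [HasZeroObject C] [HasShift C ℤ]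
  [∀ n : ℤ, (shiftFunctor C n).Additive] [Pretriangulated C]

lemma Tri.yoneda₂ {Y L X W : C} {f : Y ⟶ L} {g : L ⟶ X} {h : X ⟶ Y⟦(1 : ℤ)⟧} (H : Tri f g h)
    (b : L ⟶ W) (hb : f ≫ b = 0) : ∃ t : X ⟶ W, b = g ≫ t :=
  Triangle.yoneda_exact₂ _ H b hb

lemma Tri.coyoneda₂ {Y L X W : C} {f : Y ⟶ L} {g : L ⟶ X} {h : X ⟶ Y⟦(1 : ℤ)⟧} (H : Tri f g h)
    (b : W ⟶ L) (hb : b ≫ g = 0) : ∃ t : W ⟶ Y, b = t ≫ f :=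
  Triangle.coyoneda_exact₂ _ H b hb

section

variable [IsTriangulated C]

/-- In a homotopy cartesian square, opposite sides have the same cone. -/
lemma isIso_fst_iff_of_isPair {Z M N Y : C} {f : Z ⟶ M ⊞ N} {g : M ⊞ N ⟶ Y} (H : IsPair f g) :
    IsIso (f ≫ biprod.fst) ↔ IsIso (biprod.inr ≫ g) := by
  obtain ⟨h, H⟩ := H
  obtain ⟨L, a, p, HL⟩ := exists_tri_cone (f ≫ biprod.fst)
  obtain ⟨b, hb⟩ := H.pushout (tri_inr_fst M N) biprod.snd (by simp) HL
  rw [← HL.isZero₃_iff, hb.isZero₃_iff]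

lemma isIso_snd_iff_of_isPair {Z M N Y : C} {f : Z ⟶ M ⊞ N} {g : M ⊞ N ⟶ Y} (H : IsPair f g) :
    IsIso (f ≫ biprod.snd) ↔ IsIso (biprod.inl ≫ g) := by
  obtain ⟨h, H⟩ := H
  obtain ⟨L, a, p, HL⟩ := exists_tri_cone (f ≫ biprod.snd)
  obtain ⟨b, hb⟩ := H.pushout (tri_inl_snd M N) biprod.fst (by simp) HL
  rw [← HL.isZero₃_iff, hb.isZero₃_iff]

end

lemma isCone_lift_of_isIso {Z M N Y : C} (i : Z ⟶ M) (δ : Z ⟶ N) [IsIso δ] :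
    IsCone (biprod.lift i δ) Y ↔ Nonempty (M ≅ Y) := by
  have H : Tri (biprod.lift i δ) (biprod.fst - biprod.snd ≫ inv δ ≫ i) 0 := by
    refine (tri_inr_fst M N).of_iso (asIso δ).symm
      ⟨biprod.lift (biprod.fst + biprod.snd ≫ inv δ ≫ i) biprod.snd,
        biprod.lift (biprod.fst - biprod.snd ≫ inv δ ≫ i) biprod.snd, ?_, ?_⟩ (Iso.refl M) ?_ ?_ ?_
    · apply biprod.hom_ext <;> simp
    · apply biprod.hom_ext <;> simp
    · apply biprod.hom_ext <;> simp
    · simp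
    · simp
  exact H.isCone_iff Y

lemma isFib_desc_of_isIso {Z M N Y : C} (c : M ⟶ Y) (δ : N ⟶ Y) [IsIso δ] :
    IsFib (biprod.desc c δ) Z ↔ Nonempty (M ≅ Z) := by
  have H : Tri (biprod.lift (𝟙 M) (- c ≫ inv δ)) (biprod.desc c δ) 0 := by
    refine (tri_inl_snd M N).of_iso (Iso.refl M)
      ⟨biprod.lift biprod.fst (biprod.snd - biprod.fst ≫ c ≫ inv δ),
        biprod.lift biprod.fst (biprod.snd + biprod.fst ≫ c ≫ inv δ), ?_, ?_⟩ (asIso δ) ?_ ?_ ?_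
    · apply biprod.hom_ext <;> simp
    · apply biprod.hom_ext <;> simp
    · apply biprod.hom_ext <;> simp
    · apply biprod.hom_ext' <;> simp
    · simp
  exact H.isFib_iff Z

variable [IsIdempotentComplete C] [∀ X Y : C, Finite (X ⟶ Y)]

lemma isIso_inl_of_fst_eq_zero {Z M N Y : C} {f : Z ⟶ M ⊞ N} {g : M ⊞ N ⟶ Y} (H : IsPair f g)
    (hM : ¬ IsZero M) (hY : Indecomposable Y) (h0 : f ≫ biprod.fst = 0) :
    IsIso (biprod.inl ≫ g) := by
  obtain ⟨h, H⟩ := H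
  obtain ⟨r, hr⟩ := H.yoneda₂ _ h0
  have : (biprod.inl ≫ g) ≫ r = 𝟙 M := by
    rw [Category.assoc, ← hr, biprod.inl_fst]
  have : IsIso ((biprod.inl ≫ g) ≫ r) := by rw [this]; infer_instance
  exact (Indecomposable.isIso_of_isIso_comp hM hY _ r).1

lemma isIso_inr_of_snd_eq_zero {Z M N Y : C} {f : Z ⟶ M ⊞ N} {g : M ⊞ N ⟶ Y} (H : IsPair f g)
    (hN : ¬ IsZero N) (hY : Indecomposable Y) (h0 : f ≫ biprod.snd = 0) :
    IsIso (biprod.inr ≫ g) := by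
  obtain ⟨h, H⟩ := H
  obtain ⟨r, hr⟩ := H.yoneda₂ _ h0
  have : (biprod.inr ≫ g) ≫ r = 𝟙 N := by
    rw [Category.assoc, ← hr, biprod.inr_snd]
  have : IsIso ((biprod.inr ≫ g) ≫ r) := by rw [this]; infer_instance
  exact (Indecomposable.isIso_of_isIso_comp hN hY _ r).1

lemma isIso_fst_of_inl_eq_zero {Z M N Y : C} {f : Z ⟶ M ⊞ N} {g : M ⊞ N ⟶ Y} (H : IsPair f g)
    (hM : ¬ IsZero M) (hZ : Indecomposable Z) (h0 : biprod.inl ≫ g = 0) :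
    IsIso (f ≫ biprod.fst) := by
  obtain ⟨h, H⟩ := H
  obtain ⟨r, hr⟩ := H.coyoneda₂ _ h0
  have : r ≫ (f ≫ biprod.fst) = 𝟙 M := by
    rw [← Category.assoc, ← hr, biprod.inl_fst]
  have : IsIso (r ≫ (f ≫ biprod.fst)) := by rw [this]; infer_instance
  exact (Indecomposable.isIso_of_isIso_comp hM hZ r _).2

lemma isIso_snd_of_inr_eq_zero {Z M N Y : C} {f : Z ⟶ M ⊞ N} {g : M ⊞ N ⟶ Y} (H : IsPair f g)
    (hN : ¬ IsZero N) (hZ : Indecomposable Z) (h0 : biprod.inr ≫ g = 0) :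
    IsIso (f ≫ biprod.snd) := by
  obtain ⟨h, H⟩ := H
  obtain ⟨r, hr⟩ := H.coyoneda₂ _ h0
  have : r ≫ (f ≫ biprod.snd) = 𝟙 N := by
    rw [← Category.assoc, ← hr, biprod.inr_snd]
  have : IsIso (r ≫ (f ≫ biprod.snd)) := by rw [this]; infer_instance
  exact (Indecomposable.isIso_of_isIso_comp hN hZ r _).2

variable (k : Type w) [Field k] [Finite k] [Linear k C]

/-- Iteration of `sum_pre` and `sum_post` for pairs of morphisms: the weight is invariant under the
diagonal action of `Aut Z` and under the action of `Aut N` on the second morphism. -/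
theorem sum_pre_post {Z M N : C} (hZ : Indecomposable Z) (hN : Indecomposable N)
    (w : (Z ⟶ M) → (Z ⟶ N) → ℕ)
    (hw : ∀ i δ (η : Z ≅ Z), w (η.hom ≫ i) (η.hom ≫ δ) = w i δ)
    (hw' : ∀ i δ (ξ : N ≅ N), w i (δ ≫ ξ.hom) = w i δ)
    (h0 : ∀ δ, w 0 δ = 0) (h0' : ∀ i, w i 0 = 0) :
    ∃ n : ℕ, ∑ i, ∑ δ, w i δ = unitCard k Z * (unitCard k N * n) ∧
      (n : ZMod (Nat.card k - 1)) =
        ∑ o : PreOrbit Z M, ∑ o' : PostOrbit Z N, (w o.out o'.out : ZMod (Nat.card k - 1)) := by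
  choose m hm hm' using fun i : Z ⟶ M => sum_post k hN (w i) (hw' i) (h0' i)
  obtain ⟨n, hn, hn'⟩ := sum_pre k hZ m (fun i η => by
      apply unitCard_mul_cancel k hN
      rw [← hm, ← hm]
      let φ : (Z ⟶ N) ≃ (Z ⟶ N) :=
        ⟨fun δ => η.hom ≫ δ, fun δ => η.inv ≫ δ, fun δ => by simp, fun δ => by simp⟩
      rw [← φ.sum_comp]
      exact Finset.sum_congr rfl fun δ _ => hw i δ η) (by
      apply unitCard_mul_cancel k hN
      rw [← hm]
      simp [h0])
  refine ⟨n, ?_, ?_⟩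
  · simp only [hm, ← Finset.mul_sum, hn]
    ring
  · rw [hn']
    exact Finset.sum_congr rfl fun o _ => hm' _

/-- Iteration of `sum_post` and `sum_pre` for pairs of morphisms with common target, dual to
`sum_pre_post`. -/
theorem sum_post_pre {M N Y : C} (hY : Indecomposable Y) (hN : Indecomposable N)
    (w : (M ⟶ Y) → (N ⟶ Y) → ℕ)
    (hw : ∀ i δ (η : Y ≅ Y), w (i ≫ η.hom) (δ ≫ η.hom) = w i δ)
    (hw' : ∀ i δ (ξ : N ≅ N), w i (ξ.hom ≫ δ) = w i δ)
    (h0 : ∀ δ, w 0 δ = 0) (h0' : ∀ i, w i 0 = 0) :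
    ∃ n : ℕ, ∑ i, ∑ δ, w i δ = unitCard k Y * (unitCard k N * n) ∧
      (n : ZMod (Nat.card k - 1)) =
        ∑ o : PostOrbit M Y, ∑ o' : PreOrbit N Y, (w o.out o'.out : ZMod (Nat.card k - 1)) := by
  choose m hm hm' using fun i : M ⟶ Y => sum_pre k hN (w i) (hw' i) (h0' i)
  obtain ⟨n, hn, hn'⟩ := sum_post k hY m (fun i η => by
      apply unitCard_mul_cancel k hN
      rw [← hm, ← hm]
      let φ : (N ⟶ Y) ≃ (N ⟶ Y) :=
        ⟨fun δ => δ ≫ η.hom, fun δ => δ ≫ η.inv, fun δ => by simp, fun δ => by simp⟩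
      rw [← φ.sum_comp]
      exact Finset.sum_congr rfl fun δ _ => hw i δ η) (by
      apply unitCard_mul_cancel k hN
      rw [← hm]
      simp [h0])
  refine ⟨n, ?_, ?_⟩
  · simp only [hm, ← Finset.mul_sum, hn]
    ring
  · rw [hn']
    exact Finset.sum_congr rfl fun o _ => hm' _

/-- The morphisms completing `f` to a triangle with third object `Y` form one orbit. -/
lemma exists_card_isPair_post {Z E Y : C} (hY : Indecomposable Y) (f : Z ⟶ E)
    (h : ∀ g : E ⟶ Y, IsPair f g → g ≠ 0) :
    ∃ n : ℕ, ∑ g : E ⟶ Y, (if IsPair f g then 1 else 0) = unitCard k Y * n ∧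
      (n : ZMod (Nat.card k - 1)) = if IsCone f Y then 1 else 0 := by
  by_cases hc : IsCone f Y
  · obtain ⟨g, hg⟩ := hc
    change IsPair f g at hg
    obtain ⟨e, he⟩ := card_postOrbit k hY g (h g hg)
    refine ⟨Nat.card k ^ e, ?_, ?_⟩
    · rw [← he, Finset.sum_boole, Nat.cast_id, Nat.card_eq_fintype_card, Fintype.card_subtype]
      congr 1
      ext g'
      simp [isPair_iff_exists_post hg g']
    · have hc : IsCone f Y := ⟨g, hg⟩
      rw [if_pos hc, Nat.cast_pow, natCast_eq_one_zmod_sub_one Nat.card_pos, one_pow]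
  · refine ⟨0, ?_, by simp [hc]⟩
    rw [mul_zero]
    refine Finset.sum_eq_zero fun g _ => if_neg fun hg => hc ⟨g, hg⟩

lemma exists_card_isPair_pre {Z E Y : C} (hZ : Indecomposable Z) (g : E ⟶ Y)
    (h : ∀ f : Z ⟶ E, IsPair f g → f ≠ 0) :
    ∃ n : ℕ, ∑ f : Z ⟶ E, (if IsPair f g then 1 else 0) = unitCard k Z * n ∧
      (n : ZMod (Nat.card k - 1)) = if IsFib g Z then 1 else 0 := by
  by_cases hc : IsFib g Z
  · obtain ⟨f, hf⟩ := hc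
    change IsPair f g at hf
    obtain ⟨e, he⟩ := card_preOrbit k hZ f (h f hf)
    refine ⟨Nat.card k ^ e, ?_, ?_⟩
    · rw [← he, Finset.sum_boole, Nat.cast_id, Nat.card_eq_fintype_card, Fintype.card_subtype]
      congr 1
      ext g'
      simp [isPair_iff_exists_pre hf g']
    · have hc : IsFib g Z := ⟨f, hf⟩
      rw [if_pos hc, Nat.cast_pow, natCast_eq_one_zmod_sub_one Nat.card_pos, one_pow]
  · refine ⟨0, ?_, by simp [hc]⟩
    rw [mul_zero]
    refine Finset.sum_eq_zero fun g _ => if_neg fun hg => hc ⟨g, hg⟩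

lemma sum_biprod_hom_from {M N Y : C} (F : (M ⊞ N ⟶ Y) → ℕ) :
    ∑ c, ∑ d, F (biprod.desc c d) = ∑ g, F g := by
  let φ : (M ⟶ Y) × (N ⟶ Y) ≃ (M ⊞ N ⟶ Y) :=
    ⟨fun x => biprod.desc x.1 x.2, fun g => (biprod.inl ≫ g, biprod.inr ≫ g), fun x => by simp,
      fun g => by apply biprod.hom_ext' <;> simp⟩
  rw [← φ.sum_comp, Fintype.sum_prod_type]
  rfl

lemma sum_biprod_hom_to {M N Z : C} (F : (Z ⟶ M ⊞ N) → ℕ) :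
    ∑ c, ∑ d, F (biprod.lift c d) = ∑ g, F g := by
  let φ : (Z ⟶ M) × (Z ⟶ N) ≃ (Z ⟶ M ⊞ N) :=
    ⟨fun x => biprod.lift x.1 x.2, fun g => (g ≫ biprod.fst, g ≫ biprod.snd), fun x => by simp,
      fun g => by apply biprod.hom_ext <;> simp⟩
  rw [← φ.sum_comp, Fintype.sum_prod_type]
  rfl

lemma ite_zero_eq_sum {R ι : Type*} [AddCommMonoid R] [Fintype ι] (p : Prop) [Decidable p]
    (f : ι → R) :
    (if p then ∑ i, f i else 0) = ∑ i, if p then f i else 0 := by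
  split_ifs <;> simp

variable [IsTriangulated C]

/-- Triangles `Z ⟶ M ⊞ N ⟶ Y` none of whose four components is invertible may be counted from
either end. Up to units, both sides are the number of such triangles divided by
`(q ^ d(Z) - 1) (q ^ d(N) - 1) (q ^ d(Y) - 1)`. -/
theorem sum_lift_eq_sum_desc {Z M N Y : C} (hZ : Indecomposable Z) (hM : ¬ IsZero M)
    (hN : Indecomposable N) (hY : Indecomposable Y) :
    ∑ o : PreOrbit Z M, ∑ o' : PostOrbit Z N,
      (if ¬ IsIso o.out ∧ ¬ IsIso o'.out ∧ IsCone (biprod.lift o.out o'.out) Y then 1 else 0 :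
        ZMod (Nat.card k - 1)) =
    ∑ o : PostOrbit M Y, ∑ o' : PreOrbit N Y,
      if ¬ IsIso o.out ∧ ¬ IsIso o'.out ∧ IsFib (biprod.desc o.out o'.out) Z then 1 else 0 := by
  -- `P` is the indicator function of the set of triangles with non-invertible components. It can be
  -- defined by the components of the first or of the second morphism, since opposite sides of a
  -- homotopy cartesian square are invertible at the same time.
  let P : (Z ⟶ M) → (Z ⟶ N) → (M ⟶ Y) → (N ⟶ Y) → ℕ := fun i δ c δ' =>
    if (¬ IsIso i ∧ ¬ IsIso δ) ∧ IsPair (biprod.lift i δ) (biprod.desc c δ') then 1 else 0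
  have hP : ∀ i δ c δ', P i δ c δ' = if (¬ IsIso c ∧ ¬ IsIso δ') ∧
      IsPair (biprod.lift i δ) (biprod.desc c δ') then 1 else 0 := by
    intro i δ c δ'
    by_cases h : IsPair (biprod.lift i δ) (biprod.desc c δ')
    · have h1 := isIso_fst_iff_of_isPair h
      have h2 := isIso_snd_iff_of_isPair h
      rw [biprod.lift_fst, biprod.inr_desc] at h1
      rw [biprod.lift_snd, biprod.inl_desc] at h2
      simp only [P, h1, h2, and_comm]
    · simp [P, h]
  -- A vanishing component would split the triangle and make another component invertible.
  have hP0 : ∀ i δ c δ', P i δ c δ' ≠ 0 → i ≠ 0 ∧ δ ≠ 0 ∧ c ≠ 0 ∧ δ' ≠ 0 := by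
    intro i δ c δ' h
    have h' := h
    rw [hP] at h'
    obtain ⟨⟨h3, h4⟩, h5⟩ : (¬ IsIso i ∧ ¬ IsIso δ) ∧
        IsPair (biprod.lift i δ) (biprod.desc c δ') := by
      by_contra hn
      exact h (if_neg hn)
    obtain ⟨⟨h1, h2⟩, -⟩ : (¬ IsIso c ∧ ¬ IsIso δ') ∧
        IsPair (biprod.lift i δ) (biprod.desc c δ') := by
      by_contra hn
      exact h' (if_neg hn)
    refine ⟨fun h0 => h1 ?_, fun h0 => h2 ?_, fun h0 => h3 ?_, fun h0 => h4 ?_⟩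
    · simpa using isIso_inl_of_fst_eq_zero h5 hM hY (by simpa using h0)
    · simpa using isIso_inr_of_snd_eq_zero h5 hN.1 hY (by simpa using h0)
    · simpa using isIso_fst_of_inl_eq_zero h5 hM hZ (by simpa using h0)
    · simpa using isIso_snd_of_inr_eq_zero h5 hN.1 hZ (by simpa using h0)
  have hPZ : ∀ i δ c δ' (η : Z ≅ Z), P (η.hom ≫ i) (η.hom ≫ δ) c δ' = P i δ c δ' := by
    intro i δ c δ' η
    have : IsPair (biprod.lift (η.hom ≫ i) (η.hom ≫ δ)) (biprod.desc c δ') ↔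
        IsPair (biprod.lift i δ) (biprod.desc c δ') := by
      constructor
      · intro h
        exact isPair_congr h η (Iso.refl _) (Iso.refl _)
          (by apply biprod.hom_ext <;> simp) (by simp)
      · intro h
        exact isPair_congr h η.symm (Iso.refl _) (Iso.refl _)
          (by apply biprod.hom_ext <;> simp) (by simp)
    simp only [P, this, isIso_comp_left_iff]
  have hPY : ∀ i δ c δ' (η : Y ≅ Y), P i δ (c ≫ η.hom) (δ' ≫ η.hom) = P i δ c δ' := by
    intro i δ c δ' η
    have : IsPair (biprod.lift i δ) (biprod.desc (c ≫ η.hom) (δ' ≫ η.hom)) ↔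
        IsPair (biprod.lift i δ) (biprod.desc c δ') := by
      constructor
      · intro h
        exact isPair_congr h (Iso.refl _) (Iso.refl _) η.symm (by simp)
          (by apply biprod.hom_ext' <;> simp)
      · intro h
        exact isPair_congr h (Iso.refl _) (Iso.refl _) η (by simp)
          (by apply biprod.hom_ext' <;> simp)
    simp only [P, this]
  have hPN : ∀ i δ c δ' (η : N ≅ N), P i (δ ≫ η.hom) c δ' = P i δ c (η.hom ≫ δ') := by
    intro i δ c δ' η
    have : IsPair (biprod.lift i (δ ≫ η.hom)) (biprod.desc c δ') ↔
        IsPair (biprod.lift i δ) (biprod.desc c (η.hom ≫ δ')) := by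
      constructor
      · intro h
        exact isPair_congr h (Iso.refl _) (biprod.mapIso (Iso.refl _) η.symm) (Iso.refl _)
          (by apply biprod.hom_ext <;> simp) (by apply biprod.hom_ext' <;> simp)
      · intro h
        exact isPair_congr h (Iso.refl _) (biprod.mapIso (Iso.refl _) η) (Iso.refl _)
          (by apply biprod.hom_ext <;> simp) (by apply biprod.hom_ext' <;> simp)
    simp only [P, this, isIso_comp_right_iff]
  -- For a fixed first morphism, the second morphisms form one orbit of `Aut Y`, and vice versa.
  have h1 : ∀ i δ, ∃ n : ℕ, ∑ c, ∑ δ', P i δ c δ' = unitCard k Y * n ∧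
      (n : ZMod (Nat.card k - 1)) =
        if ¬ IsIso i ∧ ¬ IsIso δ ∧ IsCone (biprod.lift i δ) Y then 1 else 0 := by
    intro i δ
    by_cases h : ¬ IsIso i ∧ ¬ IsIso δ
    · obtain ⟨n, hn, hn'⟩ := exists_card_isPair_post k hY (biprod.lift i δ) (by
        rintro g hg rfl
        have : IsPair (biprod.lift i δ) (biprod.desc (0 : M ⟶ Y) (0 : N ⟶ Y)) := by
          convert hg
          apply biprod.hom_ext' <;> simp
        exact (hP0 i δ 0 0 (by simp [P, h, this])).2.2.1 rfl)
      refine ⟨n, ?_, by simpa [h] using hn'⟩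
      rw [← hn, ← (sum_biprod_hom_from (fun g : M ⊞ N ⟶ Y =>
        if IsPair (biprod.lift i δ) g then 1 else 0))]
      simp [P, h]
    · refine ⟨0, ?_, ?_⟩
      · simp [P, h]
      · rw [if_neg, Nat.cast_zero]
        tauto
  have h2 : ∀ c δ', ∃ n : ℕ, ∑ i, ∑ δ, P i δ c δ' = unitCard k Z * n ∧
      (n : ZMod (Nat.card k - 1)) =
        if ¬ IsIso c ∧ ¬ IsIso δ' ∧ IsFib (biprod.desc c δ') Z then 1 else 0 := by
    intro c δ'
    simp only [hP]
    by_cases h : ¬ IsIso c ∧ ¬ IsIso δ'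
    · obtain ⟨n, hn, hn'⟩ := exists_card_isPair_pre k hZ (biprod.desc c δ') (by
        rintro f hf rfl
        have : IsPair (biprod.lift (0 : Z ⟶ M) (0 : Z ⟶ N)) (biprod.desc c δ') := by
          convert hf
          apply biprod.hom_ext <;> simp
        exact (hP0 0 0 c δ' (by simp [hP, h, this])).1 rfl)
      refine ⟨n, ?_, by simpa [h] using hn'⟩
      rw [← hn, ← (sum_biprod_hom_to (fun f : Z ⟶ M ⊞ N =>
        if IsPair f (biprod.desc c δ') then 1 else 0))]
      simp [h]
    · refine ⟨0, ?_, ?_⟩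
      · simp [h]
      · rw [if_neg, Nat.cast_zero]
        tauto
  choose m hm hm' using h1
  choose m' hn hn' using h2
  have hm0 : ∀ i δ, i = 0 ∨ δ = 0 → m i δ = 0 := by
    intro i δ h
    apply unitCard_mul_cancel k hY
    rw [← hm, mul_zero]
    refine Finset.sum_eq_zero fun c _ => Finset.sum_eq_zero fun δ' _ => ?_
    by_contra h0
    have := hP0 _ _ _ _ h0
    tauto
  have hn0 : ∀ c δ', c = 0 ∨ δ' = 0 → m' c δ' = 0 := by
    intro i δ h
    apply unitCard_mul_cancel k hZ
    rw [← hn, mul_zero]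
    refine Finset.sum_eq_zero fun c _ => Finset.sum_eq_zero fun δ' _ => ?_
    by_contra h0
    have := hP0 _ _ _ _ h0
    tauto
  obtain ⟨n, h3, h4⟩ := sum_pre_post k hZ hN m
    (fun i δ η => unitCard_mul_cancel k hY (by rw [← hm, ← hm]; simp only [hPZ]))
    (fun i δ ξ => unitCard_mul_cancel k hY (by
      rw [← hm, ← hm]
      simp only [hPN]
      let φ : (N ⟶ Y) ≃ (N ⟶ Y) :=
        ⟨fun δ => ξ.hom ≫ δ, fun δ => ξ.inv ≫ δ, fun δ => by simp, fun δ => by simp⟩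
      exact Finset.sum_congr rfl fun c _ => φ.sum_comp (P i δ c)))
    (fun δ => hm0 _ _ (Or.inl rfl)) (fun i => hm0 _ _ (Or.inr rfl))
  obtain ⟨n', h3', h4'⟩ := sum_post_pre k hY hN m'
    (fun i δ η => unitCard_mul_cancel k hZ (by rw [← hn, ← hn]; simp only [hPY]))
    (fun c δ' ξ => unitCard_mul_cancel k hZ (by
      rw [← hn, ← hn]
      simp only [← hPN]
      let φ : (Z ⟶ N) ≃ (Z ⟶ N) :=
        ⟨fun δ => δ ≫ ξ.hom, fun δ => δ ≫ ξ.inv, fun δ => by simp, fun δ => by simp⟩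
      exact Finset.sum_congr rfl fun i _ => φ.sum_comp (fun δ => P i δ c δ')))
    (fun δ => hn0 _ _ (Or.inl rfl)) (fun i => hn0 _ _ (Or.inr rfl))
  -- Both sides are the number of all such triangles.
  have h5 : unitCard k Y * ∑ i, ∑ δ, m i δ = unitCard k Z * ∑ c, ∑ δ', m' c δ' := by
    simp only [Finset.mul_sum, ← hm, ← hn]
    calc ∑ i, ∑ δ, ∑ c, ∑ δ', P i δ c δ'
        = ∑ i, ∑ c, ∑ δ, ∑ δ', P i δ c δ' :=
          Finset.sum_congr rfl fun i _ => Finset.sum_comm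
      _ = ∑ c, ∑ i, ∑ δ, ∑ δ', P i δ c δ' := Finset.sum_comm
      _ = ∑ c, ∑ i, ∑ δ', ∑ δ, P i δ c δ' :=
          Finset.sum_congr rfl fun c _ => Finset.sum_congr rfl fun i _ => Finset.sum_comm
      _ = ∑ c, ∑ δ', ∑ i, ∑ δ, P i δ c δ' :=
          Finset.sum_congr rfl fun c _ => Finset.sum_comm
  have h6 : n = n' := by
    rw [h3, h3'] at h5
    apply unitCard_mul_cancel k hN
    apply unitCard_mul_cancel k hY
    apply unitCard_mul_cancel k hZ
    linarith
  simp only [hm'] at h4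
  simp only [hn'] at h4'
  rw [← h4, ← h4', h6]

/-- The extensions `(i, δ)` with `i` nonzero and not invertible, split according to whether `δ` is
invertible. -/
theorem sum_lift_split {Z M N Y : C} (hM : ¬ IsZero M)
    (hY : Indecomposable Y) (hZY : ¬ Nonempty (Z ≅ Y)) :
    ∑ o : PreOrbit Z M, (if o.out ≠ 0 ∧ ¬ IsIso o.out then ∑ o' : PostOrbit Z N,
      (if IsCone (biprod.lift o.out o'.out) Y then 1 else 0) else 0 : ZMod (Nat.card k - 1)) =
    ∑ o : PreOrbit Z M, ∑ o' : PostOrbit Z N,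
      (if ¬ IsIso o.out ∧ ¬ IsIso o'.out ∧ IsCone (biprod.lift o.out o'.out) Y then 1 else 0) +
    if Nonempty (M ≅ Y) ∧ Nonempty (Z ≅ N) then
      ∑ o : PreOrbit Z M, (if o.out ≠ 0 then 1 else 0) else 0 := by
  have h1 : (if Nonempty (M ≅ Y) ∧ Nonempty (Z ≅ N) then
      ∑ o : PreOrbit Z M, (if o.out ≠ 0 then 1 else 0) else 0 : ZMod (Nat.card k - 1)) =
      ∑ o : PreOrbit Z M, ∑ o' : PostOrbit Z N, if IsIso o'.out then
        (if Nonempty (M ≅ Y) ∧ o.out ≠ 0 then 1 else 0) else 0 := by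
    simp only [sum_post_isIso]
    by_cases h : Nonempty (M ≅ Y) <;> by_cases h' : Nonempty (Z ≅ N) <;> simp [h, h']
  rw [h1, ← Finset.sum_add_distrib]
  refine Finset.sum_congr rfl fun o _ => ?_
  rw [← Finset.sum_add_distrib]
  rw [ite_zero_eq_sum]
  refine Finset.sum_congr rfl fun o' _ => ?_
  generalize o.out = i
  generalize o'.out = δ
  by_cases hδ : IsIso δ
  · have h2 : IsCone (biprod.lift i δ) Y ↔ Nonempty (M ≅ Y) := isCone_lift_of_isIso i δ
    have h3 : Nonempty (M ≅ Y) → ¬ IsIso i := fun ⟨e⟩ hi => hZY ⟨asIso i ≪≫ e⟩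
    simp only [hδ, h2, not_true, false_and, and_false, if_false, zero_add, ← ite_and]
    refine if_congr ?_ rfl rfl
    tauto
  · have h2 : ¬ IsIso i → IsCone (biprod.lift i δ) Y → i ≠ 0 := by
      rintro - ⟨g, hg⟩ h0
      have h3 := isIso_inl_of_fst_eq_zero hg hM hY (by simpa using h0)
      rw [← isIso_snd_iff_of_isPair hg, biprod.lift_snd] at h3
      exact hδ h3
    rw [if_neg hδ, add_zero, ← ite_and]
    refine if_congr ?_ rfl rfl
    tauto

/-- The coextensions `(c, δ')` with `c` nonzero and not invertible, split according to whether `δ'`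
is invertible; dual to `sum_lift_split`. -/
theorem sum_desc_split {Z M N Y : C} (hZ : Indecomposable Z) (hM : ¬ IsZero M)
    (hZY : ¬ Nonempty (Z ≅ Y)) :
    ∑ o : PostOrbit M Y, (if o.out ≠ 0 ∧ ¬ IsIso o.out then ∑ o' : PreOrbit N Y,
      (if IsFib (biprod.desc o.out o'.out) Z then 1 else 0) else 0 : ZMod (Nat.card k - 1)) =
    ∑ o : PostOrbit M Y, ∑ o' : PreOrbit N Y,
      (if ¬ IsIso o.out ∧ ¬ IsIso o'.out ∧ IsFib (biprod.desc o.out o'.out) Z then 1 else 0) +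
    if Nonempty (M ≅ Z) ∧ Nonempty (N ≅ Y) then
      ∑ o : PostOrbit M Y, (if o.out ≠ 0 then 1 else 0) else 0 := by
  have h1 : (if Nonempty (M ≅ Z) ∧ Nonempty (N ≅ Y) then
      ∑ o : PostOrbit M Y, (if o.out ≠ 0 then 1 else 0) else 0 : ZMod (Nat.card k - 1)) =
      ∑ o : PostOrbit M Y, ∑ o' : PreOrbit N Y, if IsIso o'.out then
        (if Nonempty (M ≅ Z) ∧ o.out ≠ 0 then 1 else 0) else 0 := by
    simp only [sum_pre_isIso]
    by_cases h : Nonempty (M ≅ Z) <;> by_cases h' : Nonempty (N ≅ Y) <;> simp [h, h']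
  rw [h1, ← Finset.sum_add_distrib]
  refine Finset.sum_congr rfl fun o _ => ?_
  rw [← Finset.sum_add_distrib]
  rw [ite_zero_eq_sum]
  refine Finset.sum_congr rfl fun o' _ => ?_
  generalize o.out = i
  generalize o'.out = δ
  by_cases hδ : IsIso δ
  · have h2 : IsFib (biprod.desc i δ) Z ↔ Nonempty (M ≅ Z) := isFib_desc_of_isIso i δ
    have h3 : Nonempty (M ≅ Z) → ¬ IsIso i := fun ⟨e⟩ hi => hZY ⟨e.symm ≪≫ asIso i⟩
    simp only [hδ, h2, not_true, false_and, and_false, if_false, zero_add, ← ite_and]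
    refine if_congr ?_ rfl rfl
    tauto
  · have h2 : ¬ IsIso i → IsFib (biprod.desc i δ) Z → i ≠ 0 := by
      rintro - ⟨g, hg⟩ h0
      have h3 := isIso_fst_of_inl_eq_zero hg hM hZ (by simpa using h0)
      rw [isIso_fst_iff_of_isPair hg, biprod.inr_desc] at h3
      exact hδ h3
    rw [if_neg hδ, add_zero, ← ite_and]
    refine if_congr ?_ rfl rfl
    tauto

/-- Comparison of the two kinds of correction terms in the associator. -/
theorem sum_lift_sub_sum_desc {Z M N Y : C} (hZ : Indecomposable Z) (hM : Indecomposable M)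
    (hN : Indecomposable N) (hY : Indecomposable Y) (hZY : ¬ Nonempty (Z ≅ Y)) :
    ∑ o : PreOrbit Z M, (if o.out ≠ 0 ∧ ¬ IsIso o.out then ∑ o' : PostOrbit Z N,
      (if IsCone (biprod.lift o.out o'.out) Y then 1 else 0) else 0 : ZMod (Nat.card k - 1)) -
    ∑ o : PostOrbit M Y, (if o.out ≠ 0 ∧ ¬ IsIso o.out then ∑ o' : PreOrbit N Y,
      (if IsFib (biprod.desc o.out o'.out) Z then 1 else 0) else 0 : ZMod (Nat.card k - 1)) =
    (if Nonempty (M ≅ Y) ∧ Nonempty (Z ≅ N) then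
      ∑ o : PreOrbit Z M, (if o.out ≠ 0 then 1 else 0) else 0) -
    if Nonempty (M ≅ Z) ∧ Nonempty (N ≅ Y) then
      ∑ o : PostOrbit M Y, (if o.out ≠ 0 then 1 else 0) else 0 := by
  rw [sum_lift_split k hM.1 hY hZY, sum_desc_split k hZ hM.1 hZY,
    sum_lift_eq_sum_desc k hZ hM.1 hN hY]
  ring

end Squares

/-! ### The associator of the Hall product -/

section Associator

open scoped Classical

variable {C : Type u} [Category.{v} C] [Preadditive C] [HasZeroObject C] [HasShift C ℤ]
  [∀ n : ℤ, (shiftFunctor C n).Additive] [Pretriangulated C]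

/-- A chosen cone of `i`. -/
def coneObj {Z M : C} (i : Z ⟶ M) : C := (exists_tri_cone i).choose

/-- A chosen fibre of `c`. -/
def fibObj {M X : C} (c : M ⟶ X) : C := (exists_tri_fib c).choose

lemma coneObj_spec {Z M : C} (i : Z ⟶ M) :
    ∃ (a : M ⟶ coneObj i) (p : coneObj i ⟶ Z⟦(1 : ℤ)⟧), Tri i a p :=
  (exists_tri_cone i).choose_spec

lemma fibObj_spec {M X : C} (c : M ⟶ X) :
    ∃ (l : fibObj c ⟶ M) (s : X ⟶ (fibObj c)⟦(1 : ℤ)⟧), Tri l c s :=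
  (exists_tri_fib c).choose_spec

lemma isCone_iff_coneObj {Z M L : C} (i : Z ⟶ M) : IsCone i L ↔ Nonempty (coneObj i ≅ L) := by
  obtain ⟨a, p, H⟩ := coneObj_spec i
  exact H.isCone_iff L

lemma isFib_iff_fibObj {M X L : C} (c : M ⟶ X) : IsFib c L ↔ Nonempty (fibObj c ≅ L) := by
  obtain ⟨a, p, H⟩ := fibObj_spec c
  exact H.isFib_iff L

lemma isZero_coneObj_iff {Z M : C} (i : Z ⟶ M) : IsZero (coneObj i) ↔ IsIso i := by
  obtain ⟨a, p, H⟩ := coneObj_spec i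
  exact H.isZero₃_iff

lemma isZero_fibObj_iff {M X : C} (c : M ⟶ X) : IsZero (fibObj c) ↔ IsIso c := by
  obtain ⟨a, p, H⟩ := fibObj_spec c
  exact H.isZero₁_iff

lemma not_indecomposable_of_iso_biprod {L A B : C} (hA : ¬ IsZero A) (hB : ¬ IsZero B)
    (e : L ≅ A ⊞ B) : ¬ Indecomposable L := fun h => by
  rcases h.2 _ _ e with h | h
  · exact hA h
  · exact hB h

lemma ne_zero_of_indecomposable_coneObj {Z M : C} (hZ : ¬ IsZero Z) (hM : ¬ IsZero M) (i : Z ⟶ M)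
    (h : Indecomposable (coneObj i)) : i ≠ 0 := by
  rintro rfl
  exact not_isCone_zero h hZ hM ((isCone_iff_coneObj _).2 ⟨Iso.refl _⟩)

lemma ne_zero_of_indecomposable_fibObj {Z M : C} (hZ : ¬ IsZero Z) (hM : ¬ IsZero M) (i : Z ⟶ M)
    (h : Indecomposable (fibObj i)) : i ≠ 0 := by
  rintro rfl
  exact not_isFib_zero h hZ hM ((isFib_iff_fibObj _).2 ⟨Iso.refl _⟩)

lemma indClass_out (ℓ : IndClass C) : indClass ℓ.out.1 ℓ.out.2 = ℓ := Quotient.out_eq ℓ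

lemma nonempty_iso_indClass_out (L : C) (hL : Indecomposable L) :
    Nonempty ((indClass L hL).out.1 ≅ L) :=
  Quotient.mk_out (s := (isIsomorphicSetoid C).comap
    (Subtype.val : {X : C // Indecomposable X} → C)) ⟨L, hL⟩

/-- Summation over the indecomposable objects isomorphic to a given object. -/
lemma finsum_ite_iso {R : Type*} [AddCommMonoid R] (L : C) (w : C → R)
    (hw : ∀ A B : C, Nonempty (A ≅ B) → w A = w B) :
    (Function.support fun ℓ : IndClass C =>
      if Nonempty (L ≅ ℓ.out.1) then w ℓ.out.1 else 0).Finite ∧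
    (∑ᶠ ℓ : IndClass C, if Nonempty (L ≅ ℓ.out.1) then w ℓ.out.1 else 0) =
      if Indecomposable L then w L else 0 := by
  by_cases hL : Indecomposable L
  · have h : ∀ ℓ : IndClass C, ℓ ≠ indClass L hL → ¬ Nonempty (L ≅ ℓ.out.1) := by
      rintro ℓ hℓ ⟨e⟩
      apply hℓ
      rw [← indClass_out ℓ]
      exact Quotient.sound ⟨e.symm⟩
    constructor
    · refine (Set.finite_singleton (indClass L hL)).subset fun ℓ hℓ => ?_
      by_contra hne
      exact hℓ (if_neg (h ℓ hne))
    · rw [finsum_eq_single _ (indClass L hL) fun ℓ hℓ => if_neg (h ℓ hℓ), if_pos hL,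
        if_pos ((nonempty_iso_indClass_out L hL).map Iso.symm)]
      exact hw _ _ (nonempty_iso_indClass_out L hL)
  · have h : ∀ ℓ : IndClass C, ¬ Nonempty (L ≅ ℓ.out.1) := fun ℓ ⟨e⟩ => hL (ℓ.out.2.of_iso e.symm)
    simp [h, hL]

variable [∀ X Y : C, Finite (X ⟶ Y)]

lemma finsum_hallNumber_mul_left {R : Type*} [CommRing R] (X Y Z M : C) :
    (∑ᶠ ℓ : IndClass C, (hallNumber X Y ℓ.out.1 : R) * hallNumber ℓ.out.1 Z M) =
      ∑ o : PreOrbit Z M,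
        if Indecomposable (coneObj o.out) then (hallNumber X Y (coneObj o.out) : R) else 0 := by
  have h1 : ∀ ℓ : IndClass C, (hallNumber X Y ℓ.out.1 : R) * hallNumber ℓ.out.1 Z M =
      ∑ o : PreOrbit Z M, if Nonempty (coneObj o.out ≅ ℓ.out.1) then
        (hallNumber X Y ℓ.out.1 : R) else 0 := fun ℓ => by
    rw [hallNumber_eq_pre ℓ.out.1 Z M, Nat.cast_sum, Finset.mul_sum]
    refine Finset.sum_congr rfl fun o _ => ?_
    rw [isCone_iff_coneObj]
    split_ifs <;> simp
  have h2 := fun o : PreOrbit Z M => finsum_ite_iso (coneObj o.out)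
    (fun L => (hallNumber X Y L : R)) fun A B ⟨e⟩ => by
      rw [hallNumber_congr (Iso.refl X) (Iso.refl Y) e]
  simp only [h1]
  rw [finsum_sum_comm _ _ fun o _ => (h2 o).1]
  exact Finset.sum_congr rfl fun o _ => (h2 o).2

lemma finsum_hallNumber_mul_right {R : Type*} [CommRing R] (X Y Z M : C) :
    (∑ᶠ ℓ : IndClass C, (hallNumber Y Z ℓ.out.1 : R) * hallNumber X ℓ.out.1 M) =
      ∑ o : PostOrbit M X,
        if Indecomposable (fibObj o.out) then (hallNumber Y Z (fibObj o.out) : R) else 0 := by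
  have h1 : ∀ ℓ : IndClass C, (hallNumber Y Z ℓ.out.1 : R) * hallNumber X ℓ.out.1 M =
      ∑ o : PostOrbit M X, if Nonempty (fibObj o.out ≅ ℓ.out.1) then
        (hallNumber Y Z ℓ.out.1 : R) else 0 := fun ℓ => by
    rw [hallNumber_eq_post X ℓ.out.1 M, Nat.cast_sum, Finset.mul_sum]
    refine Finset.sum_congr rfl fun o _ => ?_
    rw [isFib_iff_fibObj]
    split_ifs <;> simp
  have h2 := fun o : PostOrbit M X => finsum_ite_iso (fibObj o.out)
    (fun L => (hallNumber Y Z L : R)) fun A B ⟨e⟩ => by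
      rw [hallNumber_congr (Iso.refl Y) (Iso.refl Z) e]
  simp only [h1]
  rw [finsum_sum_comm _ _ fun o _ => (h2 o).1]
  exact Finset.sum_congr rfl fun o _ => (h2 o).2

variable (k : Type w) [Field k] [Finite k] [Linear k C]

/-- The number of orbits of morphisms `i : Z ⟶ M` with a non-invertible nonzero `i`, together with
orbits of `δ : Z ⟶ X⟦1⟧`, such that `Y` is a cone of `(i, δ)`. -/
def liftCount (X Y Z M : C) : ZMod (Nat.card k - 1) :=
  ∑ o : PreOrbit Z M, if o.out ≠ 0 ∧ ¬ IsIso o.out then ∑ o' : PostOrbit Z (X⟦(1 : ℤ)⟧),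
    (if IsCone (biprod.lift o.out o'.out) Y then 1 else 0) else 0

/-- The number of orbits of non-invertible nonzero `c : M ⟶ X`, together with
orbits of `δ : Z⟦1⟧ ⟶ X`, such that `Y` is a fibre of `(c, δ)`. -/
def descCount (X Y Z M : C) : ZMod (Nat.card k - 1) :=
  ∑ o : PostOrbit M X, if o.out ≠ 0 ∧ ¬ IsIso o.out then ∑ o' : PreOrbit (Z⟦(1 : ℤ)⟧) X,
    (if IsFib (biprod.desc o.out o'.out) Y then 1 else 0) else 0

/-- The number of orbits of nonzero morphisms `Z ⟶ M` with cone `X ⊞ Y`. -/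
def splitConeCount (X Y Z M : C) : ZMod (Nat.card k - 1) :=
  ∑ o : PreOrbit Z M, if o.out ≠ 0 ∧ Nonempty (coneObj o.out ≅ X ⊞ Y) then 1 else 0

/-- The number of orbits of nonzero morphisms `M ⟶ X` with fibre `Y ⊞ Z`. -/
def splitFibCount (X Y Z M : C) : ZMod (Nat.card k - 1) :=
  ∑ o : PostOrbit M X, if o.out ≠ 0 ∧ Nonempty (fibObj o.out ≅ Y ⊞ Z) then 1 else 0

lemma splitConeCount_symm (X Y Z M : C) :
    splitConeCount k X Y Z M = splitConeCount k Y X Z M := by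
  refine Finset.sum_congr rfl fun o _ => if_congr (and_congr Iff.rfl ?_) rfl rfl
  exact ⟨fun ⟨e⟩ => ⟨e ≪≫ biprod.braiding X Y⟩, fun ⟨e⟩ => ⟨e ≪≫ biprod.braiding Y X⟩⟩

lemma splitFibCount_symm (X Y Z M : C) :
    splitFibCount k X Y Z M = splitFibCount k X Z Y M := by
  refine Finset.sum_congr rfl fun o _ => if_congr (and_congr Iff.rfl ?_) rfl rfl
  exact ⟨fun ⟨e⟩ => ⟨e ≪≫ biprod.braiding _ _⟩, fun ⟨e⟩ => ⟨e ≪≫ biprod.braiding _ _⟩⟩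

variable [IsTriangulated C] [IsIdempotentComplete C] [∀ n : ℤ, (shiftFunctor C n).Linear k]

/-- The number of `b` extending `c` along the cone of `i`, with fibre `Y`, summed over `c`. The
terms with `c ≠ 0` are rewritten as numbers of lifts of `i` along the fibre of `c`, those with
`c = 0` as numbers of extensions `(i, δ)`. -/
lemma hallNumber_coneObj {X Y Z M : C} (hX : Indecomposable X) (hY : Indecomposable Y)
    (hM : Indecomposable M) (e : Nonempty (X⟦(1 : ℤ)⟧⟦(1 : ℤ)⟧ ≅ X)) {i : Z ⟶ M} (hi : i ≠ 0)
    (hi' : ¬ IsIso i) :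
    (hallNumber X Y (coneObj i) : ZMod (Nat.card k - 1)) =
      ∑ c : PostOrbit M X, (if c.out ≠ 0 then
        (Nat.card {j : Z ⟶ fibObj c.out // j ≫ (fibObj_spec c.out).choose = i ∧ IsCone j Y} :
          ZMod (Nat.card k - 1)) else 0) +
      ∑ o' : PostOrbit Z (X⟦(1 : ℤ)⟧),
        (if IsCone (biprod.lift i o'.out) Y then 1 else 0) := by
  obtain ⟨a, p, H⟩ := coneObj_spec i
  rw [hallNumber_eq_post, Nat.cast_sum]
  simp only [Nat.cast_ite, Nat.cast_one, Nat.cast_zero]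
  rw [sum_post_fiber k hX a (fun b => IsFib b Y) (fun b ξ => isFib_comp_iso b ξ),
    sum_post_vanishing k H (by rwa [isZero_coneObj_iff]) hX (hX.shift 1) hY e.some]
  congr 1
  refine Finset.sum_congr rfl fun c _ => if_congr Iff.rfl ?_ rfl
  exact natCast_card_extensions_eq_card_lifts k Y hM hi H
    (fibObj_spec c.out).choose_spec.choose_spec

/-- The number of `j` lifting `i` along the fibre of `c`, with cone `Y`, summed over `i`. The
terms with `i ≠ 0` are the same as in `hallNumber_coneObj`, with the roles of `i` and `c`
exchanged. -/
lemma hallNumber_fibObj {X Y Z M : C} (hZ : Indecomposable Z) (hY : Indecomposable Y)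
    {c : M ⟶ X} (hc' : ¬ IsIso c) :
    (hallNumber Y Z (fibObj c) : ZMod (Nat.card k - 1)) =
      ∑ i : PreOrbit Z M, (if i.out ≠ 0 then
        (Nat.card {j : Z ⟶ fibObj c // j ≫ (fibObj_spec c).choose = i.out ∧ IsCone j Y} :
          ZMod (Nat.card k - 1)) else 0) +
      ∑ o' : PreOrbit (Z⟦(1 : ℤ)⟧) X,
        (if IsFib (biprod.desc c o'.out) Y then 1 else 0) := by
  rw [hallNumber_eq_pre, Nat.cast_sum]
  simp only [Nat.cast_ite, Nat.cast_one, Nat.cast_zero]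
  rw [sum_pre_fiber k hZ (fibObj_spec c).choose (fun b => IsCone b Y)
    (fun b ξ => isCone_iso_comp b ξ),
    sum_pre_vanishing k (fibObj_spec c).choose_spec.choose_spec
      (by rwa [isZero_fibObj_iff]) hZ (hZ.shift 1) hY (Iso.refl _)]

/-- The associator of the product counted by the Hall numbers, summed over indecomposable
intermediate objects. -/
theorem hall_associator {X Y Z M : C} (hX : Indecomposable X) (hY : Indecomposable Y)
    (hZ : Indecomposable Z) (hM : Indecomposable M) (e : Nonempty (X⟦(1 : ℤ)⟧⟦(1 : ℤ)⟧ ≅ X))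
    (hXY : ¬ Nonempty (X ≅ Y)) (hYZ : ¬ Nonempty (Y ≅ Z)) :
    ((∑ᶠ ℓ : IndClass C, (hallNumber X Y ℓ.out.1 : ZMod (Nat.card k - 1)) *
      hallNumber ℓ.out.1 Z M) -
    ∑ᶠ ℓ : IndClass C, (hallNumber Y Z ℓ.out.1 : ZMod (Nat.card k - 1)) *
      hallNumber X ℓ.out.1 M) =
    (liftCount k X Y Z M - descCount k X Y Z M) -
      (splitConeCount k X Y Z M - splitFibCount k X Y Z M) := by
  -- `γ i c` is the contribution of a pair of nonzero morphisms `i`, `c` to both products.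
  let γ : ∀ (i : Z ⟶ M) (c : M ⟶ X), ZMod (Nat.card k - 1) := fun i c =>
    (Nat.card {j : Z ⟶ fibObj c // j ≫ (fibObj_spec c).choose = i ∧ IsCone j Y} :
          ZMod (Nat.card k - 1))
  have hγ : ∀ i c, i ≠ 0 → c ≠ 0 → IsIso i ∨ IsIso c → γ i c = 0 := by
    intro i c hi hc h
    rcases h with h | h
    · obtain ⟨a, p, H⟩ := coneObj_spec i
      have h1 := natCast_card_extensions_eq_card_lifts k Y hM hi H
        (fibObj_spec c).choose_spec.choose_spec
      change _ = γ i c at h1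
      rw [← h1]
      have : IsEmpty {b : coneObj i ⟶ X // a ≫ b = c ∧ IsFib b Y} := by
        refine ⟨fun b => hc ?_⟩
        rw [← b.2.1, ((isZero_coneObj_iff i).2 h).eq_of_src b.1 0, comp_zero]
      simp
    · have : IsEmpty {j : Z ⟶ fibObj c // j ≫ (fibObj_spec c).choose = i ∧ IsCone j Y} := by
        refine ⟨fun b => hi ?_⟩
        rw [← b.2.1, ((isZero_fibObj_iff c).2 h).eq_of_tgt b.1 0, zero_comp]
      simp [γ]
  have h1 : (∑ᶠ ℓ : IndClass C, (hallNumber X Y ℓ.out.1 : ZMod (Nat.card k - 1)) *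
      hallNumber ℓ.out.1 Z M) = ∑ o : PreOrbit Z M, ∑ c : PostOrbit M X,
        (if o.out ≠ 0 ∧ c.out ≠ 0 then γ o.out c.out else 0) + liftCount k X Y Z M -
        splitConeCount k X Y Z M := by
    rw [finsum_hallNumber_mul_left, liftCount, splitConeCount, ← Finset.sum_add_distrib,
      ← Finset.sum_sub_distrib]
    refine Finset.sum_congr rfl fun o _ => ?_
    generalize o.out = i
    -- The cone of `i = 0` is not indecomposable, and that of an isomorphism is zero. Otherwise
    -- `hallNumber_coneObj` applies; it does not require an indecomposable cone, and for other cones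
    -- the Hall number is `1` or `0` according to whether the cone is `X ⊞ Y`.
    by_cases hi : i = 0
    · have hind : ¬ Indecomposable (coneObj i) := fun h =>
        ne_zero_of_indecomposable_coneObj hZ.1 hM.1 i h hi
      rw [if_neg hind]
      simp [hi]
    have hsum : ∑ c : PostOrbit M X, (if i ≠ 0 ∧ c.out ≠ 0 then γ i c.out else 0) =
        ∑ c : PostOrbit M X, if c.out ≠ 0 then γ i c.out else 0 :=
      Finset.sum_congr rfl fun c _ => if_congr (and_iff_right hi) rfl rfl
    by_cases hi' : IsIso i
    · have h0 : IsZero (coneObj i) := (isZero_coneObj_iff i).2 hi'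
      have hind : ¬ Indecomposable (coneObj i) := fun h => h.1 h0
      have hsplit : ¬ Nonempty (coneObj i ≅ X ⊞ Y) := fun ⟨e⟩ =>
        hX.1 (((biprod_isZero_iff X Y).1 (h0.of_iso e.symm)).1)
      rw [hsum, Finset.sum_eq_zero fun c _ => ?_]
      · simp [hind, hsplit, hi']
      · split_ifs with hc
        · exact hγ _ _ hi hc (Or.inl hi')
        · rfl
    · rw [hsum, if_pos (show i ≠ 0 ∧ ¬ IsIso i from ⟨hi, hi'⟩),
        ← hallNumber_coneObj k hX hY hM e hi hi']
      by_cases hind : Indecomposable (coneObj i)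
      · have hsplit : ¬ Nonempty (coneObj i ≅ X ⊞ Y) := fun ⟨e⟩ =>
          not_indecomposable_of_iso_biprod hX.1 hY.1 e hind
        simp [hind, hsplit]
      · rw [natCast_hallNumber_of_not_indecomposable k hX hY hXY
          (by rwa [isZero_coneObj_iff]) hind]
        simp [hind, hi]
  have h2 : (∑ᶠ ℓ : IndClass C, (hallNumber Y Z ℓ.out.1 : ZMod (Nat.card k - 1)) *
      hallNumber X ℓ.out.1 M) = ∑ c : PostOrbit M X, ∑ o : PreOrbit Z M,
        (if o.out ≠ 0 ∧ c.out ≠ 0 then γ o.out c.out else 0) + descCount k X Y Z M -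
        splitFibCount k X Y Z M := by
    rw [finsum_hallNumber_mul_right, descCount, splitFibCount, ← Finset.sum_add_distrib,
      ← Finset.sum_sub_distrib]
    refine Finset.sum_congr rfl fun o _ => ?_
    generalize o.out = c
    by_cases hc : c = 0
    · have hind : ¬ Indecomposable (fibObj c) := fun h =>
        ne_zero_of_indecomposable_fibObj hM.1 hX.1 c h hc
      rw [if_neg hind]
      simp [hc]
    have hsum : ∑ i : PreOrbit Z M, (if i.out ≠ 0 ∧ c ≠ 0 then γ i.out c else 0) =
        ∑ i : PreOrbit Z M, if i.out ≠ 0 then γ i.out c else 0 :=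
      Finset.sum_congr rfl fun i _ => if_congr (and_iff_left hc) rfl rfl
    by_cases hc' : IsIso c
    · have h0 : IsZero (fibObj c) := (isZero_fibObj_iff c).2 hc'
      have hind : ¬ Indecomposable (fibObj c) := fun h => h.1 h0
      have hsplit : ¬ Nonempty (fibObj c ≅ Y ⊞ Z) := fun ⟨e⟩ =>
        hY.1 (((biprod_isZero_iff Y Z).1 (h0.of_iso e.symm)).1)
      rw [hsum, Finset.sum_eq_zero fun i _ => ?_]
      · simp [hind, hsplit, hc']
      · split_ifs with hi
        · exact hγ _ _ hi hc (Or.inr hc')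
        · rfl
    · rw [hsum, if_pos (show c ≠ 0 ∧ ¬ IsIso c from ⟨hc, hc'⟩),
        ← hallNumber_fibObj k hZ hY hc']
      by_cases hind : Indecomposable (fibObj c)
      · have hsplit : ¬ Nonempty (fibObj c ≅ Y ⊞ Z) := fun ⟨e⟩ =>
          not_indecomposable_of_iso_biprod hY.1 hZ.1 e hind
        simp [hind, hsplit]
      · rw [natCast_hallNumber_of_not_indecomposable k hY hZ hYZ
          (by rwa [isZero_fibObj_iff]) hind]
        simp [hind, hc]
  rw [h1, h2, Finset.sum_comm]
  ring

/-! ### The alternating sum of associators -/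

/-- The coefficient of `u_M` in the associator of `u_X`, `u_Y`, `u_Z`. -/
def assocCoeff (X Y Z M : C) : ZMod (Nat.card k - 1) :=
  (∑ᶠ ℓ : IndClass C, (hallNumber X Y ℓ.out.1 : ZMod (Nat.card k - 1)) * hallNumber ℓ.out.1 Z M) -
    ∑ᶠ ℓ : IndClass C, (hallNumber Y Z ℓ.out.1 : ZMod (Nat.card k - 1)) * hallNumber X ℓ.out.1 M

/-- The number of orbits of `Aut X` on nonzero morphisms `X ⟶ M` plus the number of orbits on
nonzero morphisms `M ⟶ X`, modulo `q - 1`. -/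
def orbitCount (X M : C) : ZMod (Nat.card k - 1) :=
  ∑ o : PreOrbit X M, (if o.out ≠ 0 then 1 else 0) +
    ∑ o : PostOrbit M X, (if o.out ≠ 0 then 1 else 0)

lemma nonempty_iso_shift_symm {X Y : C} (hX : Nonempty (X⟦(1 : ℤ)⟧⟦(1 : ℤ)⟧ ≅ X))
    (h : Nonempty (Y ≅ X⟦(1 : ℤ)⟧)) : Nonempty (X ≅ Y⟦(1 : ℤ)⟧) := by
  obtain ⟨e⟩ := hX
  obtain ⟨e'⟩ := h
  exact ⟨e.symm ≪≫ ((shiftFunctor C (1 : ℤ)).mapIso e').symm⟩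

/-- The difference of correction terms, up to relabelling. -/
lemma liftCount_sub_descCount {X Y Z M : C} (hX : Indecomposable X) (hY : Indecomposable Y)
    (hZ : Indecomposable Z) (hM : Indecomposable M)
    (hper : ∀ X : C, Nonempty (X⟦(1 : ℤ)⟧⟦(1 : ℤ)⟧ ≅ X)) (hYZ : ¬ Nonempty (Y ≅ Z)) :
    liftCount k X Y Z M - descCount k Y Z X M =
      (if Nonempty (M ≅ Y) ∧ Nonempty (X ≅ Z⟦(1 : ℤ)⟧) then
        ∑ o : PreOrbit Z M, (if o.out ≠ 0 then 1 else 0) else 0) -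
      if Nonempty (M ≅ Z) ∧ Nonempty (X ≅ Y⟦(1 : ℤ)⟧) then
        ∑ o : PostOrbit M Y, (if o.out ≠ 0 then 1 else 0) else 0 := by
  have h := sum_lift_sub_sum_desc k hZ hM (hX.shift 1) hY fun ⟨e⟩ => hYZ ⟨e.symm⟩
  refine h.trans ?_
  congr 1
  · refine if_congr (and_congr Iff.rfl ?_) rfl rfl
    exact ⟨nonempty_iso_shift_symm (hper X), nonempty_iso_shift_symm (hper Z)⟩
  · refine if_congr (and_congr Iff.rfl ?_) rfl rfl
    exact ⟨fun ⟨e⟩ => nonempty_iso_shift_symm (hper X) ⟨e.symm⟩,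
      fun h => (nonempty_iso_shift_symm (hper Y) h).map Iso.symm⟩

/-- The contribution of the pair `X`, `Y` to the alternating sum of associators. -/
def pairTerm (X Y Z M : C) : ZMod (Nat.card k - 1) :=
  if Nonempty (M ≅ Z) ∧ Nonempty (X ≅ Y⟦(1 : ℤ)⟧) then orbitCount k X M - orbitCount k Y M else 0

/-- The alternating sum of the associators of three pairwise non-isomorphic indecomposable objects
vanishes up to terms that occur when two of them differ by a shift. -/
theorem sum_assocCoeff {X Y Z M : C} (hX : Indecomposable X) (hY : Indecomposable Y)
    (hZ : Indecomposable Z) (hM : Indecomposable M)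
    (hper : ∀ X : C, Nonempty (X⟦(1 : ℤ)⟧⟦(1 : ℤ)⟧ ≅ X)) (hXY : ¬ Nonempty (X ≅ Y))
    (hYZ : ¬ Nonempty (Y ≅ Z)) (hXZ : ¬ Nonempty (X ≅ Z)) :
    (assocCoeff k X Y Z M - assocCoeff k Y X Z M) +
      (assocCoeff k Y Z X M - assocCoeff k Z Y X M) +
      (assocCoeff k Z X Y M - assocCoeff k X Z Y M) =
    pairTerm k X Y Z M + pairTerm k Y Z X M + pairTerm k Z X Y M := by
  have hYX : ¬ Nonempty (Y ≅ X) := fun ⟨e⟩ => hXY ⟨e.symm⟩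
  have hZY : ¬ Nonempty (Z ≅ Y) := fun ⟨e⟩ => hYZ ⟨e.symm⟩
  have hZX : ¬ Nonempty (Z ≅ X) := fun ⟨e⟩ => hXZ ⟨e.symm⟩
  have a1 := hall_associator k hX hY hZ hM (hper X) hXY hYZ
  have a2 := hall_associator k hY hX hZ hM (hper Y) hYX hXZ
  have a3 := hall_associator k hY hZ hX hM (hper Y) hYZ hZX
  have a4 := hall_associator k hZ hY hX hM (hper Z) hZY hYX
  have a5 := hall_associator k hZ hX hY hM (hper Z) hZX hXY
  have a6 := hall_associator k hX hZ hY hM (hper X) hXZ hZY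
  have b1 := liftCount_sub_descCount k hX hY hZ hM hper hYZ
  have b2 := liftCount_sub_descCount k hY hX hZ hM hper hXZ
  have b3 := liftCount_sub_descCount k hY hZ hX hM hper hZX
  have b4 := liftCount_sub_descCount k hZ hY hX hM hper hYX
  have b5 := liftCount_sub_descCount k hZ hX hY hM hper hXY
  have b6 := liftCount_sub_descCount k hX hZ hY hM hper hZY
  have c1 := splitConeCount_symm k X Y Z M
  have c2 := splitConeCount_symm k Y Z X M
  have c3 := splitConeCount_symm k Z X Y M
  have d1 := splitFibCount_symm k X Y Z M
  have d2 := splitFibCount_symm k Y Z X M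
  have d3 := splitFibCount_symm k Z X Y M
  have e1 : Nonempty (Y ≅ X⟦(1 : ℤ)⟧) ↔ Nonempty (X ≅ Y⟦(1 : ℤ)⟧) :=
    ⟨nonempty_iso_shift_symm (hper X), nonempty_iso_shift_symm (hper Y)⟩
  have e2 : Nonempty (Z ≅ Y⟦(1 : ℤ)⟧) ↔ Nonempty (Y ≅ Z⟦(1 : ℤ)⟧) :=
    ⟨nonempty_iso_shift_symm (hper Y), nonempty_iso_shift_symm (hper Z)⟩
  have e3 : Nonempty (X ≅ Z⟦(1 : ℤ)⟧) ↔ Nonempty (Z ≅ X⟦(1 : ℤ)⟧) :=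
    ⟨nonempty_iso_shift_symm (hper Z), nonempty_iso_shift_symm (hper X)⟩
  have key : ∀ A B D : C, pairTerm k A B D M =
      (if Nonempty (M ≅ D) ∧ Nonempty (A ≅ B⟦(1 : ℤ)⟧) then
        ∑ o : PreOrbit A M, (if o.out ≠ 0 then 1 else 0) else 0) +
      (if Nonempty (M ≅ D) ∧ Nonempty (A ≅ B⟦(1 : ℤ)⟧) then
        ∑ o : PostOrbit M A, (if o.out ≠ 0 then 1 else 0) else 0) -
      (if Nonempty (M ≅ D) ∧ Nonempty (A ≅ B⟦(1 : ℤ)⟧) then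
        ∑ o : PreOrbit B M, (if o.out ≠ 0 then 1 else 0) else 0) -
      (if Nonempty (M ≅ D) ∧ Nonempty (A ≅ B⟦(1 : ℤ)⟧) then
        ∑ o : PostOrbit M B, (if o.out ≠ 0 then 1 else 0) else 0) := by
    intro A B D
    unfold pairTerm orbitCount
    split_ifs <;> ring
  rw [key, key, key]
  simp only [e1, e2, e3] at b1 b2 b3 b4 b5 b6 ⊢
  unfold assocCoeff
  -- The split terms cancel by symmetry. The remaining ones pair off as `liftCount k A B D M` in one
  -- associator with `descCount k B D A M` in another, and leave the terms of `pairTerm`.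
  linear_combination a1 - a2 + a3 - a4 + a5 - a6 + b1 - b2 + b3 - b4 + b5 - b6
    - c1 - c2 - c3 + d1 + d2 + d3

end Associator

/-! ### The Euler form -/

section EulerForm

variable {C : Type u} [Category.{v} C] [Preadditive C] [HasZeroObject C] [HasShift C ℤ]
  [∀ n : ℤ, (shiftFunctor C n).Additive] [Pretriangulated C]

lemma TwoPeriodic.nonempty_iso (hper : TwoPeriodic C) (X : C) :
    Nonempty (X⟦(1 : ℤ)⟧⟦(1 : ℤ)⟧ ≅ X) :=
  hper.map fun e => e.app X

variable (k : Type w) [Field k] [Linear k C]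

/-- The rank of `Hom(W, f)`. -/
def postRank (W : C) {X Y : C} (f : X ⟶ Y) : ℕ :=
  Module.finrank k (LinearMap.range (Linear.rightComp k W f))

/-- The rank of `Hom(f, W)`. -/
def preRank (W : C) {X Y : C} (f : X ⟶ Y) : ℕ :=
  Module.finrank k (LinearMap.range (Linear.leftComp k W f))

lemma finrank_hom_congr {X X' Y Y' : C} (e : X ≅ X') (e' : Y ≅ Y') :
    Module.finrank k (X ⟶ Y) = Module.finrank k (X' ⟶ Y') :=
  (Linear.homCongr k e e').finrank_eq

lemma postRank_congr (W : C) {X Y X' Y' : C} {f : X ⟶ Y} {f' : X' ⟶ Y'} (e : X ≅ X') (e' : Y ≅ Y')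
    (h : f ≫ e'.hom = e.hom ≫ f') : postRank k W f = postRank k W f' := by
  have h1 : (LinearMap.range (Linear.rightComp k W f)).map
      (Linear.homCongr k (Iso.refl W) e' : (W ⟶ Y) →ₗ[k] (W ⟶ Y')) =
      LinearMap.range (Linear.rightComp k W f') := by
    ext x
    constructor
    · rintro ⟨_, ⟨y, rfl⟩, rfl⟩
      refine ⟨y ≫ e.hom, ?_⟩
      simp [Linear.homCongr_apply, h]
    · rintro ⟨y, rfl⟩
      refine ⟨_, ⟨y ≫ e.inv, rfl⟩, ?_⟩
      simp [Linear.homCongr_apply, h]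
  unfold postRank
  rw [← h1, LinearEquiv.finrank_map_eq]

lemma preRank_congr (W : C) {X Y X' Y' : C} {f : X ⟶ Y} {f' : X' ⟶ Y'} (e : X ≅ X') (e' : Y ≅ Y')
    (h : f ≫ e'.hom = e.hom ≫ f') : preRank k W f = preRank k W f' := by
  have h0 : e.inv ≫ f = f' ≫ e'.inv := by
    rw [Iso.inv_comp_eq, ← Category.assoc, ← h]; simp
  have h1 : (LinearMap.range (Linear.leftComp k W f)).map
      (Linear.homCongr k e (Iso.refl W) : (X ⟶ W) →ₗ[k] (X' ⟶ W)) =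
      LinearMap.range (Linear.leftComp k W f') := by
    ext x
    constructor
    · rintro ⟨_, ⟨y, rfl⟩, rfl⟩
      refine ⟨e'.inv ≫ y, ?_⟩
      simp [Linear.homCongr_apply, reassoc_of% h0]
    · rintro ⟨y, rfl⟩
      refine ⟨_, ⟨e'.hom ≫ y, rfl⟩, ?_⟩
      simp [Linear.homCongr_apply, reassoc_of% h0]
  unfold preRank
  rw [← h1, LinearEquiv.finrank_map_eq]

variable [∀ X Y : C, Finite (X ⟶ Y)]

lemma Tri.finrank_post (W : C) {Y L X : C} {f : Y ⟶ L} {g : L ⟶ X} {h : X ⟶ Y⟦(1 : ℤ)⟧}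
    (H : Tri f g h) : Module.finrank k (W ⟶ L) = postRank k W f + postRank k W g := by
  rw [postRank, postRank, ← LinearMap.finrank_range_add_finrank_ker (Linear.rightComp k W g),
    add_comm]
  have : LinearMap.ker (Linear.rightComp k W g) = LinearMap.range (Linear.rightComp k W f) := by
    ext b
    constructor
    · intro hb
      obtain ⟨t, rfl⟩ := H.coyoneda₂ b hb
      exact ⟨t, rfl⟩
    · rintro ⟨t, rfl⟩
      change (t ≫ f) ≫ g = 0
      rw [Category.assoc, H.zero₁₂, comp_zero]
  rw [this]

lemma Tri.finrank_pre (W : C) {Y L X : C} {f : Y ⟶ L} {g : L ⟶ X} {h : X ⟶ Y⟦(1 : ℤ)⟧}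
    (H : Tri f g h) : Module.finrank k (L ⟶ W) = preRank k W f + preRank k W g := by
  rw [preRank, preRank, ← LinearMap.finrank_range_add_finrank_ker (Linear.leftComp k W f)]
  have : LinearMap.ker (Linear.leftComp k W f) = LinearMap.range (Linear.leftComp k W g) := by
    ext b
    constructor
    · intro hb
      obtain ⟨t, rfl⟩ := H.yoneda₂ b hb
      exact ⟨t, rfl⟩
    · rintro ⟨t, rfl⟩
      change f ≫ g ≫ t = 0
      rw [← Category.assoc, H.zero₁₂, zero_comp]
  rw [this]

variable [∀ n : ℤ, (shiftFunctor C n).Linear k]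

lemma finrank_hom_shift_shift (hper : TwoPeriodic C) (X Y : C) :
    Module.finrank k (X⟦(1 : ℤ)⟧ ⟶ Y) = Module.finrank k (X ⟶ Y⟦(1 : ℤ)⟧) := by
  obtain ⟨e⟩ := hper.nonempty_iso Y
  rw [← finrank_hom_congr k (Iso.refl (X⟦(1 : ℤ)⟧)) e]
  exact (LinearEquiv.ofBijective ((shiftFunctor C (1 : ℤ)).mapLinearMap k)
      ⟨fun _ _ h => (shiftFunctor C (1 : ℤ)).map_injective h,
        fun y => (shiftFunctor C (1 : ℤ)).map_surjective y⟩).finrank_eq.symm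

/-- `dim Hom(W, -) - dim Hom(W, T -)` is additive on triangles. -/
lemma Tri.euler_post (hper : TwoPeriodic C) (W : C) {Y L X : C} {f : Y ⟶ L} {g : L ⟶ X}
    {h : X ⟶ Y⟦(1 : ℤ)⟧}
    (H : Tri f g h) :
    (Module.finrank k (W ⟶ L) : ℤ) - Module.finrank k (W ⟶ L⟦(1 : ℤ)⟧) =
      ((Module.finrank k (W ⟶ X) : ℤ) - Module.finrank k (W ⟶ X⟦(1 : ℤ)⟧)) +
      ((Module.finrank k (W ⟶ Y) : ℤ) - Module.finrank k (W ⟶ Y⟦(1 : ℤ)⟧)) := by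
  obtain ⟨e⟩ := hper
  have h0 := H.finrank_post k W
  have h1 := H.rotate.finrank_post k W
  have h2 := H.rotate.rotate.finrank_post k W
  have h3 := H.rotate.rotate.rotate.finrank_post k W
  have h4 := H.rotate.rotate.rotate.rotate.finrank_post k W
  have h5 := H.rotate.rotate.rotate.rotate.rotate.finrank_post k W
  have h6 : postRank k W (-(-f⟦(1 : ℤ)⟧')⟦(1 : ℤ)⟧') = postRank k W f :=
    postRank_congr k W (e.app Y) (e.app L) (by
      have := e.hom.naturality f
      simpa using this)
  have h7 := finrank_hom_congr k (Iso.refl W) (e.app Y)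
  change Module.finrank k (W ⟶ Y⟦(1 : ℤ)⟧⟦(1 : ℤ)⟧) = Module.finrank k (W ⟶ Y) at h7
  rw [h7, h6] at h5
  push_cast [h0, h1, h2, h3, h4, h5]
  ring

/-- `dim Hom(-, W) - dim Hom(-, T W)` is additive on triangles. -/
lemma Tri.euler_pre (hper : TwoPeriodic C) (W : C) {Y L X : C} {f : Y ⟶ L} {g : L ⟶ X}
    {h : X ⟶ Y⟦(1 : ℤ)⟧}
    (H : Tri f g h) :
    (Module.finrank k (L ⟶ W) : ℤ) - Module.finrank k (L ⟶ W⟦(1 : ℤ)⟧) =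
      ((Module.finrank k (X ⟶ W) : ℤ) - Module.finrank k (X ⟶ W⟦(1 : ℤ)⟧)) +
      ((Module.finrank k (Y ⟶ W) : ℤ) - Module.finrank k (Y ⟶ W⟦(1 : ℤ)⟧)) := by
  simp only [← finrank_hom_shift_shift k hper]
  obtain ⟨e⟩ := hper
  have h0 := H.finrank_pre k W
  have h1 := H.rotate.finrank_pre k W
  have h2 := H.rotate.rotate.finrank_pre k W
  have h3 := H.rotate.rotate.rotate.finrank_pre k W
  have h4 := H.rotate.rotate.rotate.rotate.finrank_pre k W
  have h5 := H.rotate.rotate.rotate.rotate.rotate.finrank_pre k W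
  have h6 : preRank k W (-(-f⟦(1 : ℤ)⟧')⟦(1 : ℤ)⟧') = preRank k W f :=
    preRank_congr k W (e.app Y) (e.app L) (by
      have := e.hom.naturality f
      simpa using this)
  have h7 := finrank_hom_congr k (e.app Y) (Iso.refl W)
  change Module.finrank k (Y⟦(1 : ℤ)⟧⟦(1 : ℤ)⟧ ⟶ W) = Module.finrank k (Y ⟶ W) at h7
  rw [h7, h6] at h5
  push_cast [h0, h1, h2, h3, h4, h5]
  ring

lemma Tri.eulerSum_right (hper : TwoPeriodic C) (W : C) {Y L X : C} {f : Y ⟶ L} {g : L ⟶ X}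
    {h : X ⟶ Y⟦(1 : ℤ)⟧}
    (H : Tri f g h) : eulerSum k W L = eulerSum k W X + eulerSum k W Y := by
  have h1 := H.euler_post k hper W
  have h2 := H.euler_pre k hper W
  unfold eulerSum
  linarith

lemma eulerSum_congr_right (W : C) {X X' : C} (e : X ≅ X') : eulerSum k W X = eulerSum k W X' := by
  unfold eulerSum
  rw [finrank_hom_congr k (Iso.refl W) e, finrank_hom_congr k e (Iso.refl W),
    finrank_hom_congr k (Iso.refl W) ((shiftFunctor C (1 : ℤ)).mapIso e),
    finrank_hom_congr k e (Iso.refl (W⟦(1 : ℤ)⟧))]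

lemma eulerSum_symm (X Y : C) : eulerSum k X Y = eulerSum k Y X := by
  unfold eulerSum
  ring

/-- Homomorphisms from the Grothendieck group that agree on classes of objects are equal. -/
lemma GrothendieckGroup.hom_ext {A : Type*} [AddCommGroup A] {φ ψ : GrothendieckGroup C →+ A}
    (h : ∀ X : C, φ (cls X) = ψ (cls X)) : φ = ψ := by
  refine QuotientAddGroup.addMonoidHom_ext _ (FreeAbelianGroup.lift_ext _ _ fun c => ?_)
  induction c using Quotient.inductionOn with
  | h X => exact h X

/-- An invariant of objects with values in an abelian group that is additive on triangles factors
through the Grothendieck group. -/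
lemma GrothendieckGroup.exists_hom {A : Type*} [AddCommGroup A] (φ : C → A)
    (h : ∀ X Y : C, Nonempty (X ≅ Y) → φ X = φ Y)
    (hφ : ∀ (Y L X : C) (f : Y ⟶ L) (g : L ⟶ X) (h : X ⟶ Y⟦(1 : ℤ)⟧), Tri f g h →
      φ L = φ X + φ Y) :
    ∃ ψ : GrothendieckGroup C →+ A, ∀ X, ψ (cls X) = φ X := by
  refine ⟨QuotientAddGroup.lift (triangleRelations C)
    (FreeAbelianGroup.lift fun c : IsoClass C => Quotient.lift φ h c) ?_, fun X => ?_⟩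
  · unfold triangleRelations
    rw [AddSubgroup.closure_le]
    rintro _ ⟨t, ht, rfl⟩
    change FreeAbelianGroup.lift _ _ = 0
    simp only [map_sub, map_add, FreeAbelianGroup.lift_apply_of]
    change φ t.obj₃ + φ t.obj₁ - φ t.obj₂ = 0
    rw [hφ _ _ _ t.mor₁ t.mor₂ t.mor₃ ht, sub_self]
  · exact FreeAbelianGroup.lift_apply_of _ _

/-- The symmetrized Euler form on the Grothendieck group. -/
theorem exists_eulerForm (hper : TwoPeriodic C) :
    ∃ form : (ℚ ⊗[ℤ] GrothendieckGroup C) →ₗ[ℚ] (ℚ ⊗[ℤ] GrothendieckGroup C) →ₗ[ℚ] ℚ,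
      IsEulerForm k form := by
  choose φ hφ using fun W : C => GrothendieckGroup.exists_hom (eulerSum k W)
    (fun X Y ⟨e⟩ => eulerSum_congr_right k W e)
    (fun Y L X f g h H => H.eulerSum_right k hper W)
  obtain ⟨ψ, hψ⟩ := GrothendieckGroup.exists_hom φ
    (fun X Y ⟨e⟩ => GrothendieckGroup.hom_ext fun W => by
      rw [hφ, hφ, eulerSum_symm, eulerSum_congr_right k W e, eulerSum_symm])
    (fun Y L X f g h H => GrothendieckGroup.hom_ext fun W => by
      rw [AddMonoidHom.add_apply, hφ, hφ, hφ, eulerSum_symm k L, eulerSum_symm k X,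
        eulerSum_symm k Y, H.eulerSum_right k hper W])
  let B : LinearMap.BilinForm ℤ (GrothendieckGroup C) :=
    AddMonoidHom.toIntLinearMap
      ({ toFun := fun x => (ψ x).toIntLinearMap
         map_zero' := by ext; simp
         map_add' := fun x y => by ext; simp } :
        GrothendieckGroup C →+ (GrothendieckGroup C →ₗ[ℤ] ℤ))
  refine ⟨B.baseChange ℚ, fun X Y => ?_⟩
  have h1 : B (cls X) (cls Y) = eulerSum k X Y := by
    change ψ (cls X) (cls Y) = _
    rw [hψ, hφ]
  unfold ratCls
  rw [LinearMap.BilinForm.baseChange_tmul, h1]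
  simp

variable [IsTriangulated C] [IsIdempotentComplete C] [Finite k]

/-- The number `(h_X / d(X) | h_M)` is an integer, congruent modulo `q - 1` to a difference of two
numbers of orbits, since `d(X)` divides `dim Hom(X, M)` and `dim Hom(M, X)`. -/
theorem exists_eulerSum_eq (hper : TwoPeriodic C) {X Y : C} (hX : Indecomposable X)
    (e : X ≅ Y⟦(1 : ℤ)⟧) (M : C) :
    ∃ n : ℤ, eulerSum k X M = endDim k X * n ∧
      (n : ZMod (Nat.card k - 1)) = orbitCount k X M - orbitCount k Y M := by
  obtain ⟨e'⟩ := hper.nonempty_iso Y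
  have e2 : X⟦(1 : ℤ)⟧ ≅ Y := (shiftFunctor C (1 : ℤ)).mapIso e ≪≫ e'
  have hY : Indecomposable Y := (hX.shift 1).of_iso e2
  have hd : endDim k Y = endDim k X := by
    rw [← endDim_iso k (hX.shift 1) e2, endDim_shift k hX]
  obtain ⟨a, ha, ha'⟩ := exists_finrank_eq_pre k hX M
  obtain ⟨b, hb, hb'⟩ := exists_finrank_eq_post k M hX
  obtain ⟨c, hc, hc'⟩ := exists_finrank_eq_pre k hY M
  obtain ⟨d, hd1, hd'⟩ := exists_finrank_eq_post k M hY
  refine ⟨a - c + b - d, ?_, ?_⟩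
  · unfold eulerSum
    rw [← finrank_hom_shift_shift k hper X M, finrank_hom_congr k e2 (Iso.refl M),
      finrank_hom_congr k (Iso.refl M) e2, ha, hb, hc, hd1, hd]
    push_cast
    ring
  · unfold orbitCount
    rw [← ha', ← hb', ← hc', ← hd']
    push_cast
    ring

lemma form_coroot_ratCls {form : (ℚ ⊗[ℤ] GrothendieckGroup C) →ₗ[ℚ]
    (ℚ ⊗[ℤ] GrothendieckGroup C) →ₗ[ℚ] ℚ} (hform : IsEulerForm k form) {X M : C}
    (hX : Indecomposable X) {n : ℤ} (hn : eulerSum k X M = endDim k X * n) :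
    form (coroot k X) (ratCls M) = n := by
  have hd : (endDim k X : ℚ) ≠ 0 := by exact_mod_cast (endDim_pos k hX).ne'
  unfold coroot
  rw [map_smul, LinearMap.smul_apply, hform X M, hn]
  push_cast
  rw [smul_eq_mul, inv_mul_cancel_left₀ hd]

end EulerForm

/-! ### Classes in the Grothendieck group -/

section Bracket

open scoped Classical ZeroObject

variable {C : Type u} [Category.{v} C] [Preadditive C] [HasZeroObject C] [HasShift C ℤ]
  [∀ n : ℤ, (shiftFunctor C n).Additive] [Pretriangulated C]

lemma Tri.cls_eq {Y L X : C} {f : Y ⟶ L} {g : L ⟶ X} {h : X ⟶ Y⟦(1 : ℤ)⟧} (H : Tri f g h) :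
    cls L = cls X + cls Y := by
  have h1 : FreeAbelianGroup.of (isoClass X) + FreeAbelianGroup.of (isoClass Y) -
      FreeAbelianGroup.of (isoClass L) ∈ triangleRelations C :=
    AddSubgroup.subset_closure ⟨_, H, rfl⟩
  have h2 := (QuotientAddGroup.eq_zero_iff _).2 h1
  exact (sub_eq_zero.1 h2).symm

lemma cls_congr {X Y : C} (e : X ≅ Y) : cls X = cls Y :=
  congrArg (fun c => (QuotientAddGroup.mk (FreeAbelianGroup.of c) : GrothendieckGroup C))
    (Quotient.sound ⟨e⟩)

lemma cls_shift (X : C) : cls (X⟦(1 : ℤ)⟧) = - cls X := by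
  have h1 : Tri (𝟙 (0 : C)) (0 : (0 : C) ⟶ 0) 0 := contractible_distinguished (0 : C)
  have h2 : Tri (𝟙 X) (0 : X ⟶ 0) 0 := contractible_distinguished X
  have h3 := h1.cls_eq
  have h4 := h2.rotate.cls_eq
  have h5 : cls (0 : C) = 0 := by simpa using h3
  rw [h5] at h4
  exact eq_neg_of_add_eq_zero_left h4.symm

lemma Tri.ratCls_eq {Y L X : C} {f : Y ⟶ L} {g : L ⟶ X} {h : X ⟶ Y⟦(1 : ℤ)⟧} (H : Tri f g h) :
    ratCls L = ratCls X + ratCls Y := by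
  unfold ratCls
  rw [H.cls_eq, TensorProduct.tmul_add]

lemma ratCls_congr {X Y : C} (e : X ≅ Y) : ratCls X = ratCls Y := by
  unfold ratCls
  rw [cls_congr e]

lemma ratCls_shift (X : C) : ratCls (X⟦(1 : ℤ)⟧) = - ratCls X := by
  unfold ratCls
  rw [cls_shift, TensorProduct.tmul_neg]

lemma hallNumber_eq_zero_of_iso_shift [∀ X Y : C, Finite (X ⟶ Y)]
    (hproper : ProperGrothendieckGroup C) {X Y L : C}
    (e : X ≅ Y⟦(1 : ℤ)⟧) (hL : Indecomposable L) : hallNumber X Y L = 0 := by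
  by_contra h
  obtain ⟨f, g, h, H⟩ := exists_tri_of_hallNumber_ne_zero h
  apply hproper L hL
  rw [H.cls_eq, cls_congr e, cls_shift, neg_add_cancel]

lemma finite_support_hallNumber [∀ X Y : C, Finite (X ⟶ Y)] (X Y : C) :
    (Function.support fun ℓ : IndClass C => (hallNumber X Y ℓ.out.1 : ℤ)).Finite := by
  have h1 : ∀ ℓ : Function.support fun ℓ : IndClass C => (hallNumber X Y ℓ.out.1 : ℤ),
      ∃ h : X ⟶ Y⟦(1 : ℤ)⟧, Nonempty (fibObj h ≅ ℓ.1.out.1) := by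
    rintro ⟨ℓ, hℓ⟩
    obtain ⟨f, g, h, H⟩ := exists_tri_of_hallNumber_ne_zero (X := X) (Y := Y) (L := ℓ.out.1)
      (by simpa using hℓ)
    exact ⟨h, (isFib_iff_fibObj h).1 ⟨g, _, H.rotate⟩⟩
  choose φ hφ using h1
  have h2 : Function.Injective φ := by
    intro ℓ ℓ' h
    obtain ⟨e⟩ := hφ ℓ
    obtain ⟨e'⟩ := hφ ℓ'
    rw [h] at e
    refine Subtype.ext ?_
    rw [← indClass_out ℓ.1, ← indClass_out ℓ'.1]
    exact Quotient.sound ⟨e.symm ≪≫ e'⟩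
  have := Finite.of_injective φ h2
  exact Set.toFinite _

/-- The element `∑ F_{XY}^L u_L` of `𝔫`, the sum over classes of indecomposable objects `L`. -/
def hallFinsupp [∀ X Y : C, Finite (X ⟶ Y)] (X Y : C) : IndClass C →₀ ℤ :=
  Finsupp.ofSupportFinite (fun ℓ => (hallNumber X Y ℓ.out.1 : ℤ)) (finite_support_hallNumber X Y)

lemma hallFinsupp_apply [∀ X Y : C, Finite (X ⟶ Y)] (X Y : C) (ℓ : IndClass C) :
    hallFinsupp X Y ℓ = hallNumber X Y ℓ.out.1 := rfl

variable [IsIdempotentComplete C] [IsTriangulated C] [∀ X Y : C, Finite (X ⟶ Y)]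
variable (k : Type w) [Field k] [Finite k] [Linear k C] [∀ n : ℤ, (shiftFunctor C n).Linear k]

lemma endDim_smul_coroot {X : C} (hX : Indecomposable X) :
    (endDim k X : ℚ) • coroot k X = ratCls X := by
  have hd : (endDim k X : ℚ) ≠ 0 := by exact_mod_cast (endDim_pos k hX).ne'
  unfold coroot
  rw [smul_inv_smul₀ hd]

lemma coroot_congr {X Y : C} (hX : Indecomposable X) (e : X ≅ Y) : coroot k X = coroot k Y := by
  unfold coroot
  rw [ratCls_congr e, endDim_iso k hX e]

lemma coroot_shift {X : C} (hX : Indecomposable X) : coroot k (X⟦(1 : ℤ)⟧) = - coroot k X := by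
  unfold coroot
  rw [ratCls_shift, endDim_shift k hX, smul_neg]

lemma coroot_eq_neg {X Y : C} (hX : Indecomposable X) (hY : Indecomposable Y)
    (e : X ≅ Y⟦(1 : ℤ)⟧) : coroot k X = - coroot k Y := by
  rw [coroot_congr k hX e, coroot_shift k hY]

/-- `h_X / d(X)` as an element of `𝔥`. -/
def cartanElt (X : C) (hX : Indecomposable X) : cartan k C :=
  ⟨coroot k X, Submodule.subset_span ⟨X, hX, rfl⟩⟩

variable {k} in
/-- The pairing of `𝔥` with classes of indecomposable objects takes integral values. -/
theorem exists_weight (hper : TwoPeriodic C) {form : (ℚ ⊗[ℤ] GrothendieckGroup C) →ₗ[ℚ]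
    (ℚ ⊗[ℤ] GrothendieckGroup C) →ₗ[ℚ] ℚ} (hform : IsEulerForm k form) :
    ∃ ω : cartan k C →ₗ[ℤ] (IndClass C → ℤ), ∀ h ℓ,
      (ω h ℓ : ℚ) = form h (ratCls ℓ.out.1) := by
  have h1 : ∀ (h : cartan k C) (ℓ : IndClass C), ∃ n : ℤ,
      (n : ℚ) = form h (ratCls ℓ.out.1) := by
    rintro ⟨h, hh⟩ ℓ
    change ∃ n : ℤ, (n : ℚ) = form h (ratCls ℓ.out.1)
    induction hh using Submodule.span_induction with
    | mem x hx =>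
      obtain ⟨X, hX, rfl⟩ := hx
      obtain ⟨e⟩ := hper.nonempty_iso X
      obtain ⟨n, hn, -⟩ := exists_eulerSum_eq k hper hX e.symm ℓ.out.1
      exact ⟨n, (form_coroot_ratCls k hform hX hn).symm⟩
    | zero => exact ⟨0, by simp⟩
    | add x y _ _ hx hy =>
      obtain ⟨a, ha⟩ := hx
      obtain ⟨b, hb⟩ := hy
      exact ⟨a + b, by rw [Int.cast_add, ha, hb, map_add, LinearMap.add_apply]⟩
    | smul c x _ hx =>
      obtain ⟨a, ha⟩ := hx
      refine ⟨c * a, ?_⟩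
      rw [map_zsmul, LinearMap.smul_apply, ← ha, Int.cast_mul, zsmul_eq_mul]
  choose ω hω using h1
  refine ⟨AddMonoidHom.toIntLinearMap (AddMonoidHom.mk' ω fun x y => ?_), hω⟩
  ext ℓ
  apply Int.cast_injective (α := ℚ)
  rw [Pi.add_apply, Int.cast_add, hω, hω, hω, Submodule.coe_add, map_add, LinearMap.add_apply]

/-! ### The bracket -/

/-- The bracket `[u_X, u_Y]` for classes of indecomposable objects `X`, `Y`. The component in `𝔫`
vanishes if `X ≅ T Y`, since the Grothendieck group is proper. -/
def nilBracket (ℓ ℓ' : IndClass C) : HallLie k C :=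
  (if Nonempty (ℓ.out.1 ≅ ℓ'.out.1⟦(1 : ℤ)⟧) then cartanElt k ℓ.out.1 ℓ.out.2 else 0,
    hallFinsupp ℓ.out.1 ℓ'.out.1 - hallFinsupp ℓ'.out.1 ℓ.out.1)

/-- The biadditive extension of `nilBracket` to `𝔫`. -/
def nilBilin : (IndClass C →₀ ℤ) →ₗ[ℤ] (IndClass C →₀ ℤ) →ₗ[ℤ] HallLie k C :=
  Finsupp.linearCombination ℤ fun ℓ => Finsupp.linearCombination ℤ (nilBracket k ℓ)

@[simp] lemma nilBilin_single (ℓ ℓ' : IndClass C) :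
    nilBilin k (Finsupp.single ℓ 1) (Finsupp.single ℓ' 1) = nilBracket k ℓ ℓ' := by
  simp [nilBilin]

variable {k} in
/-- The bracket on `𝔤 = 𝔥 ⊕ 𝔫`, where `𝔥` acts on `𝔫` diagonally through `-ω`. -/
def hallBracket (ω : cartan k C →ₗ[ℤ] (IndClass C → ℤ)) :
    HallLie k C →ₗ[ℤ] HallLie k C →ₗ[ℤ] HallLie k C :=
  LinearMap.mk₂ ℤ (fun x y => nilBilin k x.2 y.2 + (0, ω y.1 • x.2 - ω x.1 • y.2))
    (fun x x' y => by
      ext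
      · simp [add_smul]
      · simp [add_smul]
        ring)
    (fun c x y => by
      ext
      · simp
      · simp
        ring)
    (fun x y y' => by
      ext
      · simp [add_smul]
      · simp [add_smul]
        ring)
    (fun c x y => by
      ext
      · simp
      · simp
        ring)

variable {k} in
lemma hallBracket_apply (ω : cartan k C →ₗ[ℤ] (IndClass C → ℤ)) (x y : HallLie k C) :
    hallBracket ω x y = nilBilin k x.2 y.2 + (0, ω y.1 • x.2 - ω x.1 • y.2) := rfl

lemma nilBracket_antisymm (hper : TwoPeriodic C) (ℓ ℓ' : IndClass C) :
    nilBracket k ℓ ℓ' = - nilBracket k ℓ' ℓ := by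
  have h1 : Nonempty (ℓ.out.1 ≅ ℓ'.out.1⟦(1 : ℤ)⟧) ↔ Nonempty (ℓ'.out.1 ≅ ℓ.out.1⟦(1 : ℤ)⟧) :=
    ⟨nonempty_iso_shift_symm (hper.nonempty_iso _), nonempty_iso_shift_symm (hper.nonempty_iso _)⟩
  unfold nilBracket
  rw [Prod.neg_mk, neg_sub]
  congr 1
  by_cases h : Nonempty (ℓ.out.1 ≅ ℓ'.out.1⟦(1 : ℤ)⟧)
  · rw [if_pos h, if_pos (h1.1 h)]
    exact Subtype.ext (coroot_eq_neg k ℓ.out.2 ℓ'.out.2 h.some)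
  · rw [if_neg h, if_neg (mt h1.2 h), neg_zero]

lemma nilBracket_self (ℓ : IndClass C) : nilBracket k ℓ ℓ = 0 := by
  unfold nilBracket
  rw [sub_self]
  refine Prod.ext ?_ rfl
  change ite _ _ _ = _
  split_ifs with h
  · refine Subtype.ext ?_
    have h1 := coroot_eq_neg k ℓ.out.2 ℓ.out.2 h.some
    have h2 : (2 : ℚ) • coroot k ℓ.out.1 = 0 := by
      rw [two_smul]
      nth_rewrite 1 [h1]
      exact neg_add_cancel _
    exact (smul_eq_zero.1 h2).resolve_left two_ne_zero
  · rfl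

lemma nilBilin_antisymm (hper : TwoPeriodic C) (n n' : IndClass C →₀ ℤ) :
    nilBilin k n n' = - nilBilin k n' n := by
  have : nilBilin k = - (nilBilin k (C := C)).flip := by
    refine Finsupp.lhom_ext' fun ℓ => LinearMap.ext_ring (Finsupp.lhom_ext' fun ℓ' =>
      LinearMap.ext_ring ?_)
    simpa using nilBracket_antisymm k hper ℓ ℓ'
  exact congrArg (fun B => B n n') this

lemma nilBilin_self (hper : TwoPeriodic C) (n : IndClass C →₀ ℤ) : nilBilin k n n = 0 := by
  induction n using Finsupp.induction_linear with
  | zero => simp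
  | add f g hf hg =>
    simp [hf, hg, nilBilin_antisymm k hper f g]
  | single ℓ a =>
    have h : Finsupp.single ℓ a = a • Finsupp.single ℓ (1 : ℤ) := by simp
    rw [h, map_smul, map_smul, LinearMap.smul_apply, nilBilin_single, nilBracket_self, smul_zero,
      smul_zero]

variable {k} in
lemma hallBracket_self (hper : TwoPeriodic C) (ω : cartan k C →ₗ[ℤ] (IndClass C → ℤ))
    (x : HallLie k C) : hallBracket ω x x = 0 := by
  rw [hallBracket_apply, nilBilin_self k hper, sub_self]
  simp

variable {k} in
/-- The bracket has the prescribed values on generators. If `X ≅ T Y`, the `𝔫`-component of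
`[u_X, u_Y]` vanishes because the Grothendieck group is proper. -/
theorem isHallBracket_hallBracket (hper : TwoPeriodic C) (hproper : ProperGrothendieckGroup C)
    {form : (ℚ ⊗[ℤ] GrothendieckGroup C) →ₗ[ℚ] (ℚ ⊗[ℤ] GrothendieckGroup C) →ₗ[ℚ] ℚ}
    (ω : cartan k C →ₗ[ℤ] (IndClass C → ℤ))
    (hω : ∀ h ℓ, (ω h ℓ : ℚ) = form h (ratCls ℓ.out.1)) :
    IsHallBracket k form (hallBracket ω) := by
  have huu : ∀ (X Y : C) (hX : Indecomposable X) (hY : Indecomposable Y),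
      hallBracket ω (uGen k X hX) (uGen k Y hY) =
        nilBracket k (indClass X hX) (indClass Y hY) := by
    intro X Y hX hY
    rw [hallBracket_apply]
    simp [uGen]
  have hout : ∀ (X : C) (hX : Indecomposable X), Nonempty ((indClass X hX).out.1 ≅ X) :=
    nonempty_iso_indClass_out
  constructor
  · intro X Y hX hY hXY
    obtain ⟨eX⟩ := hout X hX
    obtain ⟨eY⟩ := hout Y hY
    rw [huu]
    constructor
    · refine if_neg fun ⟨e⟩ => hXY ⟨eX.symm ≪≫ e ≪≫ (shiftFunctor C (1 : ℤ)).mapIso eY⟩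
    · intro L hL
      obtain ⟨eL⟩ := hout L hL
      change (hallNumber _ _ _ : ℤ) - hallNumber _ _ _ = _
      rw [hallNumber_congr eX eY eL, hallNumber_congr eY eX eL]
  · intro X Y hX hY hXY
    obtain ⟨eX⟩ := hout X hX
    obtain ⟨eY⟩ := hout Y hY
    have e : (indClass X hX).out.1 ≅ (indClass Y hY).out.1⟦(1 : ℤ)⟧ :=
      eX ≪≫ hXY.some ≪≫ ((shiftFunctor C (1 : ℤ)).mapIso eY).symm
    have e' := (nonempty_iso_shift_symm (hper.nonempty_iso _) ⟨e⟩).some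
    rw [huu]
    refine Prod.ext ?_ ?_
    · refine (if_pos ⟨e⟩).trans (Subtype.ext ?_)
      exact coroot_congr k (indClass X hX).out.2 eX
    · refine Finsupp.ext fun ℓ => ?_
      change (hallNumber _ _ _ : ℤ) - hallNumber _ _ _ = 0
      rw [hallNumber_eq_zero_of_iso_shift hproper e ℓ.out.2,
        hallNumber_eq_zero_of_iso_shift hproper e' ℓ.out.2, sub_self]
  · intro X Y hX hY
    obtain ⟨eY⟩ := hout Y hY
    refine ⟨ω (cartanElt k X hX) (indClass Y hY), ?_, ?_, ?_⟩
    · rw [hω, ratCls_congr eY]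
      rfl
    · rw [hallBracket_apply]
      refine Prod.ext (by simp [hGen, uGen]) (Finsupp.ext fun ℓ => ?_)
      by_cases h : indClass Y hY = ℓ
      · subst h; simp [hGen, uGen, cartanElt]
      · simp [hGen, uGen, h]
    · rw [hallBracket_apply]
      refine Prod.ext (by simp [hGen, uGen]) (Finsupp.ext fun ℓ => ?_)
      by_cases h : indClass Y hY = ℓ
      · subst h; simp [hGen, uGen, cartanElt]
      · simp [hGen, uGen, h]
  · intro X Y hX hY
    rw [hallBracket_apply]
    simp [hGen]

end Bracket

/-! ### Counting triangles -/

section TriangleCount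

open scoped Classical

variable {C : Type u} [Category.{v} C] [Preadditive C] [HasZeroObject C] [HasShift C ℤ]
  [∀ n : ℤ, (shiftFunctor C n).Additive] [Pretriangulated C]

/-- The map `(f, g, h) ↦ (g, h, -T f)` is a bijection between sets of triangles. -/
lemma card_triangleSet_rotate (X Y L : C) :
    Nat.card (TriangleSet X Y L) = Nat.card (TriangleSet (Y⟦(1 : ℤ)⟧) L X) := by
  refine Nat.card_congr ⟨fun t => ⟨t.g, t.h, -t.f⟦(1 : ℤ)⟧', Tri.rotate t.dist⟩,
    fun t => ⟨(shiftFunctor C (1 : ℤ)).preimage (-t.h), t.f, t.g,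
      Tri.of_rotate (by simpa using t.dist)⟩, fun t => ?_, fun t => ?_⟩
  · cases t
    simp
  · cases t
    simp

lemma card_triangleSet_congr {X Y L X' Y' L' : C} (a : X ≅ X') (b : Y ≅ Y') (c : L ≅ L') :
    Nat.card (TriangleSet X Y L) = Nat.card (TriangleSet X' Y' L') := by
  refine Nat.card_congr
    ⟨fun t => ⟨b.inv ≫ t.f ≫ c.hom, c.inv ≫ t.g ≫ a.hom, a.inv ≫ t.h ≫ b.hom⟦(1 : ℤ)⟧',
        Tri.of_iso t.dist b c a (by simp) (by simp) (by simp)⟩,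
      fun t => ⟨b.hom ≫ t.f ≫ c.inv, c.hom ≫ t.g ≫ a.inv, a.hom ≫ t.h ≫ b.inv⟦(1 : ℤ)⟧',
        Tri.of_iso t.dist b.symm c.symm a.symm (by simp) (by simp) (by simp)⟩,
      fun t => ?_, fun t => ?_⟩
  · cases t
    simp [← Functor.map_comp]
  · cases t
    simp [← Functor.map_comp]

lemma card_triangleSet_cycle (hper : TwoPeriodic C) (X Y Z : C) :
    Nat.card (TriangleSet X Y (Z⟦(1 : ℤ)⟧)) = Nat.card (TriangleSet Y Z (X⟦(1 : ℤ)⟧)) := by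
  rw [card_triangleSet_rotate X Y, card_triangleSet_rotate Y Z, card_triangleSet_rotate _ _ Y,
    card_triangleSet_rotate _ Y]
  exact card_triangleSet_congr (Iso.refl _) (Iso.refl _) (hper.nonempty_iso X).some.symm

variable [IsIdempotentComplete C] [∀ X Y : C, Finite (X ⟶ Y)]

lemma card_triangleSet_eq_sum (X Y L : C) : Nat.card (TriangleSet X Y L) =
    ∑ f : Y ⟶ L, ∑ g : L ⟶ X, Nat.card {h : X ⟶ Y⟦(1 : ℤ)⟧ // Tri f g h} := by
  have e : TriangleSet X Y L ≃ Σ f : Y ⟶ L, Σ g : L ⟶ X, {h : X ⟶ Y⟦(1 : ℤ)⟧ // Tri f g h} :=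
    ⟨fun t => ⟨t.f, t.g, t.h, t.dist⟩, fun t => ⟨t.1, t.2.1, t.2.2.1, t.2.2.2⟩,
      fun t => rfl, fun t => rfl⟩
  rw [Nat.card_congr e, Nat.card_sigma]
  refine Finset.sum_congr rfl fun f _ => ?_
  rw [Nat.card_sigma]

variable (k : Type w) [Field k] [Finite k] [Linear k C]

/-- The morphisms `h` completing `f`, `g` to a triangle form a coset of a subspace. -/
lemma natCast_card_tri {X Y L : C} (hX : Indecomposable X) {f : Y ⟶ L} {g : L ⟶ X} (hg : g ≠ 0) :
    (Nat.card {h : X ⟶ Y⟦(1 : ℤ)⟧ // Tri f g h} : ZMod (Nat.card k - 1)) =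
      if IsPair f g then 1 else 0 := by
  split_ifs with hp
  · obtain ⟨h₀, H⟩ := hp
    refine natCast_card_coset k ((LinearMap.ker (Linear.leftComp k X g)).map
      (Linear.rightComp k X h₀)) _ h₀ fun h => ?_
    constructor
    · intro H'
      obtain ⟨e, he, he'⟩ := H'.exists_iso₃ H
      refine ⟨e.hom - 𝟙 X, ?_, ?_⟩
      · change g ≫ (e.hom - 𝟙 X) = 0
        rw [Preadditive.comp_sub, he, Category.comp_id, sub_self]
      · change (e.hom - 𝟙 X) ≫ h₀ = h - h₀
        rw [Preadditive.sub_comp, ← he', Category.id_comp]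
    · rintro ⟨ε, hε, hε'⟩
      change g ≫ ε = 0 at hε
      change ε ≫ h₀ = h - h₀ at hε'
      have h1 : ¬ IsIso ε := fun _ => hg (by rw [← cancel_mono ε, hε, zero_comp])
      have h2 : IsIso (𝟙 X + ε) :=
        (isUnit_iff_isIso (𝟙 X + ε)).1 ((hX.isIso_iff ε).1 h1).isUnit_one_add
      refine H.of_iso (Iso.refl _) (Iso.refl _) (asIso (𝟙 X + ε)).symm (by simp) ?_ ?_
      · simp [IsIso.comp_inv_eq, hε]
      · simp [hε']
  · have : IsEmpty {h : X ⟶ Y⟦(1 : ℤ)⟧ // Tri f g h} := ⟨fun h => hp ⟨h.1, h.2⟩⟩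
    simp

/-- The number of triangles is divisible by the numbers of units of the residue fields of `X` and
`Y`, and the quotient is congruent to the number of orbits. -/
theorem exists_card_triangleSet_eq {X Y L : C} (hX : Indecomposable X) (hY : Indecomposable Y)
    (hL : Indecomposable L) :
    ∃ n : ℕ, Nat.card (TriangleSet X Y L) = unitCard k X * (unitCard k Y * n) ∧
      (n : ZMod (Nat.card k - 1)) = hallNumber X Y L := by
  have hf0 : ∀ g : L ⟶ X, ¬ IsPair (0 : Y ⟶ L) g := fun g hg =>
    not_isCone_zero hX hY.1 hL.1 ⟨g, hg⟩
  have hg0 : ∀ f : Y ⟶ L, ¬ IsPair f (0 : L ⟶ X) := fun f hf =>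
    not_isFib_zero hY hL.1 hX.1 ⟨f, hf⟩
  have h0 : ∀ (f : Y ⟶ L) (g : L ⟶ X), ¬ IsPair f g →
      Nat.card {h : X ⟶ Y⟦(1 : ℤ)⟧ // Tri f g h} = 0 := fun f g hp => by
    have : IsEmpty {h : X ⟶ Y⟦(1 : ℤ)⟧ // Tri f g h} := ⟨fun h => hp ⟨h.1, h.2⟩⟩
    exact Nat.card_of_isEmpty
  have hinv : ∀ (f : Y ⟶ L) (g : L ⟶ X) (ξ : X ≅ X),
      Nat.card {h : X ⟶ Y⟦(1 : ℤ)⟧ // Tri f (g ≫ ξ.hom) h} =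
        Nat.card {h : X ⟶ Y⟦(1 : ℤ)⟧ // Tri f g h} := fun f g ξ =>
    Nat.card_congr ⟨fun h => ⟨ξ.hom ≫ h.1, h.2.of_iso (Iso.refl _) (Iso.refl _) ξ.symm
        (by simp) (by simp) (by simp)⟩,
      fun h => ⟨ξ.inv ≫ h.1, h.2.of_iso (Iso.refl _) (Iso.refl _) ξ
        (by simp) (by simp) (by simp)⟩, fun h => by simp, fun h => by simp⟩
  have hinv' : ∀ (f : Y ⟶ L) (g : L ⟶ X) (η : Y ≅ Y),
      Nat.card {h : X ⟶ Y⟦(1 : ℤ)⟧ // Tri (η.hom ≫ f) g h} =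
        Nat.card {h : X ⟶ Y⟦(1 : ℤ)⟧ // Tri f g h} := fun f g η =>
    Nat.card_congr ⟨fun h => ⟨h.1 ≫ η.hom⟦(1 : ℤ)⟧', h.2.of_iso η (Iso.refl _) (Iso.refl _)
        (by simp) (by simp) (by simp)⟩,
      fun h => ⟨h.1 ≫ η.inv⟦(1 : ℤ)⟧', h.2.of_iso η.symm (Iso.refl _) (Iso.refl _)
        (by simp) (by simp) (by simp)⟩, fun h => by simp [← Functor.map_comp],
        fun h => by simp [← Functor.map_comp]⟩
  -- For a fixed `f`, the morphisms `g` of the triangles form one orbit of `Aut X`, and for each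
  -- such pair `f`, `g` the number of `h` is `1` modulo `q - 1`.
  choose m hm hm' using fun f : Y ⟶ L => sum_post k hX
    (fun g : L ⟶ X => Nat.card {h : X ⟶ Y⟦(1 : ℤ)⟧ // Tri f g h}) (hinv f)
    (h0 _ _ (hg0 f))
  have hm1 : ∀ f, (m f : ZMod (Nat.card k - 1)) = if IsCone f X then 1 else 0 := by
    intro f
    rw [hm' f]
    have h1 : ∀ o : PostOrbit L X,
        (Nat.card {h : X ⟶ Y⟦(1 : ℤ)⟧ // Tri f o.out h} : ZMod (Nat.card k - 1)) =
          if IsPair f o.out then 1 else 0 := by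
      intro o
      by_cases ho : o.out = 0
      · rw [h0 _ _ (ho ▸ hg0 f), if_neg (ho ▸ hg0 f), Nat.cast_zero]
      · exact natCast_card_tri k hX ho
    simp only [h1]
    split_ifs with hc
    · obtain ⟨g, hg⟩ := hc
      change IsPair f g at hg
      rw [Fintype.sum_eq_single (Quotient.mk _ g)]
      · exact if_pos ((isPair_iff_exists_post hg _).2
          (Setoid.symm' _ (Quotient.mk_out (s := postSetoid L X) g)))
      · intro o ho
        refine if_neg fun h => ho ?_
        rw [← Quotient.out_eq o]
        exact Quotient.sound (Setoid.symm' _ ((isPair_iff_exists_post hg _).1 h))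
    · exact Finset.sum_eq_zero fun o _ => if_neg fun h => hc ⟨_, h⟩
  -- It remains to sum over the orbits of `Aut Y` on the morphisms `f`.
  obtain ⟨n, hn, hn'⟩ := sum_pre k hY m
    (fun f η => unitCard_mul_cancel k hX (by
      rw [← hm, ← hm]
      exact Finset.sum_congr rfl fun g _ => hinv' f g η))
    (unitCard_mul_cancel k hX (by
      rw [← hm, mul_zero]
      exact Finset.sum_eq_zero fun g _ => h0 _ _ (hf0 g)))
  refine ⟨n, ?_, ?_⟩
  · rw [card_triangleSet_eq_sum, ← hn, Finset.mul_sum]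
    exact Finset.sum_congr rfl fun f _ => hm f
  · rw [hn', hallNumber_eq_pre, Nat.cast_sum]
    refine Finset.sum_congr rfl fun o _ => ?_
    rw [hm1]
    simp

/-! ### The `𝔥`-component of the Jacobi identity -/

/-- Multiplicities proportional to `q ^ c - 1`, `q ^ a - 1`, `q ^ b - 1` are modulo `q - 1`
proportional to `c`, `a`, `b`, with the same integral factor for the numbers divided by their
greatest common divisor. -/
lemma exists_proportional {q a b c n₁ n₂ n₃ : ℕ} (hq : 1 < q) (ha : 0 < a)
    (h₁ : (q ^ a - 1) * n₁ = (q ^ c - 1) * n₂) (h₂ : (q ^ a - 1) * n₃ = (q ^ b - 1) * n₂) :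
    ∃ g t a' b' c' : ℕ, 0 < g ∧ a = g * a' ∧ b = g * b' ∧ c = g * c' ∧
      (n₁ : ZMod (q - 1)) = t * c' ∧ (n₂ : ZMod (q - 1)) = t * a' ∧
      (n₃ : ZMod (q - 1)) = t * b' ∧ (n₂ = 0 → t = 0) := by
  obtain ⟨g, hg⟩ : ∃ g, g = Nat.gcd a (Nat.gcd b c) := ⟨_, rfl⟩
  have hg0 : 0 < g := hg ▸ Nat.gcd_pos_of_pos_left _ ha
  obtain ⟨a', rfl⟩ : g ∣ a := hg ▸ Nat.gcd_dvd_left _ _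
  obtain ⟨b', rfl⟩ : g ∣ b := hg ▸ (Nat.gcd_dvd_right _ _).trans (Nat.gcd_dvd_left _ _)
  obtain ⟨c', rfl⟩ : g ∣ c := hg ▸ (Nat.gcd_dvd_right _ _).trans (Nat.gcd_dvd_right _ _)
  obtain ⟨x, hx, hx'⟩ := exists_pow_mul_sub_one hq.le g a'
  obtain ⟨y, hy, hy'⟩ := exists_pow_mul_sub_one hq.le g b'
  obtain ⟨z, hz, hz'⟩ := exists_pow_mul_sub_one hq.le g c'
  have hE : 0 < q ^ g - 1 := by
    have := Nat.one_lt_pow hg0.ne' hq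
    omega
  have hx0 : 0 < x := by
    have h1 := Nat.one_lt_pow ha.ne' hq
    rcases Nat.eq_zero_or_pos x with h | h
    · rw [h, mul_zero] at hx
      omega
    · exact h
  -- `x`, `y`, `z` are the quotients of `q ^ a - 1`, `q ^ b - 1`, `q ^ c - 1` by their greatest
  -- common divisor `q ^ g - 1`.
  have hgcd : Nat.gcd x (Nat.gcd y z) = 1 := by
    have h1 : Nat.gcd (q ^ (g * a') - 1) (Nat.gcd (q ^ (g * b') - 1) (q ^ (g * c') - 1)) =
        q ^ g - 1 := by
      rw [Nat.pow_sub_one_gcd_pow_sub_one, Nat.pow_sub_one_gcd_pow_sub_one, ← hg]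
    rw [hx, hy, hz, Nat.gcd_mul_left, Nat.gcd_mul_left] at h1
    exact Nat.eq_of_mul_eq_mul_left hE (h1.trans (mul_one _).symm)
  rw [hx, hz, mul_assoc, mul_assoc] at h₁
  rw [hx, hy, mul_assoc, mul_assoc] at h₂
  have h1 := Nat.eq_of_mul_eq_mul_left hE h₁
  have h2 := Nat.eq_of_mul_eq_mul_left hE h₂
  have hdvd : x ∣ n₂ := by
    have h3 : x ∣ Nat.gcd (x * n₂) (Nat.gcd (y * n₂) (z * n₂)) :=
      Nat.dvd_gcd (dvd_mul_right _ _) (Nat.dvd_gcd (h2 ▸ dvd_mul_right _ _)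
        (h1 ▸ dvd_mul_right _ _))
    rwa [Nat.gcd_mul_right, Nat.gcd_mul_right, hgcd, one_mul] at h3
  obtain ⟨t, rfl⟩ := hdvd
  have h3 : n₁ = z * t := Nat.eq_of_mul_eq_mul_left hx0 (by rw [h1]; ring)
  have h4 : n₃ = y * t := Nat.eq_of_mul_eq_mul_left hx0 (by rw [h2]; ring)
  refine ⟨g, t, a', b', c', hg0, rfl, rfl, rfl, ?_, ?_, ?_, fun h => ?_⟩
  · rw [h3, Nat.cast_mul, hz', mul_comm]
  · rw [Nat.cast_mul, hx', mul_comm]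
  · rw [h4, Nat.cast_mul, hy', mul_comm]
  · exact (Nat.mul_eq_zero.1 h).resolve_left hx0.ne'

variable [IsTriangulated C] [∀ n : ℤ, (shiftFunctor C n).Linear k]

/-- The three numbers of triangles `Y ⟶ T Z ⟶ X ⟶ T Y` and its rotations agree. Hence the Hall
numbers are modulo `q - 1` proportional to `d(Z)`, `d(X)`, `d(Y)`, and the sum is a multiple of
`h_X + h_Y + h_Z`, which vanishes if there is any such triangle. -/
theorem exists_sum_cartanElt_eq (hper : TwoPeriodic C) {X Y Z : C} (hX : Indecomposable X)
    (hY : Indecomposable Y) (hZ : Indecomposable Z) :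
    ∃ w : cartan k C,
      (hallNumber X Y (Z⟦(1 : ℤ)⟧) : ℤ) • cartanElt k (Z⟦(1 : ℤ)⟧) (hZ.shift 1) +
      (hallNumber Y Z (X⟦(1 : ℤ)⟧) : ℤ) • cartanElt k (X⟦(1 : ℤ)⟧) (hX.shift 1) +
      (hallNumber Z X (Y⟦(1 : ℤ)⟧) : ℤ) • cartanElt k (Y⟦(1 : ℤ)⟧) (hY.shift 1) =
        ((Nat.card k - 1 : ℕ) : ℤ) • w := by
  obtain ⟨n₁, h1, h1'⟩ := exists_card_triangleSet_eq k hX hY (hZ.shift 1)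
  obtain ⟨n₂, h2, h2'⟩ := exists_card_triangleSet_eq k hY hZ (hX.shift 1)
  obtain ⟨n₃, h3, h3'⟩ := exists_card_triangleSet_eq k hZ hX (hY.shift 1)
  have e1 := card_triangleSet_cycle hper X Y Z
  have e2 := card_triangleSet_cycle hper Y Z X
  -- Rotation identifies the three sets of triangles, whose cardinalities are divisible by different
  -- pairs of the numbers `q ^ d - 1`.
  have f1 : unitCard k X * n₁ = unitCard k Z * n₂ := by
    apply unitCard_mul_cancel k hY
    rw [h1, h2] at e1
    linarith
  have f2 : unitCard k X * n₃ = unitCard k Y * n₂ := by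
    apply unitCard_mul_cancel k hZ
    rw [h2, h3] at e2
    linarith
  obtain ⟨g, t, a, b, c, hg, ha, hb, hc, g1, g2, g3, h0⟩ :=
    exists_proportional Finite.one_lt_card (endDim_pos k hX) f1 f2
  have key : ∀ (F n : ℕ) (d : ℕ), (n : ZMod (Nat.card k - 1)) = F →
      (n : ZMod (Nat.card k - 1)) = t * d →
      ∃ s : ℤ, (F : ℤ) = t * d + ((Nat.card k - 1 : ℕ) : ℤ) * s := by
    intro F n d h h'
    have h4 : (((F : ℤ) - t * d : ℤ) : ZMod (Nat.card k - 1)) = 0 := by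
      push_cast
      rw [← h, h', sub_self]
    obtain ⟨s, hs⟩ := (ZMod.intCast_zmod_eq_zero_iff_dvd _ _).1 h4
    exact ⟨s, by rw [← hs]; ring⟩
  obtain ⟨s₁, hs₁⟩ := key _ _ _ h1' g1
  obtain ⟨s₂, hs₂⟩ := key _ _ _ h2' g2
  obtain ⟨s₃, hs₃⟩ := key _ _ _ h3' g3
  -- If `t ≠ 0` there is a triangle, so that the class of `T Z` is the sum of the classes of `X` and
  -- `Y`. The common divisor `g` can be cancelled in `ℚ ⊗ 𝒢`.
  have hzero : ((t : ℤ) * c) • cartanElt k (Z⟦(1 : ℤ)⟧) (hZ.shift 1) +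
      ((t : ℤ) * a) • cartanElt k (X⟦(1 : ℤ)⟧) (hX.shift 1) +
      ((t : ℤ) * b) • cartanElt k (Y⟦(1 : ℤ)⟧) (hY.shift 1) = 0 := by
    rcases Nat.eq_zero_or_pos n₂ with hn | hn
    · simp [h0 hn]
    · have hcard : Nat.card (TriangleSet X Y (Z⟦(1 : ℤ)⟧)) ≠ 0 := by
        rw [e1, h2]
        have := unitCard_pos k hY
        have := unitCard_pos k hZ
        positivity
      obtain ⟨⟨f, g', h, H⟩⟩ := (Nat.card_ne_zero.1 hcard).1
      have hcls : ratCls (Z⟦(1 : ℤ)⟧) = ratCls X + ratCls Y := Tri.ratCls_eq H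
      have hd : ∀ (X : C) (hX : Indecomposable X) (a : ℕ), endDim k X = g * a →
          (g : ℚ) • ((a : ℤ) • coroot k (X⟦(1 : ℤ)⟧)) = - ratCls X := by
        intro X hX a ha
        rw [← ratCls_shift, ← endDim_smul_coroot k (hX.shift 1), endDim_shift k hX, ha,
          ← Int.cast_smul_eq_zsmul ℚ, smul_smul]
        push_cast
        rfl
      have hsum : (g : ℚ) • ((c : ℤ) • coroot k (Z⟦(1 : ℤ)⟧) + (a : ℤ) • coroot k (X⟦(1 : ℤ)⟧) +
          (b : ℤ) • coroot k (Y⟦(1 : ℤ)⟧)) = 0 := by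
        rw [smul_add, smul_add, hd Z hZ c hc, hd X hX a ha, hd Y hY b hb, ← ratCls_shift Z, hcls]
        abel
      have hsum' := (smul_eq_zero.1 hsum).resolve_left (by exact_mod_cast hg.ne')
      refine Subtype.ext ?_
      change ((t : ℤ) * c) • coroot k (Z⟦(1 : ℤ)⟧) + ((t : ℤ) * a) • coroot k (X⟦(1 : ℤ)⟧) +
        ((t : ℤ) * b) • coroot k (Y⟦(1 : ℤ)⟧) = 0
      rw [mul_smul, mul_smul, mul_smul, ← smul_add, ← smul_add, hsum', smul_zero]
  refine ⟨s₁ • cartanElt k (Z⟦(1 : ℤ)⟧) (hZ.shift 1) + s₂ • cartanElt k (X⟦(1 : ℤ)⟧) (hX.shift 1) +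
    s₃ • cartanElt k (Y⟦(1 : ℤ)⟧) (hY.shift 1), ?_⟩
  rw [hs₁, hs₂, hs₃, add_smul, add_smul, add_smul, smul_add, smul_add, smul_smul, smul_smul,
    smul_smul, ← sub_eq_zero, ← hzero]
  abel

end TriangleCount

/-! ### The Jacobi identity modulo `q - 1` -/

section Jacobi

open scoped Classical

variable {C : Type u} [Category.{v} C] [Preadditive C] [HasZeroObject C] [HasShift C ℤ]
  [∀ n : ℤ, (shiftFunctor C n).Additive] [Pretriangulated C]
  [IsIdempotentComplete C] [IsTriangulated C] [∀ X Y : C, Finite (X ⟶ Y)]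
variable {k : Type w} [Field k] [Finite k] [Linear k C] [∀ n : ℤ, (shiftFunctor C n).Linear k]

/-- The Jacobi expression of a bilinear map. -/
def jacobiator {V : Type*} [AddCommGroup V] (B : V →ₗ[ℤ] V →ₗ[ℤ] V) (x y z : V) : V :=
  B (B x y) z + B (B y z) x + B (B z x) y

lemma jacobiator_cycle {V : Type*} [AddCommGroup V] (B : V →ₗ[ℤ] V →ₗ[ℤ] V) (x y z : V) :
    jacobiator B x y z = jacobiator B y z x := by
  unfold jacobiator
  abel

/-- To check that the Jacobi expression takes values in a subgroup, it suffices to consider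
generators. -/
lemma jacobiator_mem_of_span {V : Type*} [AddCommGroup V] (B : V →ₗ[ℤ] V →ₗ[ℤ] V) {S : Set V}
    (hS : Submodule.span ℤ S = ⊤) (I : Submodule ℤ V)
    (h : ∀ x ∈ S, ∀ y ∈ S, ∀ z ∈ S, jacobiator B x y z ∈ I) (x y z : V) :
    jacobiator B x y z ∈ I := by
  have key : ∀ y z : V, (∀ x ∈ S, jacobiator B x y z ∈ I) → ∀ x, jacobiator B x y z ∈ I := by
    intro y z h x
    have hx : x ∈ Submodule.span ℤ S := hS ▸ Submodule.mem_top
    induction hx using Submodule.span_induction with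
    | mem x hx => exact h x hx
    | zero => simp [jacobiator]
    | add a b _ _ ha hb =>
      have : jacobiator B (a + b) y z = jacobiator B a y z + jacobiator B b y z := by
        simp only [jacobiator, map_add, LinearMap.add_apply]
        abel
      rw [this]
      exact I.add_mem ha hb
    | smul c a _ ha =>
      have : jacobiator B (c • a) y z = c • jacobiator B a y z := by
        simp only [jacobiator, map_smul, LinearMap.smul_apply, smul_add]
      rw [this]
      exact I.smul_mem c ha
  refine key y z (fun x hx => ?_) x
  rw [jacobiator_cycle]
  refine key z x (fun y hy => ?_) y
  rw [jacobiator_cycle]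
  refine key x y (fun z hz => ?_) z
  rw [jacobiator_cycle]
  exact h x hx y hy z hz

lemma span_generators :
    Submodule.span ℤ ({x : HallLie k C | ∃ h : cartan k C, x = (h, 0)} ∪
      {x | ∃ ℓ : IndClass C, x = (0, Finsupp.single ℓ 1)}) = ⊤ := by
  rw [eq_top_iff]
  rintro ⟨h, n⟩ -
  have h1 : ((h, n) : HallLie k C) = (h, 0) + LinearMap.inr ℤ _ _ n := by simp
  rw [h1]
  refine Submodule.add_mem _ (Submodule.subset_span (Or.inl ⟨h, rfl⟩)) ?_
  induction n using Finsupp.induction_linear with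
  | zero =>
    rw [map_zero]
    exact Submodule.zero_mem _
  | add f g hf hg =>
    rw [map_add]
    exact Submodule.add_mem _ (hf (by simp)) (hg (by simp))
  | single ℓ a =>
    have h : Finsupp.single ℓ a = a • Finsupp.single ℓ (1 : ℤ) := by simp
    rw [h, map_smul]
    exact Submodule.smul_mem _ _ (Submodule.subset_span (Or.inr ⟨ℓ, rfl⟩))

lemma hallBracket_antisymm (hper : TwoPeriodic C) (ω : cartan k C →ₗ[ℤ] (IndClass C → ℤ))
    (x y : HallLie k C) : hallBracket ω x y = - hallBracket ω y x := by
  rw [hallBracket_apply, hallBracket_apply, nilBilin_antisymm k hper, neg_add]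
  congr 1
  rw [Prod.neg_mk, neg_sub, neg_zero]

lemma jacobiator_self (hper : TwoPeriodic C) (ω : cartan k C →ₗ[ℤ] (IndClass C → ℤ))
    (x z : HallLie k C) : jacobiator (hallBracket ω) x x z = 0 := by
  unfold jacobiator
  rw [hallBracket_self hper, hallBracket_antisymm hper ω z x]
  simp

lemma pointwise_smul_single (f : IndClass C → ℤ) (ℓ : IndClass C) :
    f • Finsupp.single ℓ (1 : ℤ) = f ℓ • Finsupp.single ℓ (1 : ℤ) := by
  refine Finsupp.ext fun m => ?_
  by_cases h : ℓ = m
  · subst h; simp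
  · simp [h]

variable {form : (ℚ ⊗[ℤ] GrothendieckGroup C) →ₗ[ℚ] (ℚ ⊗[ℤ] GrothendieckGroup C) →ₗ[ℚ] ℚ}
  {ω : cartan k C →ₗ[ℤ] (IndClass C → ℤ)}

lemma weight_eq_neg (hω : ∀ h ℓ, (ω h ℓ : ℚ) = form h (ratCls ℓ.out.1)) (h : cartan k C)
    {ℓ ℓ' : IndClass C} (e : ℓ.out.1 ≅ ℓ'.out.1⟦(1 : ℤ)⟧) : ω h ℓ = - ω h ℓ' := by
  apply Int.cast_injective (α := ℚ)
  rw [Int.cast_neg, hω, hω, ratCls_congr e, ratCls_shift, map_neg]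

lemma weight_eq_add (hω : ∀ h ℓ, (ω h ℓ : ℚ) = form h (ratCls ℓ.out.1)) (h : cartan k C)
    {ℓ ℓ' m : IndClass C} (hm : hallNumber ℓ.out.1 ℓ'.out.1 m.out.1 ≠ 0) :
    ω h m = ω h ℓ + ω h ℓ' := by
  obtain ⟨f, g, h', H⟩ := exists_tri_of_hallNumber_ne_zero hm
  apply Int.cast_injective (α := ℚ)
  rw [Int.cast_add, hω, hω, hω, H.ratCls_eq, map_add]

/-- `𝔥` acts by derivations, since the bracket is graded by the Grothendieck group. -/
lemma jacobiator_cartan_nil_nil (hper : TwoPeriodic C)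
    (hω : ∀ h ℓ, (ω h ℓ : ℚ) = form h (ratCls ℓ.out.1)) (h : cartan k C) (ℓ ℓ' : IndClass C) :
    jacobiator (hallBracket ω) (h, 0) (0, Finsupp.single ℓ 1) (0, Finsupp.single ℓ' 1) = 0 := by
  have h1 : jacobiator (hallBracket ω) (h, 0) (0, Finsupp.single ℓ 1) (0, Finsupp.single ℓ' 1) =
      (0, ω h • (nilBracket k ℓ ℓ').2) - (ω h ℓ + ω h ℓ') • nilBracket k ℓ ℓ' := by
    unfold jacobiator
    simp only [hallBracket_apply, map_zero, LinearMap.zero_apply, zero_smul, smul_zero, zero_sub,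
      sub_zero, add_zero, zero_add, map_neg, map_smul, pointwise_smul_single, nilBilin_single,
      LinearMap.neg_apply, LinearMap.smul_apply, Prod.mk_zero_zero]
    rw [nilBracket_antisymm k hper ℓ' ℓ, add_smul, smul_neg]
    abel
  rw [h1, sub_eq_zero]
  refine Prod.ext ?_ (Finsupp.ext fun m => ?_)
  · change 0 = (ω h ℓ + ω h ℓ') • (if _ then _ else _ : cartan k C)
    split_ifs with e
    · rw [weight_eq_neg hω h e.some, neg_add_cancel, zero_smul]
    · rw [smul_zero]
  · change ω h m * ((hallNumber _ _ _ : ℤ) - hallNumber _ _ _) =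
      (ω h ℓ + ω h ℓ') * ((hallNumber _ _ _ : ℤ) - hallNumber _ _ _)
    by_cases h1 : hallNumber ℓ.out.1 ℓ'.out.1 m.out.1 = 0
    · by_cases h2 : hallNumber ℓ'.out.1 ℓ.out.1 m.out.1 = 0
      · rw [h1, h2]; simp
      · rw [weight_eq_add hω h h2, add_comm]
    · rw [weight_eq_add hω h h1]

lemma jacobiator_cartan_cartan (ω : cartan k C →ₗ[ℤ] (IndClass C → ℤ)) (h h' : cartan k C)
    (n : IndClass C →₀ ℤ) :
    jacobiator (hallBracket ω) (h, 0) (h', 0) (0, n) = 0 := by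
  unfold jacobiator
  simp only [hallBracket_apply, map_zero, LinearMap.zero_apply, smul_zero, zero_sub,
    sub_zero, add_zero, zero_add, Prod.mk_zero_zero, smul_neg]
  rw [Prod.mk_add_mk, smul_smul, smul_smul, mul_comm, neg_add_cancel, add_zero]
  rfl

lemma jacobiator_cartan (ω : cartan k C →ₗ[ℤ] (IndClass C → ℤ)) (h h' h'' : cartan k C) :
    jacobiator (hallBracket ω) (h, 0) (h', 0) (h'', 0) = 0 := by
  unfold jacobiator
  simp [hallBracket_apply]

/-- The `𝔥`-component of `[n, u_Z]` only involves the coefficient of `n` at `T Z`. -/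
lemma nilBilin_single_fst (n : IndClass C →₀ ℤ) (ℓ : IndClass C) :
    (nilBilin k n (Finsupp.single ℓ 1)).1 =
      n (indClass (ℓ.out.1⟦(1 : ℤ)⟧) (ℓ.out.2.shift 1)) •
        cartanElt k (ℓ.out.1⟦(1 : ℤ)⟧) (ℓ.out.2.shift 1) := by
  induction n using Finsupp.induction_linear with
  | zero => simp
  | add f g hf hg =>
    rw [map_add, LinearMap.add_apply, Prod.fst_add, hf, hg, Finsupp.add_apply, add_smul]
  | single m a =>
    have h : Finsupp.single m a = a • Finsupp.single m (1 : ℤ) := by simp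
    rw [h, map_smul, LinearMap.smul_apply, nilBilin_single, Prod.smul_fst, Finsupp.smul_apply,
      smul_assoc]
    congr 1
    change (if _ then _ else _) = _
    split_ifs with e
    · have : m = indClass (ℓ.out.1⟦(1 : ℤ)⟧) (ℓ.out.2.shift 1) := by
        rw [← indClass_out m]
        exact Quotient.sound e
      rw [← this, Finsupp.single_eq_same, one_smul]
      exact Subtype.ext (coroot_congr k m.out.2 e.some)
    · rw [Finsupp.single_eq_of_ne, zero_smul]
      intro h
      apply e
      have := nonempty_iso_indClass_out (ℓ.out.1⟦(1 : ℤ)⟧) (ℓ.out.2.shift 1)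
      rwa [h] at this

/-- The `𝔫`-component of `[∑ F_{XY}^L u_L, u_Z]`. -/
lemma natCast_nilBilin_hallFinsupp_snd {R : Type*} [CommRing R] (X Y : C) (ℓ m : IndClass C) :
    (((nilBilin k (hallFinsupp X Y) (Finsupp.single ℓ 1)).2 m : ℤ) : R) =
      (∑ᶠ a : IndClass C, (hallNumber X Y a.out.1 : R) * hallNumber a.out.1 ℓ.out.1 m.out.1) -
      ∑ᶠ a : IndClass C, (hallNumber X Y a.out.1 : R) * hallNumber ℓ.out.1 a.out.1 m.out.1 := by
  have h1 : (nilBilin k (hallFinsupp X Y) (Finsupp.single ℓ 1)).2 m =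
      ∑ a ∈ (hallFinsupp X Y).support, (hallNumber X Y a.out.1 : ℤ) *
        (hallNumber a.out.1 ℓ.out.1 m.out.1 - hallNumber ℓ.out.1 a.out.1 m.out.1) := by
    unfold nilBilin
    rw [Finsupp.linearCombination_apply, Finsupp.sum, LinearMap.sum_apply, Prod.snd_sum,
      Finsupp.finsetSum_apply]
    refine Finset.sum_congr rfl fun a _ => ?_
    rw [LinearMap.smul_apply, Finsupp.linearCombination_single, one_smul]
    rfl
  have h2 : ∀ v : IndClass C → R, (∑ᶠ a : IndClass C, (hallNumber X Y a.out.1 : R) * v a) =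
      ∑ a ∈ (hallFinsupp X Y).support, (hallNumber X Y a.out.1 : R) * v a := by
    intro v
    refine finsum_eq_sum_of_support_subset _ fun a ha => ?_
    rw [Finset.mem_coe, Finsupp.mem_support_iff, hallFinsupp_apply]
    intro h0
    apply ha
    simp only [Nat.cast_eq_zero] at h0
    simp [h0]
  rw [h1, h2, h2, ← Finset.sum_sub_distrib]
  push_cast
  exact Finset.sum_congr rfl fun a _ => by ring

/-- Elements of `𝔤` divisible by `m` can be recognized on coordinates. -/
lemma mem_range_lsmul {m : ℕ} (x : HallLie k C) (w : cartan k C) (h1 : x.1 = (m : ℤ) • w)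
    (h2 : ∀ ℓ, (x.2 ℓ : ZMod m) = 0) :
    x ∈ LinearMap.range (LinearMap.lsmul ℤ (HallLie k C) (m : ℤ)) := by
  refine ⟨(w, x.2.mapRange (fun a => a / (m : ℤ)) (by simp)), ?_⟩
  refine Prod.ext h1.symm (Finsupp.ext fun ℓ => ?_)
  exact Int.mul_ediv_cancel' ((ZMod.intCast_zmod_eq_zero_iff_dvd _ _).1 (h2 ℓ))

/-- The Jacobi identity modulo `q - 1` for three basis elements of `𝔫`. The `𝔥`-component is
`exists_sum_cartanElt_eq` for both orientations; in the `𝔫`-component the action of `[u_X, u_Y]` in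
`𝔥` on `u_Z` cancels the terms on the right hand side of `sum_assocCoeff`. -/
theorem jacobiator_nil (hper : TwoPeriodic C)
    {form : (ℚ ⊗[ℤ] GrothendieckGroup C) →ₗ[ℚ] (ℚ ⊗[ℤ] GrothendieckGroup C) →ₗ[ℚ] ℚ}
    (hform : IsEulerForm k form) {ω : cartan k C →ₗ[ℤ] (IndClass C → ℤ)}
    (hω : ∀ h ℓ, (ω h ℓ : ℚ) = form h (ratCls ℓ.out.1)) (a b c : IndClass C) :
    jacobiator (hallBracket ω) (0, Finsupp.single a 1) (0, Finsupp.single b 1)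
      (0, Finsupp.single c 1) ∈
      LinearMap.range (LinearMap.lsmul ℤ (HallLie k C) ((Nat.card k - 1 : ℕ) : ℤ)) := by
  -- Since the bracket is alternating, the Jacobi expression vanishes if two arguments coincide.
  by_cases hab : a = b
  · subst hab
    rw [jacobiator_self hper]
    exact Submodule.zero_mem _
  by_cases hbc : b = c
  · subst hbc
    rw [jacobiator_cycle, jacobiator_self hper]
    exact Submodule.zero_mem _
  by_cases hac : a = c
  · subst hac
    rw [jacobiator_cycle, jacobiator_cycle, jacobiator_self hper]
    exact Submodule.zero_mem _
  have hne : ∀ {ℓ ℓ' : IndClass C}, ℓ ≠ ℓ' → ¬ Nonempty (ℓ.out.1 ≅ ℓ'.out.1) := by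
    intro ℓ ℓ' h e
    apply h
    rw [← indClass_out ℓ, ← indClass_out ℓ']
    exact Quotient.sound e
  have h1 : ∀ ℓ ℓ' ℓ'' : IndClass C, hallBracket ω (hallBracket ω (0, Finsupp.single ℓ 1)
      (0, Finsupp.single ℓ' 1)) (0, Finsupp.single ℓ'' 1) =
      nilBilin k (hallFinsupp ℓ.out.1 ℓ'.out.1) (Finsupp.single ℓ'' 1) -
      nilBilin k (hallFinsupp ℓ'.out.1 ℓ.out.1) (Finsupp.single ℓ'' 1) -
      (0, ω (nilBracket k ℓ ℓ').1 ℓ'' • Finsupp.single ℓ'' 1) := by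
    intro ℓ ℓ' ℓ''
    have h0 : hallBracket ω (0, Finsupp.single ℓ 1) (0, Finsupp.single ℓ' 1) =
        nilBracket k ℓ ℓ' := by
      simp [hallBracket_apply]
    rw [h0, hallBracket_apply, ← LinearMap.sub_apply, ← map_sub,
      sub_eq_add_neg (nilBilin k _ (Finsupp.single ℓ'' 1))]
    change nilBilin k (hallFinsupp ℓ.out.1 ℓ'.out.1 - hallFinsupp ℓ'.out.1 ℓ.out.1) _ + _ = _
    congr 1
    rw [pointwise_smul_single, Prod.neg_mk, neg_zero, map_zero, zero_smul, zero_sub]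
  -- The weight of `[u_X, u_Y]` in `𝔥` on `u_Z` is the correction term of the associators.
  have h2 : ∀ ℓ ℓ' ℓ'' m : IndClass C,
      (((ω (nilBracket k ℓ ℓ').1 ℓ'' • Finsupp.single ℓ'' (1 : ℤ)) m : ℤ) :
        ZMod (Nat.card k - 1)) = pairTerm k ℓ.out.1 ℓ'.out.1 ℓ''.out.1 m.out.1 := by
    intro ℓ ℓ' ℓ'' m
    unfold pairTerm
    change ((ω (if _ then _ else _) ℓ'' * Finsupp.single ℓ'' (1 : ℤ) m : ℤ) :
        ZMod (Nat.card k - 1)) = _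
    by_cases hm : ℓ'' = m
    · subst hm
      split_ifs with h h' h'
      · obtain ⟨n, hn, hn'⟩ := exists_eulerSum_eq k hper ℓ.out.2 h.some ℓ''.out.1
        rw [← hn', Finsupp.single_eq_same, mul_one]
        congr 1
        apply Int.cast_injective (α := ℚ)
        rw [hω, ← form_coroot_ratCls k hform ℓ.out.2 hn]
        rfl
      · exact absurd ⟨⟨Iso.refl _⟩, h⟩ h'
      · exact absurd h'.2 h
      · simp
    · rw [Finsupp.single_eq_of_ne (Ne.symm hm), mul_zero, Int.cast_zero, if_neg]
      exact fun h => hne (Ne.symm hm) h.1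
  obtain ⟨w, hw⟩ := exists_sum_cartanElt_eq k hper a.out.2 b.out.2 c.out.2
  obtain ⟨w', hw'⟩ := exists_sum_cartanElt_eq k hper b.out.2 a.out.2 c.out.2
  refine mem_range_lsmul _ (w - w') ?_ fun m => ?_
  · unfold jacobiator
    simp only [h1, Prod.fst_add, Prod.fst_sub, nilBilin_single_fst, hallFinsupp_apply]
    have h3 : ∀ (X Y : C) (ℓ : IndClass C), hallNumber X Y
        (indClass (ℓ.out.1⟦(1 : ℤ)⟧) (ℓ.out.2.shift 1)).out.1 =
          hallNumber X Y (ℓ.out.1⟦(1 : ℤ)⟧) := fun X Y ℓ =>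
      hallNumber_congr (Iso.refl X) (Iso.refl Y) (nonempty_iso_indClass_out _ _).some
    rw [smul_sub, ← hw, ← hw']
    simp only [h3]
    abel
  · unfold jacobiator
    simp only [h1, Prod.snd_add, Prod.snd_sub, Finsupp.add_apply, Finsupp.sub_apply, Int.cast_add,
      Int.cast_sub, natCast_nilBilin_hallFinsupp_snd, h2]
    have h4 := sum_assocCoeff k a.out.2 b.out.2 c.out.2 m.out.2 hper.nonempty_iso (hne hab)
      (hne hbc) (hne hac)
    unfold assocCoeff at h4
    linear_combination h4

/-- The Jacobi identity holds modulo `q - 1`. -/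
theorem jacobiator_mem (hper : TwoPeriodic C)
    {form : (ℚ ⊗[ℤ] GrothendieckGroup C) →ₗ[ℚ] (ℚ ⊗[ℤ] GrothendieckGroup C) →ₗ[ℚ] ℚ}
    (hform : IsEulerForm k form) {ω : cartan k C →ₗ[ℤ] (IndClass C → ℤ)}
    (hω : ∀ h ℓ, (ω h ℓ : ℚ) = form h (ratCls ℓ.out.1)) (x y z : HallLie k C) :
    jacobiator (hallBracket ω) x y z ∈
      LinearMap.range (LinearMap.lsmul ℤ (HallLie k C) ((Nat.card k - 1 : ℕ) : ℤ)) := by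
  refine jacobiator_mem_of_span _ span_generators _ ?_ x y z
  rintro _ (⟨h, rfl⟩ | ⟨a, rfl⟩) _ (⟨h', rfl⟩ | ⟨b, rfl⟩) _ (⟨h'', rfl⟩ | ⟨c, rfl⟩)
  · rw [jacobiator_cartan]
    exact Submodule.zero_mem _
  · rw [jacobiator_cartan_cartan]
    exact Submodule.zero_mem _
  · rw [jacobiator_cycle, jacobiator_cycle, jacobiator_cartan_cartan]
    exact Submodule.zero_mem _
  · rw [jacobiator_cartan_nil_nil hper hω]
    exact Submodule.zero_mem _
  · rw [jacobiator_cycle, jacobiator_cartan_cartan]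
    exact Submodule.zero_mem _
  · rw [jacobiator_cycle, jacobiator_cartan_nil_nil hper hω]
    exact Submodule.zero_mem _
  · rw [jacobiator_cycle, jacobiator_cycle, jacobiator_cartan_nil_nil hper hω]
    exact Submodule.zero_mem _
  · exact jacobiator_nil hper hform hω a b c

end Jacobi

/-! ### The Lie algebra modulo `q - 1` -/

section LieAlgebra

/-- The bilinear map induced on the quotient of `V` by multiples of `m`. -/
def modNBilin {V : Type*} [AddCommGroup V] (B : V →ₗ[ℤ] V →ₗ[ℤ] V) (m : ℕ) :
    ModN V m →ₗ[ℤ] ModN V m →ₗ[ℤ] ModN V m :=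
  Submodule.liftQ _
    { toFun := fun x => Submodule.mapQ _ _ (B x) (by
        rintro _ ⟨y, rfl⟩
        exact ⟨B x y, by simp⟩)
      map_add' := fun x y => by
        refine Submodule.linearMap_qext _ (LinearMap.ext fun z => ?_)
        simp
      map_smul' := fun c x => by
        refine Submodule.linearMap_qext _ (LinearMap.ext fun z => ?_)
        simp } (by
    rintro _ ⟨y, rfl⟩
    refine Submodule.linearMap_qext _ (LinearMap.ext fun z => ?_)
    exact (Submodule.Quotient.mk_eq_zero _).2 ⟨B y z, by simp⟩)

lemma modNBilin_mkQ {V : Type*} [AddCommGroup V] (B : V →ₗ[ℤ] V →ₗ[ℤ] V) (m : ℕ) (x y : V) :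
    modNBilin B m (ModN.mkQ m x) (ModN.mkQ m y) = ModN.mkQ m (B x y) := rfl

/-- An alternating product satisfying the Jacobi identity modulo `m` induces a Lie algebra
structure on the quotient by multiples of `m`. -/
theorem exists_lieAlgebra_modN {V : Type u} [AddCommGroup V] (B : V →ₗ[ℤ] V →ₗ[ℤ] V) (m : ℕ)
    (halt : ∀ x, B x x = 0)
    (hjac : ∀ x y z, jacobiator B x y z ∈ LinearMap.range (LinearMap.lsmul ℤ V (m : ℤ))) :
    ∃ (𝔏 : Type u) (_ : LieRing 𝔏) (_ : LieAlgebra (ZMod m) 𝔏) (e : ModN V m ≃ₗ[ZMod m] 𝔏),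
      ∀ x y : V, ⁅e (ModN.mkQ m x), e (ModN.mkQ m y)⁆ = e (ModN.mkQ m (B x y)) := by
  have hsurj : ∀ x : ModN V m, ∃ y, ModN.mkQ m y = x := Submodule.mkQ_surjective _
  have hskew : ∀ x y, B x y = - B y x := fun x y => by
    have := halt (x + y)
    simp only [map_add, LinearMap.add_apply, halt, zero_add, add_zero] at this
    exact eq_neg_of_add_eq_zero_right this
  let L : LieRing (ModN V m) :=
    { bracket := fun x y => modNBilin B m x y
      add_lie := fun x y z => by
        change modNBilin B m (x + y) z = modNBilin B m x z + modNBilin B m y z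
        rw [map_add, LinearMap.add_apply]
      lie_add := fun x y z => map_add (modNBilin B m x) y z
      lie_self := fun x => by
        obtain ⟨x, rfl⟩ := hsurj x
        change modNBilin B m _ _ = 0
        rw [modNBilin_mkQ, halt, map_zero]
      leibniz_lie := fun x y z => by
        obtain ⟨x, rfl⟩ := hsurj x
        obtain ⟨y, rfl⟩ := hsurj y
        obtain ⟨z, rfl⟩ := hsurj z
        change modNBilin B m _ (modNBilin B m _ _) = modNBilin B m (modNBilin B m _ _) _ +
          modNBilin B m _ (modNBilin B m _ _)
        simp only [modNBilin_mkQ]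
        rw [← sub_eq_zero, ← map_add, ← map_sub]
        refine (Submodule.Quotient.mk_eq_zero _).2 ?_
        have h : B x (B y z) - (B (B x y) z + B y (B x z)) = - jacobiator B x y z := by
          unfold jacobiator
          rw [hskew x (B y z), hskew y (B x z), hskew x z, map_neg, LinearMap.neg_apply]
          abel
        rw [h]
        exact Submodule.neg_mem _ (hjac x y z) }
  let A : LieAlgebra (ZMod m) (ModN V m) :=
    { lie_smul := fun c x y => ZMod.map_smul (modNBilin B m x) c y }
  exact ⟨ModN V m, L, A, LinearEquiv.refl _ _, fun x y => rfl⟩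

end LieAlgebra

end PengXiao

end

theorem mainTheorem1 (k : Type w) [Field k] [Finite k]
    (C : Type u) [Category.{v} C] [Preadditive C] [Linear k C] [HasZeroObject C] [HasShift C ℤ]
    [∀ n : ℤ, (shiftFunctor C n).Additive] [∀ n : ℤ, (shiftFunctor C n).Linear k]
    [Pretriangulated C] [IsTriangulated C] [IsIdempotentComplete C]
    (hfin : PengXiao.Finitary C) (hper : PengXiao.TwoPeriodic C)
    (hproper : PengXiao.ProperGrothendieckGroup C) :
    ∃ (form : (ℚ ⊗[ℤ] PengXiao.GrothendieckGroup C) →ₗ[ℚ]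
          (ℚ ⊗[ℤ] PengXiao.GrothendieckGroup C) →ₗ[ℚ] ℚ)
      (B : PengXiao.HallLie k C →ₗ[ℤ] PengXiao.HallLie k C →ₗ[ℤ] PengXiao.HallLie k C),
      PengXiao.IsEulerForm k form ∧ PengXiao.IsHallBracket k form B ∧ (∀ x, B x x = 0) ∧
      ∃ (𝔏 : Type u) (_ : LieRing 𝔏) (_ : LieAlgebra (ZMod (Nat.card k - 1)) 𝔏)
        (e : ModN (PengXiao.HallLie k C) (Nat.card k - 1) ≃ₗ[ZMod (Nat.card k - 1)] 𝔏),
        ∀ x y : PengXiao.HallLie k C,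
          ⁅e (ModN.mkQ _ x), e (ModN.mkQ _ y)⁆ = e (ModN.mkQ _ (B x y)) := by
  have := hfin.1
  obtain ⟨form, hform⟩ := PengXiao.exists_eulerForm (C := C) k hper
  obtain ⟨ω, hω⟩ := PengXiao.exists_weight hper hform
  exact ⟨form, PengXiao.hallBracket ω, hform, PengXiao.isHallBracket_hallBracket hper hproper ω hω,
    PengXiao.hallBracket_self hper ω, PengXiao.exists_lieAlgebra_modN _ _
      (PengXiao.hallBracket_self hper ω) (PengXiao.jacobiator_mem hper hform hω)⟩
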